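/- Let $M=\mathbb C^{12}$ with coordinates $b_i,a_i,c_i$ ($i=1,\dots,4$), and let $$L(\mu)=\begin{pmatrix} b_1&-\mu&c_3/\mu^2&a_4/\mu\\ a_1/\mu&b_2&-\mu&c_4/\mu^2\\ c_1/\mu^2&a_2/\mu&b_3&-\mu\\ -\mu&c_2/\mu^2&a_3/\mu&b_4\end{pmatrix}$$ be the Lax matrix of the generalized Toda lattice Toda$^4_3$. Its characteristic polynomial expands as $$\det(\lambda\mathbf 1-L(\mu))=\lambda^4-\mu^4+H(\lambda)+\frac{K(\lambda)-\lambda^2J_1}{\mu^4}+\frac{J_2}{\mu^8},\qquad H(\lambda)=-(\lambda^3H_0-\lambda^2H_1+\lambda H_2-H_3),\quad K(\lambda)=K_0\lambda+K_1,$$ with $H_0=\sum_i b_i$, $J_1=c_1c_3+c_2c_4$, $J_2=c_1c_2c_3c_4$. Let $$P=\begin{pmatrix}0&A_1&C_1\\-A_1^T&C_2&0\\-C_1^T&0&0\end{pmatrix},\qquad P'=\begin{pmatrix}A_2&B_1&C_3\\-B_1^T&A_3&C_4\\-C_3^T&-C_4^T&A_4\end{pmatrix}$$ be its two compatible Poisson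 tensors (matrices of the brackets of the coordinates ordered as $b,a,c$), given by the non-zero brackets below and by antisymmetry, where indices are taken modulo $4$, $i=1,\dots,4$. For $P$: $$\{b_i,a_i\}=-a_i,\ \{b_{i+1},a_i\}=a_i,\ \{b_i,c_i\}=-c_i,\ \{b_{i+2},c_i\}=c_i,\ \{a_i,a_{i+1}\}=-c_i .$$ For $P'$: $$\{b_i,b_{i+1}\}'=a_i,\ \{b_i,a_i\}'=-b_ia_i,\ \{b_{i+1},a_i\}'=b_{i+1}a_i,\ \{b_i,a_{i+1}\}'=c_i,\ \{b_i,a_{i+2}\}'=-c_{i+2},$$ $$\{b_i,c_i\}'=-b_ic_i,\ \{b_{i+2},c_i\}'=b_{i+2}c_i,\ \{a_i,a_{i+1}\}'=-b_{i+1}c_i-a_ia_{i+1},\ \{c_i,c_{i+1}\}'=-c_ic_{i+1},$$ $$\{a_i,c_i\}'=-a_ic_i,\ \{a_i,c_{i+1}\}'=-a_ic_{i+1},\ \{a_i,c_{i+2}\}'=a_ic_{i+2},\ \{a_i,c_{i+3}\}'=a_ic_{i+3}.$$ Put $Z_1=-\partial/\partial b_4$, $Z_2=\partial/\partial a_4$,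 $(f_1,f_2)=(H_0,K_0)$, $G_{ij}=L_{Z_i}f_j$, $X_1^i=P'df_i$ and, where $\det G=a_1c_2+a_3c_1\neq0$, $$Q=P'-\sum_{i,j}(G^{-1})_{ij}\,Z_j\wedge X_1^i,\qquad (v\wedge w)\xi=\xi(v)w-\xi(w)v .$$ For $\kappa\in\mathbb C^4$ let $S_\kappa=\{H_0=\kappa_1,K_0=\kappa_2,J_1=\kappa_3,J_2=\kappa_4\}$; call $\kappa$ generic if $\kappa_4\ne0$ and $\kappa_3^2\neq4\kappa_4$. Put $$\mathcal G(\lambda)=\begin{pmatrix}L_{Z_1}H(\lambda)&L_{Z_2}H(\lambda)\\L_{Z_1}K(\lambda)&L_{Z_2}K(\lambda)\end{pmatrix},\qquad \rho(\lambda)=-\mathcal G_{22}/\mathcal G_{12},\quad \sigma(\lambda)=-\mathcal G_{21}/\mathcal G_{11}.$$ Let $R\subset M$ be the set of points that lie on some $S_{\kappa'}$ with $\kappa'$ generic and at which $\det G\ne0$ and $\operatorname{Det}\mathcal G(\lambda)$ has no multiple root, and let $R'\subset R$ be the set of those points at which, moreover, $\mathcal G_{12}$ and $\mathcal G_{22}$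 do not vanish at any root of $\operatorname{Det}\mathcal G(\lambda)$. Then for every generic $\kappa$: 1. $S_\kappa$ is non-empty; at each of its points the common kernel of $dH_0,dK_0,dJ_1,dJ_2$ (the tangent space of $S_\kappa$) is $8$-dimensional, and $P$ restricts to an invertible (symplectic) tensor on it. Where $\det G\ne0$, $Q$ restricts to $S_\kappa$ too, so that $N^*=P^{-1}Q$ (on the cotangent spaces of $S_\kappa$) and its transpose $N=QP^{-1}$ (on the tangent spaces) are defined; there $\operatorname{Det}\mathcal G(\lambda)$ has degree $4$, its roots are the eigenvalues of $N$, and the Hamiltonians $H_1,H_2,H_3,K_1$ of the Toda$^4_3$ flows are in involution for the brackets of both $P$ and $Q$ on $S_\kappa$. 2. $R$ and $R'$ are open, and $R'\cap S_\kappa$ is dense in $S_\kappa$. On $S_\kappa\cap R$ the minimal polynomial $\Delta_N(\lambda)=\lambda^4-\sum_{i=1}^4p_i\lambda^{4-i}$ of $N$ is $\operatorname{Det}\mathcal G(\lambda)$ divided by its leading coefficient, and the $p_i$ are holomorphic. On $S_\kappa\cap R'$ they are functionally independent: the restrictions of $dp_1,\dots,dp_4$ to the tangent spaces of $S_\kappa$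 are linearly independent. 3. On $R$, $\rho(\lambda)$ and $\sigma(\lambda)$ are Nijenhuis functions generators away from their poles, i.e. for $\Phi=\rho$ and for $\Phi=\sigma$ there is a one-form $\alpha_\Phi$, holomorphic in the point and in $\lambda$ where the denominator of $\Phi(\lambda)$ does not vanish, with $N^*d\Phi(\lambda)=\lambda\,d\Phi(\lambda)+\Delta_N(\lambda)\,\alpha_\Phi$ on the leaves. 4. $\displaystyle \rho(\lambda)=-\frac{(-c_1a_3-a_1c_2)\lambda+c_2a_1b_3-a_1a_2a_3+c_1b_2a_3+c_1c_2}{\lambda^2-(b_2+b_3)\lambda+b_2b_3+a_2}$. 5. Near every point of $S_\kappa\cap R'$ there are continuous branches $\lambda_1,\dots,\lambda_4$ of the roots of $\operatorname{Det}\mathcal G(\lambda)$ and $\mu_i$ of $\log\rho(\lambda_i)$; and all such branches are, near that point, Darboux–Nijenhuis coordinates on $S_\kappa$ for the restrictions of $P$ and $Q$: they are holomorphic coordinates on $S_\kappa$, the $\lambda_i$ are pairwise distinct, $\{\mu_i,\lambda_j\}=\delta_{ij}$, $\{\lambda_i,\lambda_j\}=\{\mu_i,\mu_j\}=0$ for the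 bracket of $P$, and $$N=\sum_{i=1}^4\lambda_i\Big(\frac{\partial}{\partial\lambda_i}\otimes d\lambda_i+\frac{\partial}{\partial\mu_i}\otimes d\mu_i\Big).$$ -/

import Mathlib

open Polynomial Matrix

noncomputable section

namespace Toda

/-! ### Phase space, Lax matrix, Poisson tensors -/

/-- The coordinates `b₁,…,b₄` (block `0`), `a₁,…,a₄` (block `1`), `c₁,…,c₄` (block `2`);
all indices are shifted by one, so that `b₁` is `b x 0`. -/
abbrev Idx : Type := Fin 3 × Fin 4

/-- The phase space `ℂ¹²`. -/
abbrev M : Type := Idx → ℂ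

abbrev b (x : M) (i : Fin 4) : ℂ := x (0, i)
abbrev a (x : M) (i : Fin 4) : ℂ := x (1, i)
abbrev c (x : M) (i : Fin 4) : ℂ := x (2, i)

/-- The Lax matrix with spectral parameter `μ`. -/
def lax (x : M) (μ : ℂ) : Matrix (Fin 4) (Fin 4) ℂ :=
  !![b x 0, -μ, c x 2 / μ ^ 2, a x 3 / μ;
     a x 0 / μ, b x 1, -μ, c x 3 / μ ^ 2;
     c x 0 / μ ^ 2, a x 1 / μ, b x 2, -μ;
     -μ, c x 1 / μ ^ 2, a x 2 / μ, b x 3]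

def blockA1 (x : M) : Matrix (Fin 4) (Fin 4) ℂ :=
  !![-a x 0, 0, 0, a x 3;
     a x 0, -a x 1, 0, 0;
     0, a x 1, -a x 2, 0;
     0, 0, a x 2, -a x 3]

def blockC1 (x : M) : Matrix (Fin 4) (Fin 4) ℂ :=
  !![-c x 0, 0, c x 2, 0;
     0, -c x 1, 0, c x 3;
     c x 0, 0, -c x 2, 0;
     0, c x 1, 0, -c x 3]

def blockC2 (x : M) : Matrix (Fin 4) (Fin 4) ℂ :=
  !![0, -c x 0, 0, c x 3;
     c x 0, 0, -c x 1, 0;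
     0, c x 1, 0, -c x 2;
     -c x 3, 0, c x 2, 0]

/-- The first (linear) Poisson tensor `P`, as the matrix `P^{ij} = {x^i, x^j}`. -/
def tensorP (x : M) : Matrix Idx Idx ℂ :=
  Matrix.comp (Fin 3) (Fin 3) (Fin 4) (Fin 4) ℂ
    !![0, blockA1 x, blockC1 x;
       -(blockA1 x)ᵀ, blockC2 x, 0;
       -(blockC1 x)ᵀ, 0, 0]

def blockA2 (x : M) : Matrix (Fin 4) (Fin 4) ℂ :=
  !![0, a x 0, 0, -a x 3;
     -a x 0, 0, a x 1, 0;
     0, -a x 1, 0, a x 2;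
     a x 3, 0, -a x 2, 0]

def blockB1 (x : M) : Matrix (Fin 4) (Fin 4) ℂ :=
  !![-(b x 0 * a x 0), c x 0, -c x 2, b x 0 * a x 3;
     b x 1 * a x 0, -(b x 1 * a x 1), c x 1, -c x 3;
     -c x 0, b x 2 * a x 1, -(b x 2 * a x 2), c x 2;
     c x 3, -c x 1, b x 3 * a x 2, -(b x 3 * a x 3)]

def blockC3 (x : M) : Matrix (Fin 4) (Fin 4) ℂ :=
  !![-(b x 0 * c x 0), 0, b x 0 * c x 2, 0;
     0, -(b x 1 * c x 1), 0, b x 1 * c x 3;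
     c x 0 * b x 2, 0, -(b x 2 * c x 2), 0;
     0, c x 1 * b x 3, 0, -(b x 3 * c x 3)]

def blockA3 (x : M) : Matrix (Fin 4) (Fin 4) ℂ :=
  !![0, -(b x 1 * c x 0) - a x 0 * a x 1, 0, b x 0 * c x 3 + a x 0 * a x 3;
     b x 1 * c x 0 + a x 0 * a x 1, 0, -(b x 2 * c x 1) - a x 1 * a x 2, 0;
     0, b x 2 * c x 1 + a x 1 * a x 2, 0, -(b x 3 * c x 2) - a x 2 * a x 3;
     -(b x 0 * c x 3) - a x 0 * a x 3, 0, b x 3 * c x 2 + a x 2 * a x 3, 0]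

def blockC4 (x : M) : Matrix (Fin 4) (Fin 4) ℂ :=
  !![-(a x 0 * c x 0), -(a x 0 * c x 1), a x 0 * c x 2, a x 0 * c x 3;
     c x 0 * a x 1, -(a x 1 * c x 1), -(a x 1 * c x 2), a x 1 * c x 3;
     c x 0 * a x 2, c x 1 * a x 2, -(a x 2 * c x 2), -(a x 2 * c x 3);
     -(c x 0 * a x 3), c x 1 * a x 3, c x 2 * a x 3, -(a x 3 * c x 3)]

def blockA4 (x : M) : Matrix (Fin 4) (Fin 4) ℂ :=
  !![0, -(c x 0 * c x 1), 0, c x 0 * c x 3;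
     c x 0 * c x 1, 0, -(c x 1 * c x 2), 0;
     0, c x 1 * c x 2, 0, -(c x 2 * c x 3);
     -(c x 0 * c x 3), 0, c x 2 * c x 3, 0]

/-- The second Poisson tensor `P'`. -/
def tensorP' (x : M) : Matrix Idx Idx ℂ :=
  Matrix.comp (Fin 3) (Fin 3) (Fin 4) (Fin 4) ℂ
    !![blockA2 x, blockB1 x, blockC3 x;
       -(blockB1 x)ᵀ, blockA3 x, blockC4 x;
       -(blockC3 x)ᵀ, -(blockC4 x)ᵀ, blockA4 x]

/-- The vector obtained by applying a bivector, given by its matrix, to a covector. -/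
def sharp (B : Matrix Idx Idx ℂ) (ξ : Module.Dual ℂ M) : M :=
  B *ᵥ fun j => ξ (Pi.single j 1)

/-- The differential of a function at a point, as a covector. -/
def diff (f : M → ℂ) (x : M) : Module.Dual ℂ M := (fderiv ℂ f x).toLinearMap

/-! ### The conserved quantities -/

def H0 (x : M) : ℂ := b x 0 + b x 1 + b x 2 + b x 3

def H1 (x : M) : ℂ :=
  b x 0 * b x 1 + b x 0 * b x 2 + b x 0 * b x 3 + b x 1 * b x 2 + b x 1 * b x 3 + b x 2 * b x 3
    + a x 0 + a x 1 + a x 2 + a x 3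

def H2 (x : M) : ℂ :=
  c x 0 + c x 1 + c x 2 + c x 3
    + b x 0 * (a x 1 + a x 2) + b x 1 * (a x 2 + a x 3)
    + b x 2 * (a x 3 + a x 0) + b x 3 * (a x 0 + a x 1)
    + b x 0 * b x 1 * b x 2 + b x 0 * b x 1 * b x 3 + b x 0 * b x 2 * b x 3
    + b x 1 * b x 2 * b x 3

def H3 (x : M) : ℂ :=
  b x 0 * c x 1 + b x 1 * c x 2 + b x 2 * c x 3 + b x 3 * c x 0 + a x 0 * a x 2 + a x 1 * a x 3
    + b x 0 * b x 1 * a x 2 + b x 1 * b x 2 * a x 3 + b x 2 * b x 3 * a x 0 + b x 3 * b x 0 * a x 1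
    + b x 0 * b x 1 * b x 2 * b x 3

def K0 (x : M) : ℂ :=
  b x 0 * c x 3 * c x 1 + b x 1 * c x 0 * c x 2 + b x 2 * c x 1 * c x 3 + b x 3 * c x 2 * c x 0
    - c x 0 * a x 3 * a x 2 - c x 1 * a x 0 * a x 3 - c x 2 * a x 1 * a x 0 - c x 3 * a x 2 * a x 1

def K1 (x : M) : ℂ :=
  a x 0 * c x 1 * c x 2 + a x 1 * c x 2 * c x 3 + a x 2 * c x 3 * c x 0 + a x 3 * c x 0 * c x 1
    - b x 0 * b x 2 * c x 1 * c x 3 - b x 1 * b x 3 * c x 0 * c x 2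
    + b x 0 * a x 1 * a x 2 * c x 3 + b x 1 * a x 2 * a x 3 * c x 0
    + b x 2 * a x 3 * a x 0 * c x 1 + b x 3 * a x 0 * a x 1 * c x 2
    - a x 0 * a x 1 * a x 2 * a x 3

def J1 (x : M) : ℂ := c x 0 * c x 2 + c x 1 * c x 3

def J2 (x : M) : ℂ := c x 0 * c x 1 * c x 2 * c x 3

/-- The polynomial `H(λ)`. -/
def polyH (x : M) : ℂ[X] :=
  -(C (H0 x) * X ^ 3 - C (H1 x) * X ^ 2 + C (H2 x) * X - C (H3 x))

/-- The polynomial `K(λ)`. -/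
def polyK (x : M) : ℂ[X] := C (K0 x) * X + C (K1 x)

/-- `H(λ)`, `K(λ)`, `J₁`, `J₂` are the coefficients of the characteristic polynomial of the Lax
matrix in powers of `μ⁴`. -/
theorem det_lax (x : M) (l μ : ℂ) (hμ : μ ≠ 0) :
    (l • (1 : Matrix (Fin 4) (Fin 4) ℂ) - lax x μ).det =
      l ^ 4 - μ ^ 4 + (polyH x).eval l + ((polyK x).eval l - l ^ 2 * J1 x) / μ ^ 4
        + J2 x / (μ ^ 4) ^ 2 := by
  have h : l • (1 : Matrix (Fin 4) (Fin 4) ℂ) - lax x μ =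
      !![l - b x 0, μ, -(c x 2 / μ ^ 2), -(a x 3 / μ);
         -(a x 0 / μ), l - b x 1, μ, -(c x 3 / μ ^ 2);
         -(c x 0 / μ ^ 2), -(a x 1 / μ), l - b x 2, μ;
         μ, -(c x 1 / μ ^ 2), -(a x 2 / μ), l - b x 3] := by
    ext i j
    fin_cases i <;> fin_cases j <;> simp [lax]
  have h1 : (1 : Fin 4).succAbove (1 : Fin 3) = 2 := by decide
  have h2 : (1 : Fin 4).succAbove (2 : Fin 3) = 3 := by decide
  have h3 : (2 : Fin 4).succAbove (1 : Fin 3) = 1 := by decide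
  have h4 : (2 : Fin 4).succAbove (2 : Fin 3) = 3 := by decide
  have h5 : (3 : Fin 4).succAbove (1 : Fin 3) = 1 := by decide
  have h6 : (3 : Fin 4).succAbove (2 : Fin 3) = 2 := by decide
  rw [h, Matrix.det_succ_row_zero]
  simp [Fin.sum_univ_four, Matrix.det_fin_three, h1, h2, h3, h4, h5, h6, polyH, polyK, H0, H1, H2,
    H3, K0, K1, J1, J2]
  field_simp
  ring

/-! ### The symplectic leaves -/

/-- The Casimir functions of `P`. -/
def casimir : Fin 4 → M → ℂ := ![H0, K0, J1, J2]

/-- The common level set of the Casimir functions with values `κ`. -/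
def leaf (κ : Fin 4 → ℂ) : Set M := {x | ∀ i, casimir i x = κ i}

/-- The tangent space at `x` of the level set through `x`. -/
def tangent (x : M) : Submodule ℂ M := ⨅ i, LinearMap.ker (diff (casimir i) x)

/-- The restriction to the leaf through `x` of the differential of a function. -/
def leafDiff (f : M → ℂ) (x : M) : Module.Dual ℂ (tangent x) := diff f x ∘ₗ (tangent x).subtype

/-- The bivector `B` at the point `x` restricts to the bivector `A` on the tangent space of the
leaf: `A` maps the restriction of a covector `ξ` to `B ξ`. -/
def IsRestriction (x : M) (B : Matrix Idx Idx ℂ)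
    (A : Module.Dual ℂ (tangent x) →ₗ[ℂ] tangent x) : Prop :=
  ∀ ξ : Module.Dual ℂ M, (A (ξ ∘ₗ (tangent x).subtype) : M) = sharp B ξ

open Classical in
/-- The restriction of a bivector to the leaf through `x` (it is unique if it exists, and the value
is `0` if it does not). -/
def restrict (x : M) (B : Matrix Idx Idx ℂ) : Module.Dual ℂ (tangent x) →ₗ[ℂ] tangent x :=
  if h : ∃ A, IsRestriction x B A then h.choose else 0

/-! ### The deformed tensor `Q` and the Nijenhuis tensor -/

/-- The vector fields `Z₁ = -∂/∂b₄` and `Z₂ = ∂/∂a₄`. -/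
def Z : Fin 2 → M := ![Pi.single (0, 3) (-1), Pi.single (1, 3) 1]

/-- The two Casimirs of `P` that are not Casimirs of `P'`. -/
def f : Fin 2 → M → ℂ := ![H0, K0]

/-- The vector fields `X₁¹ = P' dH₀` and `X₁² = P' dK₀`. -/
def X1 (j : Fin 2) (x : M) : M := sharp (tensorP' x) (diff (f j) x)

/-- The matrix `G` with entries `L_{Z_i} f_j`. -/
def matG (x : M) : Matrix (Fin 2) (Fin 2) ℂ := Matrix.of fun i j => diff (f j) x (Z i)

/-- The bivector `v ∧ w`, with `(v ∧ w) ξ = ξ(v) w - ξ(w) v`. -/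
def wedge (v w : M) : Matrix Idx Idx ℂ := vecMulVec w v - vecMulVec v w

/-- The tensor `Q = P' - ∑ (G⁻¹)_{ij} Z_j ∧ X₁ⁱ`. -/
def tensorQ (x : M) : Matrix Idx Idx ℂ :=
  tensorP' x - ∑ i, ∑ j, (matG x)⁻¹ i j • wedge (Z j) (X1 i x)

open Classical in
/-- The Nijenhuis tensor `N = Q P⁻¹` of the leaf through `x`, acting on the tangent space (its
transpose, acting on the cotangent space, is `P⁻¹ Q`). -/
def nijenhuis (x : M) : tangent x →ₗ[ℂ] tangent x :=
  if h : Function.Bijective (restrict x (tensorP x)) then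
    restrict x (tensorQ x) ∘ₗ (LinearEquiv.ofBijective (restrict x (tensorP x)) h).symm.toLinearMap
  else 0

/-- The coefficients `p₁,…,p₄` (at the indices `0,…,3`) of the minimal polynomial
`λ⁴ - p₁ λ³ - p₂ λ² - p₃ λ - p₄` of the Nijenhuis tensor. -/
def coeffP (i : Fin 4) (x : M) : ℂ := -(minpoly ℂ (nijenhuis x)).coeff (3 - (i : ℕ))

/-! ### The matrix `𝒢(λ)` -/

/-- The Lie derivative along `v`, coefficient by coefficient, of a function with values in the
polynomials of degree at most `3`. -/
def liePoly (v : M) (F : M → ℂ[X]) (x : M) : ℂ[X] :=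
  ∑ k ∈ Finset.range 4, C (diff (fun y => (F y).coeff k) x v) * X ^ k

/-- The matrix `𝒢(λ)`. -/
def calG (x : M) : Matrix (Fin 2) (Fin 2) ℂ[X] :=
  !![liePoly (Z 0) polyH x, liePoly (Z 1) polyH x;
     liePoly (Z 0) polyK x, liePoly (Z 1) polyK x]

/-- The ratio `ρ(λ) = -𝒢₂₂ / 𝒢₁₂`. -/
def rho (x : M) (l : ℂ) : ℂ := -(calG x 1 1).eval l / (calG x 0 1).eval l

/-- The ratio `σ(λ) = -𝒢₂₁ / 𝒢₁₁`. -/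
def sigma (x : M) (l : ℂ) : ℂ := -(calG x 1 0).eval l / (calG x 0 0).eval l

/-! ### Generic points -/

/-- The values of the Casimirs of the generic leaves. -/
def IsGenericValue (κ : Fin 4 → ℂ) : Prop := κ 3 ≠ 0 ∧ κ 2 ^ 2 ≠ 4 * κ 3

/-- The points of the generic leaves at which `Q` is defined and `Det 𝒢(λ)` has no multiple
root. -/
def regLocus : Set M :=
  {x | IsGenericValue (fun i => casimir i x) ∧ (matG x).det ≠ 0 ∧ (calG x).det.Separable}

/-- The points of `regLocus` at which, moreover, `ρ` has neither a zero nor a pole at a root of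
`Det 𝒢(λ)`. -/
def dnLocus : Set M :=
  {x | x ∈ regLocus ∧
    ∀ l, (calG x).det.IsRoot l → (calG x 0 1).eval l ≠ 0 ∧ (calG x 1 1).eval l ≠ 0}

/-! ### Nijenhuis functions generators and Darboux–Nijenhuis coordinates -/

/-- `Φ(λ)`, defined for `(x, λ)` in `Ω`, is a Nijenhuis functions generator on the leaves: there is
a one-form `α`, depending holomorphically on the point and on `λ`, such that
`N* dΦ(λ) = λ dΦ(λ) + Δ_N(λ) α` on the leaves, `Δ_N` being the minimal polynomial of `N`. -/
def IsNijenhuisGenerator (Ω : Set (M × ℂ)) (Φ : M → ℂ → ℂ) : Prop :=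
  DifferentiableOn ℂ (fun z : M × ℂ => Φ z.1 z.2) Ω ∧
  ∃ α : M × ℂ → (M →L[ℂ] ℂ), DifferentiableOn ℂ α Ω ∧
    ∀ x l, (x, l) ∈ Ω → ∀ v : tangent x,
      leafDiff (fun y => Φ y l) x (nijenhuis x v) =
        l * leafDiff (fun y => Φ y l) x v + (minpoly ℂ (nijenhuis x)).eval l * α (x, l) v

/-- `(y, x)` is a system of holomorphic coordinates on the open subset `leaf κ ∩ V` of the leaf,
with image the open set `W` and with holomorphic inverse map `Ψ`. -/
structure IsLeafChart (κ : Fin 4 → ℂ) (V : Set M) (y x : Fin 4 → M → ℂ)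
    (W : Set ((Fin 4 → ℂ) × (Fin 4 → ℂ))) (Ψ : (Fin 4 → ℂ) × (Fin 4 → ℂ) → M) : Prop where
  isOpen_source : IsOpen V
  isOpen_target : IsOpen W
  differentiable_y : ∀ i, DifferentiableOn ℂ (y i) V
  differentiable_x : ∀ i, DifferentiableOn ℂ (x i) V
  differentiable_inv : DifferentiableOn ℂ Ψ W
  mapsTo : ∀ m ∈ leaf κ ∩ V, ((fun i => y i m), fun i => x i m) ∈ W
  mapsTo_inv : ∀ w ∈ W, Ψ w ∈ leaf κ ∩ V
  left_inv : ∀ m ∈ leaf κ ∩ V, Ψ ((fun i => y i m), fun i => x i m) = m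
  right_inv : ∀ w ∈ W, ((fun i => y i (Ψ w)), fun i => x i (Ψ w)) = w

/-- `(y, x)` are Darboux–Nijenhuis coordinates on `leaf κ ∩ V` for the restrictions of `P` and `Q`
(with inverse chart `Ψ : W → leaf κ ∩ V`), `ev i` being the pairwise distinct eigenvalues of the
Nijenhuis tensor. -/
structure IsDarbouxNijenhuis (κ : Fin 4 → ℂ) (V : Set M) (y x ev : Fin 4 → M → ℂ)
    (W : Set ((Fin 4 → ℂ) × (Fin 4 → ℂ))) (Ψ : (Fin 4 → ℂ) × (Fin 4 → ℂ) → M) : Prop where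
  chart : IsLeafChart κ V y x W Ψ
  distinct : ∀ m ∈ leaf κ ∩ V, Function.Injective fun i => ev i m
  bracket_xy : ∀ m ∈ leaf κ ∩ V, ∀ i j,
    leafDiff (x i) m (restrict m (tensorP m) (leafDiff (y j) m)) = if i = j then 1 else 0
  bracket_xx : ∀ m ∈ leaf κ ∩ V, ∀ i j,
    leafDiff (x i) m (restrict m (tensorP m) (leafDiff (x j) m)) = 0
  bracket_yy : ∀ m ∈ leaf κ ∩ V, ∀ i j,
    leafDiff (y i) m (restrict m (tensorP m) (leafDiff (y j) m)) = 0
  /-- `N = ∑ ev_i (∂/∂y_i ⊗ dy_i + ∂/∂x_i ⊗ dx_i)`. -/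
  diagonal : ∀ m ∈ leaf κ ∩ V, ∀ v : tangent m,
    (nijenhuis m v : M) = ∑ i, ev i m •
      (leafDiff (y i) m v •
          fderiv ℂ Ψ ((fun i => y i m), fun i => x i m) (Pi.single i 1, 0) +
        leafDiff (x i) m v •
          fderiv ℂ Ψ ((fun i => y i m), fun i => x i m) (0, Pi.single i 1))

/-- On `V`, the `lam i` are continuous branches of the four roots of `Det 𝒢(λ)`, and the `mu i` are
continuous branches of `log ρ(lam i)`. -/
structure IsBranch (V : Set M) (lam mu : Fin 4 → M → ℂ) : Prop where
  continuousOn_lam : ∀ i, ContinuousOn (lam i) V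
  continuousOn_mu : ∀ i, ContinuousOn (mu i) V
  roots_eq : ∀ m ∈ V, (calG m).det.roots = Finset.univ.val.map fun i => lam i m
  exp_mu : ∀ m ∈ V, ∀ i, Complex.exp (mu i m) = rho m (lam i m)

/-- The Hamiltonians `H₁, H₂, H₃, K₁` of the commuting flows. -/
def hamiltonian : Fin 4 → M → ℂ := ![H1, H2, H3, K1]

end Toda

end

/-! The mechanism is bihamiltonian. The coefficients of `H(λ)` and `K(λ)` form Lenard chains for the
pencil `P' - λP`, while `J₁`, `J₂` are common Casimirs. Where `det G ≠ 0`, no nonzero combination of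
`Z₁`, `Z₂` is tangent to the leaf, and `Q` corrects `P'` along these fields so that `dH₀` and `dK₀`
are killed too. On covectors annihilating `Z₁`, `Z₂`, the tensors `Q` and `P'` agree modulo the span
of `Z₁`, `Z₂`. Hence an equality `Qξ = Pη` for such a `ξ` need only be checked modulo that span
(`tensorQ_eq_of_eqModZ`), where it becomes a polynomial identity in the coordinates.

The entries of `𝒢(λ)` involve neither `b₄` nor `a₄`, so their differentials are covectors of this
kind. The core of the proof is that `P' - λP` sends the numerators of `dρ(λ)` and `dσ(λ)`, and also
`d Det 𝒢(λ)`, to `Det 𝒢(λ)` times explicit vectors (`pencil_rhoForm`, `pencil_sigmaForm`,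
`pencil_gradDet`). The first two identities give the Nijenhuis generators; all three give
information at and away from the roots.

Eigenvalues: at a root, a left null vector of `𝒢` produces an eigencovector
(`hasEigenvalue_of_isRoot`). Away from the roots, pairing an eigencovector with the pencil
identities forces it into the kernel of `P` (`isRoot_of_hasEigenvalue`). An eigenspace is the image
under `P` of the kernel of the antisymmetric map `Q - λP` in dimension 8, so it is at least
2-dimensional (`two_le_finrank_ker`). Four simple roots then exhaust the tangent space, which
determines the minimal polynomial.

Density: the loci are cut out by nonvanishing resultants. Each piece of a leaf with fixed `c₁c₃`,
`c₂c₄` is rationally parametrized, and the identity theorem along a path to a sample point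
(`leafPoint_mem_dnLocus`) applies.

Darboux–Nijenhuis coordinates: `dλᵢ` is a multiple of `d Det 𝒢` at `λᵢ`, and `d log ρ(λᵢ)` is a
combination of the numerator of `dρ` and of `dλᵢ`; both are eigenforms of `N*` with eigenvalue `λᵢ`.
Eigenforms with distinct eigenvalues are orthogonal for `P`, and the remaining bracket is a limit of
pencil identities (`covec_rhoForm_gradDet`). The canonical brackets make the eight forms a basis,
and the inverse function theorem, with the Casimirs adjoined, gives the chart. The `pᵢ` are
independent because the `dλᵢ` are combinations of the `dpᵢ`. -/

noncomputable section

namespace Toda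

/-! ### Covectors and their components -/

/-- The covector with components `ξ`. -/
def covec (ξ : M) : M →L[ℂ] ℂ := ∑ p, ξ p • ContinuousLinearMap.proj p

theorem covec_apply (ξ v : M) : covec ξ v = ∑ p, ξ p * v p := by
  simp [covec]

theorem covec_single (ξ : M) (p : Idx) (t : ℂ) : covec ξ (Pi.single p t) = ξ p * t := by
  simp [covec_apply, Pi.single_apply]

theorem covec_add (ξ η : M) : covec (ξ + η) = covec ξ + covec η := by
  ext v; simp [covec_apply, add_mul, Finset.sum_add_distrib]

theorem covec_sub (ξ η : M) : covec (ξ - η) = covec ξ - covec η := by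
  ext v; simp [covec_apply, sub_mul, Finset.sum_sub_distrib]

theorem covec_smul (t : ℂ) (ξ : M) : covec (t • ξ) = t • covec ξ := by
  ext v; simp [covec_apply, Finset.mul_sum, mul_assoc]

theorem exists_covec (ξ : Module.Dual ℂ M) : ∃ η : M, ξ = (covec η).toLinearMap := by
  refine ⟨fun p => ξ (Pi.single p 1), ?_⟩
  refine LinearMap.pi_ext fun p t => ?_
  have : (Pi.single p t : M) = t • Pi.single p 1 := by
    ext q; simp [Pi.single_apply]
  simp [covec_single, this, mul_comm]

theorem sharp_covec (B : Matrix Idx Idx ℂ) (ξ : M) :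
    sharp B (covec ξ).toLinearMap = B *ᵥ ξ := by
  unfold sharp
  congr 1
  ext p
  simp [covec_single]

theorem covec_mulVec_swap {B : Matrix Idx Idx ℂ} (hB : Bᵀ = -B) (ξ η : M) :
    covec ξ (B *ᵥ η) = -covec η (B *ᵥ ξ) := by
  have h : ξ ⬝ᵥ (B *ᵥ η) = -(η ⬝ᵥ (B *ᵥ ξ)) := by
    rw [dotProduct_mulVec, ← mulVec_transpose, hB, neg_mulVec, neg_dotProduct, dotProduct_comm]
  simpa [covec_apply, dotProduct] using h

/-- A point of the phase space given by its three blocks of coordinates. -/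
def blocks (u v w : Fin 4 → ℂ) : M := fun p => ![u, v, w] p.1 p.2

@[simp] theorem blocks_zero (u v w : Fin 4 → ℂ) (i : Fin 4) : blocks u v w (0, i) = u i := rfl
@[simp] theorem blocks_one (u v w : Fin 4 → ℂ) (i : Fin 4) : blocks u v w (1, i) = v i := rfl
@[simp] theorem blocks_two (u v w : Fin 4 → ℂ) (i : Fin 4) : blocks u v w (2, i) = w i := rfl

theorem sum_idx {E : Type*} [AddCommMonoid E] (F : Idx → E) :
    ∑ p, F p = (F (0, 0) + F (0, 1) + F (0, 2) + F (0, 3)) +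
      (F (1, 0) + F (1, 1) + F (1, 2) + F (1, 3)) +
      (F (2, 0) + F (2, 1) + F (2, 2) + F (2, 3)) := by
  rw [Fintype.sum_prod_type, Fin.sum_univ_three]
  simp only [Fin.sum_univ_four]

theorem ext_blocks {x y : M} (h0 : ∀ i, x (0, i) = y (0, i)) (h1 : ∀ i, x (1, i) = y (1, i))
    (h2 : ∀ i, x (2, i) = y (2, i)) : x = y := by
  ext ⟨k, i⟩
  fin_cases k
  exacts [h0 i, h1 i, h2 i]

theorem forall_fin_four {p : Fin 4 → Prop} : (∀ i, p i) ↔ p 0 ∧ p 1 ∧ p 2 ∧ p 3 :=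
  ⟨fun h => ⟨h 0, h 1, h 2, h 3⟩, fun ⟨h0, h1, h2, h3⟩ i => by fin_cases i <;> assumption⟩

/-! ### The two Poisson tensors in components -/

theorem tensorP_apply (x : M) (i j : Fin 4) :
    tensorP x (0, i) (0, j) = 0 ∧ tensorP x (0, i) (1, j) = blockA1 x i j ∧
    tensorP x (0, i) (2, j) = blockC1 x i j ∧ tensorP x (1, i) (0, j) = -blockA1 x j i ∧
    tensorP x (1, i) (1, j) = blockC2 x i j ∧ tensorP x (1, i) (2, j) = 0 ∧
    tensorP x (2, i) (0, j) = -blockC1 x j i ∧ tensorP x (2, i) (1, j) = 0 ∧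
    tensorP x (2, i) (2, j) = 0 := ⟨rfl, rfl, rfl, rfl, rfl, rfl, rfl, rfl, rfl⟩

theorem tensorP'_apply (x : M) (i j : Fin 4) :
    tensorP' x (0, i) (0, j) = blockA2 x i j ∧ tensorP' x (0, i) (1, j) = blockB1 x i j ∧
    tensorP' x (0, i) (2, j) = blockC3 x i j ∧ tensorP' x (1, i) (0, j) = -blockB1 x j i ∧
    tensorP' x (1, i) (1, j) = blockA3 x i j ∧ tensorP' x (1, i) (2, j) = blockC4 x i j ∧
    tensorP' x (2, i) (0, j) = -blockC3 x j i ∧ tensorP' x (2, i) (1, j) = -blockC4 x j i ∧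
    tensorP' x (2, i) (2, j) = blockA4 x i j := ⟨rfl, rfl, rfl, rfl, rfl, rfl, rfl, rfl, rfl⟩

theorem tensorP_mulVec (x ξ : M) : tensorP x *ᵥ ξ = blocks
    ![-a x 0 * a ξ 0 + a x 3 * a ξ 3 - c x 0 * c ξ 0 + c x 2 * c ξ 2,
      a x 0 * a ξ 0 - a x 1 * a ξ 1 - c x 1 * c ξ 1 + c x 3 * c ξ 3,
      a x 1 * a ξ 1 - a x 2 * a ξ 2 + c x 0 * c ξ 0 - c x 2 * c ξ 2,
      a x 2 * a ξ 2 - a x 3 * a ξ 3 + c x 1 * c ξ 1 - c x 3 * c ξ 3]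
    ![a x 0 * (b ξ 0 - b ξ 1) - c x 0 * a ξ 1 + c x 3 * a ξ 3,
      a x 1 * (b ξ 1 - b ξ 2) - c x 1 * a ξ 2 + c x 0 * a ξ 0,
      a x 2 * (b ξ 2 - b ξ 3) - c x 2 * a ξ 3 + c x 1 * a ξ 1,
      a x 3 * (b ξ 3 - b ξ 0) - c x 3 * a ξ 0 + c x 2 * a ξ 2]
    ![c x 0 * (b ξ 0 - b ξ 2), c x 1 * (b ξ 1 - b ξ 3),
      c x 2 * (b ξ 2 - b ξ 0), c x 3 * (b ξ 3 - b ξ 1)] := by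
  refine ext_blocks ?_ ?_ ?_ <;> rw [forall_fin_four] <;> refine ⟨?_, ?_, ?_, ?_⟩ <;>
    simp [tensorP_apply, mulVec, dotProduct, sum_idx, blockA1, blockC1, blockC2] <;> ring

theorem tensorP'_mulVec (x ξ : M) : tensorP' x *ᵥ ξ = blocks
    ![a x 0 * b ξ 1 - a x 3 * b ξ 3 - b x 0 * a x 0 * a ξ 0 + c x 0 * a ξ 1 - c x 2 * a ξ 2
        + b x 0 * a x 3 * a ξ 3 - b x 0 * c x 0 * c ξ 0 + b x 0 * c x 2 * c ξ 2,
      a x 1 * b ξ 2 - a x 0 * b ξ 0 - b x 1 * a x 1 * a ξ 1 + c x 1 * a ξ 2 - c x 3 * a ξ 3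
        + b x 1 * a x 0 * a ξ 0 - b x 1 * c x 1 * c ξ 1 + b x 1 * c x 3 * c ξ 3,
      a x 2 * b ξ 3 - a x 1 * b ξ 1 - b x 2 * a x 2 * a ξ 2 + c x 2 * a ξ 3 - c x 0 * a ξ 0
        + b x 2 * a x 1 * a ξ 1 - b x 2 * c x 2 * c ξ 2 + b x 2 * c x 0 * c ξ 0,
      a x 3 * b ξ 0 - a x 2 * b ξ 2 - b x 3 * a x 3 * a ξ 3 + c x 3 * a ξ 0 - c x 1 * a ξ 1
        + b x 3 * a x 2 * a ξ 2 - b x 3 * c x 3 * c ξ 3 + b x 3 * c x 1 * c ξ 1]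
    ![b x 0 * a x 0 * b ξ 0 - b x 1 * a x 0 * b ξ 1 + c x 0 * b ξ 2 - c x 3 * b ξ 3
        - (b x 1 * c x 0 + a x 0 * a x 1) * a ξ 1 + (b x 0 * c x 3 + a x 0 * a x 3) * a ξ 3
        + a x 0 * (-c x 0 * c ξ 0 - c x 1 * c ξ 1 + c x 2 * c ξ 2 + c x 3 * c ξ 3),
      b x 1 * a x 1 * b ξ 1 - b x 2 * a x 1 * b ξ 2 + c x 1 * b ξ 3 - c x 0 * b ξ 0
        - (b x 2 * c x 1 + a x 1 * a x 2) * a ξ 2 + (b x 1 * c x 0 + a x 1 * a x 0) * a ξ 0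
        + a x 1 * (-c x 1 * c ξ 1 - c x 2 * c ξ 2 + c x 3 * c ξ 3 + c x 0 * c ξ 0),
      b x 2 * a x 2 * b ξ 2 - b x 3 * a x 2 * b ξ 3 + c x 2 * b ξ 0 - c x 1 * b ξ 1
        - (b x 3 * c x 2 + a x 2 * a x 3) * a ξ 3 + (b x 2 * c x 1 + a x 2 * a x 1) * a ξ 1
        + a x 2 * (-c x 2 * c ξ 2 - c x 3 * c ξ 3 + c x 0 * c ξ 0 + c x 1 * c ξ 1),
      b x 3 * a x 3 * b ξ 3 - b x 0 * a x 3 * b ξ 0 + c x 3 * b ξ 1 - c x 2 * b ξ 2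
        - (b x 0 * c x 3 + a x 3 * a x 0) * a ξ 0 + (b x 3 * c x 2 + a x 3 * a x 2) * a ξ 2
        + a x 3 * (-c x 3 * c ξ 3 - c x 0 * c ξ 0 + c x 1 * c ξ 1 + c x 2 * c ξ 2)]
    ![c x 0 * (b x 0 * b ξ 0 - b x 2 * b ξ 2 + a x 0 * a ξ 0 - a x 1 * a ξ 1 - a x 2 * a ξ 2
        + a x 3 * a ξ 3 - c x 1 * c ξ 1 + c x 3 * c ξ 3),
      c x 1 * (b x 1 * b ξ 1 - b x 3 * b ξ 3 + a x 1 * a ξ 1 - a x 2 * a ξ 2 - a x 3 * a ξ 3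
        + a x 0 * a ξ 0 - c x 2 * c ξ 2 + c x 0 * c ξ 0),
      c x 2 * (b x 2 * b ξ 2 - b x 0 * b ξ 0 + a x 2 * a ξ 2 - a x 3 * a ξ 3 - a x 0 * a ξ 0
        + a x 1 * a ξ 1 - c x 3 * c ξ 3 + c x 1 * c ξ 1),
      c x 3 * (b x 3 * b ξ 3 - b x 1 * b ξ 1 + a x 3 * a ξ 3 - a x 0 * a ξ 0 - a x 1 * a ξ 1
        + a x 2 * a ξ 2 - c x 0 * c ξ 0 + c x 2 * c ξ 2)] := by
  refine ext_blocks ?_ ?_ ?_ <;> rw [forall_fin_four] <;> refine ⟨?_, ?_, ?_, ?_⟩ <;>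
    simp [tensorP'_apply, mulVec, dotProduct, sum_idx, blockA2, blockB1, blockC3, blockA3, blockC4,
      blockA4] <;> ring

theorem transpose_eq_neg_of_mulVec {B : Matrix Idx Idx ℂ}
    (h : ∀ ξ η : M, ∑ p, ξ p * (B *ᵥ η) p = -∑ p, η p * (B *ᵥ ξ) p) : Bᵀ = -B := by
  ext p q
  have := h (Pi.single q 1) (Pi.single p 1)
  simpa [Pi.single_apply] using this

theorem tensorP_transpose (x : M) : (tensorP x)ᵀ = -tensorP x := by
  refine transpose_eq_neg_of_mulVec fun ξ η => ?_
  simp only [tensorP_mulVec, sum_idx, blocks_zero, blocks_one, blocks_two]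
  simp
  ring

theorem tensorP'_transpose (x : M) : (tensorP' x)ᵀ = -tensorP' x := by
  refine transpose_eq_neg_of_mulVec fun ξ η => ?_
  simp only [tensorP'_mulVec, sum_idx, blocks_zero, blocks_one, blocks_two]
  simp
  ring


/-! ### Gradients of the conserved quantities -/

/-- The gradient of `H0`. -/
def gradH0 (_x : M) : M := blocks
    ![1,
      1,
      1,
      1]
    ![0,
      0,
      0,
      0]
    ![0,
      0,
      0,
      0]

/-- The gradient of `H1`. -/
def gradH1 (x : M) : M := blocks
    ![b x 1 + b x 2 + b x 3,
      b x 0 + b x 2 + b x 3,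
      b x 0 + b x 1 + b x 3,
      b x 0 + b x 1 + b x 2]
    ![1,
      1,
      1,
      1]
    ![0,
      0,
      0,
      0]

/-- The gradient of `H2`. -/
def gradH2 (x : M) : M := blocks
    ![b x 1 * b x 2 + b x 1 * b x 3 + b x 2 * b x 3 + a x 1 + a x 2,
      b x 0 * b x 2 + b x 0 * b x 3 + b x 2 * b x 3 + a x 2 + a x 3,
      b x 0 * b x 1 + b x 0 * b x 3 + b x 1 * b x 3 + a x 0 + a x 3,
      b x 0 * b x 1 + b x 0 * b x 2 + b x 1 * b x 2 + a x 0 + a x 1]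
    ![b x 2 + b x 3,
      b x 0 + b x 3,
      b x 0 + b x 1,
      b x 1 + b x 2]
    ![1,
      1,
      1,
      1]

/-- The gradient of `H3`. -/
def gradH3 (x : M) : M := blocks
    ![b x 1 * b x 2 * b x 3 + b x 1 * a x 2 + b x 3 * a x 1 + c x 1,
      b x 0 * b x 2 * b x 3 + b x 0 * a x 2 + b x 2 * a x 3 + c x 2,
      b x 0 * b x 1 * b x 3 + b x 1 * a x 3 + b x 3 * a x 0 + c x 3,
      b x 0 * b x 1 * b x 2 + b x 0 * a x 1 + b x 2 * a x 0 + c x 0]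
    ![b x 2 * b x 3 + a x 2,
      b x 0 * b x 3 + a x 3,
      b x 0 * b x 1 + a x 0,
      b x 1 * b x 2 + a x 1]
    ![b x 3,
      b x 0,
      b x 1,
      b x 2]

/-- The gradient of `K0`. -/
def gradK0 (x : M) : M := blocks
    ![c x 1 * c x 3,
      c x 0 * c x 2,
      c x 1 * c x 3,
      c x 0 * c x 2]
    ![-a x 1 * c x 2 - a x 3 * c x 1,
      -a x 0 * c x 2 - a x 2 * c x 3,
      -a x 1 * c x 3 - a x 3 * c x 0,
      -a x 0 * c x 1 - a x 2 * c x 0]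
    ![b x 1 * c x 2 + b x 3 * c x 2 - a x 2 * a x 3,
      b x 0 * c x 3 + b x 2 * c x 3 - a x 0 * a x 3,
      b x 1 * c x 0 + b x 3 * c x 0 - a x 0 * a x 1,
      b x 0 * c x 1 + b x 2 * c x 1 - a x 1 * a x 2]

/-- The gradient of `K1`. -/
def gradK1 (x : M) : M := blocks
    ![-b x 2 * c x 1 * c x 3 + a x 1 * a x 2 * c x 3,
      -b x 3 * c x 0 * c x 2 + a x 2 * a x 3 * c x 0,
      -b x 0 * c x 1 * c x 3 + a x 0 * a x 3 * c x 1,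
      -b x 1 * c x 0 * c x 2 + a x 0 * a x 1 * c x 2]
    ![b x 2 * a x 3 * c x 1 + b x 3 * a x 1 * c x 2 - a x 1 * a x 2 * a x 3 + c x 1 * c x 2,
      b x 0 * a x 2 * c x 3 + b x 3 * a x 0 * c x 2 - a x 0 * a x 2 * a x 3 + c x 2 * c x 3,
      b x 0 * a x 1 * c x 3 + b x 1 * a x 3 * c x 0 - a x 0 * a x 1 * a x 3 + c x 0 * c x 3,
      b x 1 * a x 2 * c x 0 + b x 2 * a x 0 * c x 1 - a x 0 * a x 1 * a x 2 + c x 0 * c x 1]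
    ![-b x 1 * b x 3 * c x 2 + b x 1 * a x 2 * a x 3 + a x 2 * c x 3 + a x 3 * c x 1,
      -b x 0 * b x 2 * c x 3 + b x 2 * a x 0 * a x 3 + a x 0 * c x 2 + a x 3 * c x 0,
      -b x 1 * b x 3 * c x 0 + b x 3 * a x 0 * a x 1 + a x 0 * c x 1 + a x 1 * c x 3,
      -b x 0 * b x 2 * c x 1 + b x 0 * a x 1 * a x 2 + a x 1 * c x 2 + a x 2 * c x 0]

/-- The gradient of `J1`. -/
def gradJ1 (x : M) : M := blocks
    ![0,
      0,
      0,
      0]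
    ![0,
      0,
      0,
      0]
    ![c x 2,
      c x 3,
      c x 0,
      c x 1]

/-- The gradient of `J2`. -/
def gradJ2 (x : M) : M := blocks
    ![0,
      0,
      0,
      0]
    ![0,
      0,
      0,
      0]
    ![c x 1 * c x 2 * c x 3,
      c x 0 * c x 2 * c x 3,
      c x 0 * c x 1 * c x 3,
      c x 0 * c x 1 * c x 2]

/-! ### The entries of `𝒢(λ)` and their gradients -/

/-- The entry `𝒢₁₁` as a function of the point and of `λ`. -/
def g11 (x : M) (l : ℂ) : ℂ :=
  l ^ 3 - (b x 0 + b x 1 + b x 2) * l ^ 2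
    + (b x 0 * b x 1 + b x 0 * b x 2 + b x 1 * b x 2 + a x 0 + a x 1) * l
    - (c x 0 + b x 2 * a x 0 + b x 0 * a x 1 + b x 0 * b x 1 * b x 2)

/-- The entry `𝒢₁₂`. -/
def g12 (x : M) (l : ℂ) : ℂ := l ^ 2 - (b x 1 + b x 2) * l + (b x 1 * b x 2 + a x 1)

/-- The entry `𝒢₂₁`. -/
def g21 (x : M) (l : ℂ) : ℂ :=
  -(c x 0 * c x 2) * l + (b x 1 * c x 0 * c x 2 - a x 0 * a x 1 * c x 2)

/-- The coefficient of `λ` in `𝒢₂₂`, which is the leading coefficient of `Det 𝒢(λ)`. -/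
def lead (x : M) : ℂ := -(c x 0 * a x 2) - c x 1 * a x 0

/-- The entry `𝒢₂₂`. -/
def g22 (x : M) (l : ℂ) : ℂ :=
  lead x * l + (b x 1 * a x 2 * c x 0 + b x 2 * a x 0 * c x 1 - a x 0 * a x 1 * a x 2
    + c x 0 * c x 1)

/-- The determinant of `𝒢(λ)`. -/
def detFun (x : M) (l : ℂ) : ℂ := g11 x l * g22 x l - g12 x l * g21 x l

/-- The gradient of `𝒢₁₁` with respect to the point. -/
def gradG11 (x : M) (l : ℂ) : M := blocks
    ![-b x 1 * b x 2 + b x 1 * l + b x 2 * l - a x 1 - l ^ 2,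
      -b x 0 * b x 2 + b x 0 * l + b x 2 * l - l ^ 2,
      -b x 0 * b x 1 + b x 0 * l + b x 1 * l - a x 0 - l ^ 2,
      0]
    ![-b x 2 + l,
      -b x 0 + l,
      0,
      0]
    ![-1,
      0,
      0,
      0]

/-- The gradient of `𝒢₁₂` with respect to the point. -/
def gradG12 (x : M) (l : ℂ) : M := blocks
    ![0,
      b x 2 - l,
      b x 1 - l,
      0]
    ![0,
      1,
      0,
      0]
    ![0,
      0,
      0,
      0]

/-- The gradient of `𝒢₂₁` with respect to the point. -/
def gradG21 (x : M) (l : ℂ) : M := blocks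
    ![0,
      c x 0 * c x 2,
      0,
      0]
    ![-a x 1 * c x 2,
      -a x 0 * c x 2,
      0,
      0]
    ![b x 1 * c x 2 - c x 2 * l,
      0,
      b x 1 * c x 0 - a x 0 * a x 1 - c x 0 * l,
      0]

/-- The gradient of `𝒢₂₂` with respect to the point. -/
def gradG22 (x : M) (l : ℂ) : M := blocks
    ![0,
      a x 2 * c x 0,
      a x 0 * c x 1,
      0]
    ![b x 2 * c x 1 - a x 1 * a x 2 - c x 1 * l,
      -a x 0 * a x 2,
      b x 1 * c x 0 - a x 0 * a x 1 - c x 0 * l,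
      0]
    ![b x 1 * a x 2 - a x 2 * l + c x 1,
      b x 2 * a x 0 - a x 0 * l + c x 0,
      0,
      0]

/-- The gradient of `lead`. -/
def gradLead (x : M) : M := blocks
    ![0,
      0,
      0,
      0]
    ![-c x 1,
      0,
      -c x 0,
      0]
    ![-a x 2,
      -a x 0,
      0,
      0]

/-- The gradient of `detFun` with respect to the point. -/
def gradDet (x : M) (l : ℂ) : M :=
  g22 x l • gradG11 x l + g11 x l • gradG22 x l - g21 x l • gradG12 x l - g12 x l • gradG21 x l

theorem hasFDerivAt_H0 (x : M) : HasFDerivAt H0 (covec (gradH0 x)) x := by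
  unfold H0
  refine HasFDerivAt.congr_fderiv (by
    repeat' first
      | exact hasFDerivAt_apply (𝕜 := ℂ) _ x
      | apply HasFDerivAt.fun_add) ?_
  ext v
  simp only [covec_apply, sum_idx, gradH0, blocks_zero, blocks_one, blocks_two]
  simp

theorem hasFDerivAt_H1 (x : M) : HasFDerivAt H1 (covec (gradH1 x)) x := by
  unfold H1
  refine HasFDerivAt.congr_fderiv (by
    repeat' first
      | exact hasFDerivAt_apply (𝕜 := ℂ) _ x
      | exact hasFDerivAt_const (𝕜 := ℂ) _ x
      | apply HasFDerivAt.fun_add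
      | apply HasFDerivAt.fun_sub
      | apply HasFDerivAt.fun_neg
      | apply HasFDerivAt.fun_mul) ?_
  ext v
  simp only [covec_apply, sum_idx, gradH1, blocks_zero, blocks_one, blocks_two]
  simp
  ring

theorem hasFDerivAt_H2 (x : M) : HasFDerivAt H2 (covec (gradH2 x)) x := by
  unfold H2
  refine HasFDerivAt.congr_fderiv (by
    repeat' first
      | exact hasFDerivAt_apply (𝕜 := ℂ) _ x
      | exact hasFDerivAt_const (𝕜 := ℂ) _ x
      | apply HasFDerivAt.fun_add
      | apply HasFDerivAt.fun_sub
      | apply HasFDerivAt.fun_neg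
      | apply HasFDerivAt.fun_mul) ?_
  ext v
  simp only [covec_apply, sum_idx, gradH2, blocks_zero, blocks_one, blocks_two]
  simp
  ring

theorem hasFDerivAt_H3 (x : M) : HasFDerivAt H3 (covec (gradH3 x)) x := by
  unfold H3
  refine HasFDerivAt.congr_fderiv (by
    repeat' first
      | exact hasFDerivAt_apply (𝕜 := ℂ) _ x
      | exact hasFDerivAt_const (𝕜 := ℂ) _ x
      | apply HasFDerivAt.fun_add
      | apply HasFDerivAt.fun_sub
      | apply HasFDerivAt.fun_neg
      | apply HasFDerivAt.fun_mul) ?_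
  ext v
  simp only [covec_apply, sum_idx, gradH3, blocks_zero, blocks_one, blocks_two]
  simp
  ring

theorem hasFDerivAt_K0 (x : M) : HasFDerivAt K0 (covec (gradK0 x)) x := by
  unfold K0
  refine HasFDerivAt.congr_fderiv (by
    repeat' first
      | exact hasFDerivAt_apply (𝕜 := ℂ) _ x
      | exact hasFDerivAt_const (𝕜 := ℂ) _ x
      | apply HasFDerivAt.fun_add
      | apply HasFDerivAt.fun_sub
      | apply HasFDerivAt.fun_neg
      | apply HasFDerivAt.fun_mul) ?_
  ext v
  simp only [covec_apply, sum_idx, gradK0, blocks_zero, blocks_one, blocks_two]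
  simp
  ring

theorem hasFDerivAt_K1 (x : M) : HasFDerivAt K1 (covec (gradK1 x)) x := by
  unfold K1
  refine HasFDerivAt.congr_fderiv (by
    repeat' first
      | exact hasFDerivAt_apply (𝕜 := ℂ) _ x
      | exact hasFDerivAt_const (𝕜 := ℂ) _ x
      | apply HasFDerivAt.fun_add
      | apply HasFDerivAt.fun_sub
      | apply HasFDerivAt.fun_neg
      | apply HasFDerivAt.fun_mul) ?_
  ext v
  simp only [covec_apply, sum_idx, gradK1, blocks_zero, blocks_one, blocks_two]
  simp
  ring

theorem hasFDerivAt_J1 (x : M) : HasFDerivAt J1 (covec (gradJ1 x)) x := by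
  unfold J1
  refine HasFDerivAt.congr_fderiv (by
    repeat' first
      | exact hasFDerivAt_apply (𝕜 := ℂ) _ x
      | exact hasFDerivAt_const (𝕜 := ℂ) _ x
      | apply HasFDerivAt.fun_add
      | apply HasFDerivAt.fun_sub
      | apply HasFDerivAt.fun_neg
      | apply HasFDerivAt.fun_mul) ?_
  ext v
  simp only [covec_apply, sum_idx, gradJ1, blocks_zero, blocks_one, blocks_two]
  simp
  ring

theorem hasFDerivAt_J2 (x : M) : HasFDerivAt J2 (covec (gradJ2 x)) x := by
  unfold J2
  refine HasFDerivAt.congr_fderiv (by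
    repeat' first
      | exact hasFDerivAt_apply (𝕜 := ℂ) _ x
      | exact hasFDerivAt_const (𝕜 := ℂ) _ x
      | apply HasFDerivAt.fun_add
      | apply HasFDerivAt.fun_sub
      | apply HasFDerivAt.fun_neg
      | apply HasFDerivAt.fun_mul) ?_
  ext v
  simp only [covec_apply, sum_idx, gradJ2, blocks_zero, blocks_one, blocks_two]
  simp
  ring

theorem hasFDerivAt_lead (x : M) : HasFDerivAt lead (covec (gradLead x)) x := by
  unfold lead
  refine HasFDerivAt.congr_fderiv (by
    repeat' first
      | exact hasFDerivAt_apply (𝕜 := ℂ) _ x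
      | exact hasFDerivAt_const (𝕜 := ℂ) _ x
      | apply HasFDerivAt.fun_add
      | apply HasFDerivAt.fun_sub
      | apply HasFDerivAt.fun_neg
      | apply HasFDerivAt.fun_mul) ?_
  ext v
  simp only [covec_apply, sum_idx, gradLead, blocks_zero, blocks_one, blocks_two]
  simp
  ring

theorem hasFDerivAt_g11 (x : M) (l : ℂ) :
    HasFDerivAt (fun y => g11 y l) (covec (gradG11 x l)) x := by
  unfold g11
  refine HasFDerivAt.congr_fderiv (by
    repeat' first
      | exact hasFDerivAt_apply (𝕜 := ℂ) _ x
      | exact hasFDerivAt_const (𝕜 := ℂ) _ x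
      | apply HasFDerivAt.fun_add
      | apply HasFDerivAt.fun_sub
      | apply HasFDerivAt.fun_neg
      | apply HasFDerivAt.fun_mul) ?_
  ext v
  simp only [covec_apply, sum_idx, gradG11, blocks_zero, blocks_one, blocks_two]
  simp
  ring

theorem hasFDerivAt_g12 (x : M) (l : ℂ) :
    HasFDerivAt (fun y => g12 y l) (covec (gradG12 x l)) x := by
  unfold g12
  refine HasFDerivAt.congr_fderiv (by
    repeat' first
      | exact hasFDerivAt_apply (𝕜 := ℂ) _ x
      | exact hasFDerivAt_const (𝕜 := ℂ) _ x
      | apply HasFDerivAt.fun_add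
      | apply HasFDerivAt.fun_sub
      | apply HasFDerivAt.fun_neg
      | apply HasFDerivAt.fun_mul) ?_
  ext v
  simp only [covec_apply, sum_idx, gradG12, blocks_zero, blocks_one, blocks_two]
  simp
  ring

theorem hasFDerivAt_g21 (x : M) (l : ℂ) :
    HasFDerivAt (fun y => g21 y l) (covec (gradG21 x l)) x := by
  unfold g21
  refine HasFDerivAt.congr_fderiv (by
    repeat' first
      | exact hasFDerivAt_apply (𝕜 := ℂ) _ x
      | exact hasFDerivAt_const (𝕜 := ℂ) _ x
      | apply HasFDerivAt.fun_add
      | apply HasFDerivAt.fun_sub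
      | apply HasFDerivAt.fun_neg
      | apply HasFDerivAt.fun_mul) ?_
  ext v
  simp only [covec_apply, sum_idx, gradG21, blocks_zero, blocks_one, blocks_two]
  simp
  ring

theorem hasFDerivAt_g22 (x : M) (l : ℂ) :
    HasFDerivAt (fun y => g22 y l) (covec (gradG22 x l)) x := by
  unfold g22 lead
  refine HasFDerivAt.congr_fderiv (by
    repeat' first
      | exact hasFDerivAt_apply (𝕜 := ℂ) _ x
      | exact hasFDerivAt_const (𝕜 := ℂ) _ x
      | apply HasFDerivAt.fun_add
      | apply HasFDerivAt.fun_sub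
      | apply HasFDerivAt.fun_neg
      | apply HasFDerivAt.fun_mul) ?_
  ext v
  simp only [covec_apply, sum_idx, gradG22, blocks_zero, blocks_one, blocks_two]
  simp
  ring

theorem hasFDerivAt_detFun (x : M) (l : ℂ) :
    HasFDerivAt (fun y => detFun y l) (covec (gradDet x l)) x := by
  refine HasFDerivAt.congr_fderiv (((hasFDerivAt_g11 x l).fun_mul (hasFDerivAt_g22 x l)).fun_sub
    ((hasFDerivAt_g12 x l).fun_mul (hasFDerivAt_g21 x l))) ?_
  simp only [gradDet, covec_add, covec_sub, covec_smul]
  module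


/-! ### Lenard relations -/

theorem tensorP_gradH0 (x : M) : tensorP x *ᵥ gradH0 x = 0 := by
  rw [tensorP_mulVec]
  refine ext_blocks ?_ ?_ ?_ <;> rw [forall_fin_four] <;> refine ⟨?_, ?_, ?_, ?_⟩ <;>
    simp [gradH0]

theorem tensorP_gradK0 (x : M) : tensorP x *ᵥ gradK0 x = 0 := by
  rw [tensorP_mulVec]
  refine ext_blocks ?_ ?_ ?_ <;> rw [forall_fin_four] <;> refine ⟨?_, ?_, ?_, ?_⟩ <;>
    simp [gradK0] <;> ring

theorem tensorP_gradJ1 (x : M) : tensorP x *ᵥ gradJ1 x = 0 := by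
  rw [tensorP_mulVec]
  refine ext_blocks ?_ ?_ ?_ <;> rw [forall_fin_four] <;> refine ⟨?_, ?_, ?_, ?_⟩ <;>
    simp [-mul_eq_zero, -mul_eq_mul_left_iff, gradJ1] <;> ring

theorem tensorP_gradJ2 (x : M) : tensorP x *ᵥ gradJ2 x = 0 := by
  rw [tensorP_mulVec]
  refine ext_blocks ?_ ?_ ?_ <;> rw [forall_fin_four] <;> refine ⟨?_, ?_, ?_, ?_⟩ <;>
    simp [-mul_eq_zero, -mul_eq_mul_left_iff, gradJ2] <;> ring

theorem tensorP'_gradJ1 (x : M) : tensorP' x *ᵥ gradJ1 x = 0 := by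
  rw [tensorP'_mulVec]
  refine ext_blocks ?_ ?_ ?_ <;> rw [forall_fin_four] <;> refine ⟨?_, ?_, ?_, ?_⟩ <;>
    simp [-mul_eq_zero, -mul_eq_mul_left_iff, gradJ1] <;> ring

theorem tensorP'_gradJ2 (x : M) : tensorP' x *ᵥ gradJ2 x = 0 := by
  rw [tensorP'_mulVec]
  refine ext_blocks ?_ ?_ ?_ <;> rw [forall_fin_four] <;> refine ⟨?_, ?_, ?_, ?_⟩ <;>
    simp [-mul_eq_zero, -mul_eq_mul_left_iff, gradJ2] <;> ring

/-- First link of the chain `H₀ → H₁ → H₂ → H₃ → 0`, which says that `H(λ)` is a Casimir of `P' -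
λP`. The minus signs reflect the alternating signs in `H(λ)`. -/
theorem tensorP'_gradH0 (x : M) : tensorP' x *ᵥ gradH0 x = -(tensorP x *ᵥ gradH1 x) := by
  rw [tensorP_mulVec, tensorP'_mulVec]
  refine ext_blocks ?_ ?_ ?_ <;> rw [forall_fin_four] <;> refine ⟨?_, ?_, ?_, ?_⟩ <;>
    simp [gradH0, gradH1] <;> ring

theorem tensorP'_gradH1 (x : M) : tensorP' x *ᵥ gradH1 x = -(tensorP x *ᵥ gradH2 x) := by
  rw [tensorP_mulVec, tensorP'_mulVec]
  refine ext_blocks ?_ ?_ ?_ <;> rw [forall_fin_four] <;> refine ⟨?_, ?_, ?_, ?_⟩ <;>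
    simp [gradH1, gradH2] <;> ring

theorem tensorP'_gradH2 (x : M) : tensorP' x *ᵥ gradH2 x = -(tensorP x *ᵥ gradH3 x) := by
  rw [tensorP_mulVec, tensorP'_mulVec]
  refine ext_blocks ?_ ?_ ?_ <;> rw [forall_fin_four] <;> refine ⟨?_, ?_, ?_, ?_⟩ <;>
    simp [-mul_eq_zero, -mul_eq_mul_left_iff, gradH2, gradH3] <;> ring

theorem tensorP'_gradH3 (x : M) : tensorP' x *ᵥ gradH3 x = 0 := by
  rw [tensorP'_mulVec]
  refine ext_blocks ?_ ?_ ?_ <;> rw [forall_fin_four] <;> refine ⟨?_, ?_, ?_, ?_⟩ <;>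
    simp [-mul_eq_zero, -mul_eq_mul_left_iff, gradH3] <;> ring

/-- Link of the second chain `K₀ → K₁ → 0`; here `K(λ)` has no alternating signs. -/
theorem tensorP'_gradK0 (x : M) : tensorP' x *ᵥ gradK0 x = tensorP x *ᵥ gradK1 x := by
  rw [tensorP_mulVec, tensorP'_mulVec]
  refine ext_blocks ?_ ?_ ?_ <;> rw [forall_fin_four] <;> refine ⟨?_, ?_, ?_, ?_⟩ <;>
    simp [-mul_eq_zero, -mul_eq_mul_left_iff, gradK0, gradK1] <;> ring

theorem tensorP'_gradK1 (x : M) : tensorP' x *ᵥ gradK1 x = 0 := by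
  rw [tensorP'_mulVec]
  refine ext_blocks ?_ ?_ ?_ <;> rw [forall_fin_four] <;> refine ⟨?_, ?_, ?_, ?_⟩ <;>
    simp [-mul_eq_zero, -mul_eq_mul_left_iff, gradK1] <;> ring

/-! ### Identities modulo the span of `Z₁` and `Z₂` -/

/-- Equality of vectors modulo the span of `∂/∂b₄` and `∂/∂a₄`. -/
def EqModZ (u v : M) : Prop := ∀ p : Idx, p ≠ (0, 3) → p ≠ (1, 3) → u p = v p

theorem EqModZ.mk {u v : M} (h00 : u (0, 0) = v (0, 0)) (h01 : u (0, 1) = v (0, 1))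
    (h02 : u (0, 2) = v (0, 2)) (h10 : u (1, 0) = v (1, 0)) (h11 : u (1, 1) = v (1, 1))
    (h12 : u (1, 2) = v (1, 2)) (h2 : ∀ i, u (2, i) = v (2, i)) : EqModZ u v := by
  rintro ⟨k, i⟩ hp hq
  fin_cases k
  · fin_cases i
    exacts [h00, h01, h02, absurd rfl hp]
  · fin_cases i
    exacts [h10, h11, h12, absurd rfl hq]
  · exact h2 i

/-- The numerator of the differential of `ρ(λ)`. -/
def rhoForm (x : M) (l : ℂ) : M := g22 x l • gradG12 x l - g12 x l • gradG22 x l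

/-- The numerator of the differential of `σ(λ)`. -/
def sigmaForm (x : M) (l : ℂ) : M := g21 x l • gradG11 x l - g11 x l • gradG21 x l

/-- The covector that governs the action of the pencil on `sigmaForm`. -/
def sigmaAux (x : M) : M := blocks
  ![c x 0 * c x 2, 0, c x 0 * c x 2, 0]
  ![a x 1 * c x 2, a x 0 * c x 2, 0, 0]
  ![0, 0, a x 0 * a x 1, 0]

/-- The defect in the eigenform equation is divisible by `Det 𝒢(λ)` and points along `∂/∂b₁` alone.
By `tensorP_gradLead` this direction is, modulo `Z₁` and `Z₂`, a multiple of `P d(lead)`, which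
identifies the one-form `α` of `ρ`. -/
theorem pencil_rhoForm (x : M) (l : ℂ) :
    EqModZ (tensorP' x *ᵥ rhoForm x l - l • (tensorP x *ᵥ rhoForm x l))
      (detFun x l • blocks ![-1, 0, 0, 0] 0 0) := by
  rw [tensorP_mulVec, tensorP'_mulVec]
  refine EqModZ.mk ?_ ?_ ?_ ?_ ?_ ?_ (forall_fin_four.2 ⟨?_, ?_, ?_, ?_⟩) <;>
    simp [rhoForm, detFun, gradG12, gradG22] <;>
    simp only [g11, g12, g21, g22, lead] <;> ring

theorem tensorP_gradLead (x : M) :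
    EqModZ (tensorP x *ᵥ gradLead x) (-lead x • blocks ![1, 0, 0, 0] 0 0) := by
  rw [tensorP_mulVec]
  refine EqModZ.mk ?_ ?_ ?_ ?_ ?_ ?_ (forall_fin_four.2 ⟨?_, ?_, ?_, ?_⟩) <;>
    simp [gradLead, lead] <;> ring

/-- Counterpart for `σ`: the defect points along `∂/∂a₃`, and `sigmaAux` takes the place of the
differential of `lead`. -/
theorem pencil_sigmaForm (x : M) (l : ℂ) :
    EqModZ (tensorP' x *ᵥ sigmaForm x l - l • (tensorP x *ᵥ sigmaForm x l))
      ((detFun x l * c x 2) • blocks 0 ![0, 0, 1, 0] 0) := by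
  rw [tensorP_mulVec, tensorP'_mulVec]
  refine EqModZ.mk ?_ ?_ ?_ ?_ ?_ ?_ (forall_fin_four.2 ⟨?_, ?_, ?_, ?_⟩) <;>
    simp [sigmaForm, detFun, gradG11, gradG21] <;>
    simp only [g11, g12, g21, g22, lead] <;> ring

theorem tensorP_sigmaAux (x : M) :
    EqModZ (tensorP x *ᵥ sigmaAux x) (-(lead x * c x 2) • blocks 0 ![0, 0, 1, 0] 0) := by
  rw [tensorP_mulVec]
  refine EqModZ.mk ?_ ?_ ?_ ?_ ?_ ?_ (forall_fin_four.2 ⟨?_, ?_, ?_, ?_⟩) <;>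
    simp [sigmaAux, lead] <;> ring

/-- The vector field that governs the action of the pencil on `gradDet`. -/
def eulerVec (x : M) (l : ℂ) : M := blocks
  ![l - b x 0, 0, 0, 0] ![-a x 0, 0, 2 * a x 2, 0] ![-c x 0, 2 * c x 1, c x 2, -2 * c x 3]

/-- At a root of `Det 𝒢` the right side vanishes, so the differential of the determinant, hence that
of the root, is an eigenform of `N*`. Away from the roots, the precise vector `eulerVec` is needed
in `isRoot_of_hasEigenvalue` and its multiple by the determinant in no other place. -/
theorem pencil_gradDet (x : M) (l : ℂ) :
    EqModZ (tensorP' x *ᵥ gradDet x l - l • (tensorP x *ᵥ gradDet x l))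
      (detFun x l • eulerVec x l) := by
  rw [tensorP_mulVec, tensorP'_mulVec]
  refine EqModZ.mk ?_ ?_ ?_ ?_ ?_ ?_ (forall_fin_four.2 ⟨?_, ?_, ?_, ?_⟩) <;>
    simp [gradDet, eulerVec, detFun, gradG11, gradG21, gradG12, gradG22] <;>
    simp only [g11, g12, g21, g22, lead] <;> ring


/-! ### The Casimir functions -/

/-- The gradients of the Casimir functions. -/
def gradCasimir (x : M) : Fin 4 → M := ![gradH0 x, gradK0 x, gradJ1 x, gradJ2 x]

theorem hasFDerivAt_casimir (x : M) (i : Fin 4) :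
    HasFDerivAt (casimir i) (covec (gradCasimir x i)) x := by
  fin_cases i
  exacts [hasFDerivAt_H0 x, hasFDerivAt_K0 x, hasFDerivAt_J1 x, hasFDerivAt_J2 x]

theorem diff_eq {F : M → ℂ} {x ξ : M} (h : HasFDerivAt F (covec ξ) x) :
    diff F x = (covec ξ).toLinearMap := by
  rw [diff, h.fderiv]

theorem diff_casimir (x : M) (i : Fin 4) :
    diff (casimir i) x = (covec (gradCasimir x i)).toLinearMap :=
  diff_eq (hasFDerivAt_casimir x i)

theorem mem_tangent {x v : M} : v ∈ tangent x ↔ ∀ i, covec (gradCasimir x i) v = 0 := by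
  simp [tangent, diff_casimir]

theorem tensorP_gradCasimir (x : M) (i : Fin 4) : tensorP x *ᵥ gradCasimir x i = 0 := by
  fin_cases i
  exacts [tensorP_gradH0 x, tensorP_gradK0 x, tensorP_gradJ1 x, tensorP_gradJ2 x]

/-- The points lying on generic leaves. -/
def IsGenericPoint (x : M) : Prop := IsGenericValue fun i => casimir i x

theorem IsGenericPoint.c_ne {x : M} (h : IsGenericPoint x) (i : Fin 4) : c x i ≠ 0 := by
  have h1 : J2 x ≠ 0 := h.1
  simp only [J2, mul_ne_zero_iff] at h1
  obtain ⟨⟨⟨h0, h1⟩, h2⟩, h3⟩ := h1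
  fin_cases i <;> assumption

theorem IsGenericPoint.sub_ne {x : M} (h : IsGenericPoint x) :
    c x 0 * c x 2 - c x 1 * c x 3 ≠ 0 := by
  have h1 : J1 x ^ 2 ≠ 4 * J2 x := h.2
  intro h2
  refine h1 (sub_eq_zero.1 ?_)
  simp only [J1, J2]
  linear_combination (c x 0 * c x 2 - c x 1 * c x 3) * h2

theorem isGenericPoint_of_leaf {κ : Fin 4 → ℂ} (hκ : IsGenericValue κ) {x : M}
    (hx : x ∈ leaf κ) : IsGenericPoint x := by
  have : (fun i => casimir i x) = κ := funext hx
  rwa [IsGenericPoint, this]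

/-- The covectors without `b` and `a` components that satisfy two linear relations are
combinations of `dJ₁` and `dJ₂`. -/
theorem exists_eq_gradJ {x η : M} (h : IsGenericPoint x) (hb : ∀ i, b η i = 0)
    (ha : ∀ i, a η i = 0) (h02 : c x 0 * c η 0 = c x 2 * c η 2)
    (h13 : c x 1 * c η 1 = c x 3 * c η 3) :
    ∃ s t : ℂ, η = s • gradJ1 x + t • gradJ2 x := by
  have hs := h.sub_ne
  have h0 := h.c_ne 0
  have h1 := h.c_ne 1
  have h2 := h.c_ne 2
  have h3 := h.c_ne 3
  -- Multiplied by `cᵢ`, the wanted equation reads `cᵢηᵢ = s cᵢcᵢ₊₂ + t J₂`. The difference of its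
  -- first two cases gives `s`, and then the first case gives `t`.
  obtain ⟨s, es⟩ : ∃ s, s * (c x 0 * c x 2 - c x 1 * c x 3) = c x 0 * c η 0 - c x 1 * c η 1 :=
    ⟨_, div_mul_cancel₀ _ hs⟩
  obtain ⟨t, et⟩ : ∃ t, t * (c x 0 * c x 1 * c x 2 * c x 3) = c x 0 * c η 0 - s * (c x 0 * c x 2) :=
    ⟨_, div_mul_cancel₀ _ (by simp [h0, h1, h2, h3])⟩
  refine ⟨s, t, ext_blocks (fun i => ?_) (fun i => ?_) ?_⟩
  · rw [show η (0, i) = 0 from hb i]; fin_cases i <;> simp [gradJ1, gradJ2]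
  · rw [show η (1, i) = 0 from ha i]; fin_cases i <;> simp [gradJ1, gradJ2]
  · rw [forall_fin_four]
    refine ⟨mul_left_cancel₀ h0 ?_, mul_left_cancel₀ h1 ?_, mul_left_cancel₀ h2 ?_,
      mul_left_cancel₀ h3 ?_⟩ <;> simp [-mul_eq_mul_left_iff, gradJ1, gradJ2]
    · linear_combination -et
    · linear_combination -et + es
    · linear_combination -et - h02
    · linear_combination -et + es - h13

/-- At a generic point, the kernel of `P` is spanned by the differentials of the Casimirs. -/
theorem exists_eq_sum_gradCasimir {x ξ : M} (h : IsGenericPoint x) (hξ : tensorP x *ᵥ ξ = 0) :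
    ∃ t : Fin 4 → ℂ, ξ = ∑ i, t i • gradCasimir x i := by
  have hs := h.sub_ne
  have hs' : c x 1 * c x 3 - c x 0 * c x 2 ≠ 0 := by
    rw [← neg_ne_zero]; simpa using hs
  -- The `b` components of `dH₀` all equal 1 and those of `dK₀` alternate between `c₂c₄` and `c₁c₃`,
  -- so subtracting suitable multiples makes the first two `b` components of `η` vanish.
  obtain ⟨t, et⟩ : ∃ t, t * (c x 1 * c x 3 - c x 0 * c x 2) = b ξ 0 - b ξ 1 :=
    ⟨_, div_mul_cancel₀ _ hs'⟩
  obtain ⟨η, hη⟩ : ∃ η, η = ξ - (b ξ 0 - t * (c x 1 * c x 3)) • gradH0 x - t • gradK0 x :=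
    ⟨_, rfl⟩
  have hP : tensorP x *ᵥ η = 0 := by
    rw [hη]
    simp [mulVec_sub, mulVec_smul, hξ, tensorP_gradH0, tensorP_gradK0]
  have hb0 : b η 0 = 0 := by simp [hη, gradH0, gradK0]
  have hb1 : b η 1 = 0 := by
    simp [hη, gradH0, gradK0]; linear_combination et
  rw [tensorP_mulVec] at hP
  have e0 := fun i => congrFun hP (0, i)
  have e1 := fun i => congrFun hP (1, i)
  have e2 := fun i => congrFun hP (2, i)
  rw [forall_fin_four] at e0 e1 e2
  obtain ⟨e00, e01, e02, e03⟩ := e0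
  obtain ⟨e10, e11, e12, e13⟩ := e1
  obtain ⟨e20, e21, e22, e23⟩ := e2
  simp [h.c_ne] at e00 e01 e02 e03 e10 e11 e12 e13 e20 e21 e22 e23
  have hb2 : b η 2 = 0 := by linear_combination hb0 - e20
  have hb3 : b η 3 = 0 := by linear_combination hb1 - e21
  simp only [hb0, hb1, hb2, hb3] at e10 e11 e12 e13
  -- The `a` rows of `Pη = 0` now decouple into two 2 × 2 systems, each with determinant `±(c₁c₃ -
  -- c₂c₄)`.
  have ha1 : a η 1 = 0 := by
    refine (mul_eq_zero.1 ?_).resolve_left hs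
    linear_combination -c x 2 * e10 - c x 3 * e12
  have ha3 : a η 3 = 0 := by
    refine (mul_eq_zero.1 ?_).resolve_left hs
    linear_combination -c x 1 * e10 - c x 0 * e12
  have ha0 : a η 0 = 0 := by
    refine (mul_eq_zero.1 ?_).resolve_left hs
    linear_combination c x 2 * e11 + c x 1 * e13
  have ha2 : a η 2 = 0 := by
    refine (mul_eq_zero.1 ?_).resolve_left hs
    linear_combination c x 3 * e11 + c x 0 * e13
  obtain ⟨s, r, hsr⟩ := exists_eq_gradJ h (forall_fin_four.2 ⟨hb0, hb1, hb2, hb3⟩)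
    (forall_fin_four.2 ⟨ha0, ha1, ha2, ha3⟩)
    (by linear_combination -e00 - a x 0 * ha0 + a x 3 * ha3)
    (by linear_combination -e01 + a x 0 * ha0 - a x 1 * ha1)
  refine ⟨![b ξ 0 - t * (c x 1 * c x 3), t, s, r], ?_⟩
  rw [Fin.sum_univ_four]
  have : ξ = η + (b ξ 0 - t * (c x 1 * c x 3)) • gradH0 x + t • gradK0 x := by
    rw [hη]; abel
  refine this.trans ?_
  rw [hsr]
  simp [gradCasimir]
  abel

theorem gradCasimir_independent {x : M} (h : IsGenericPoint x) {t : Fin 4 → ℂ}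
    (ht : ∑ i, t i • gradCasimir x i = 0) : t = 0 := by
  rw [Fin.sum_univ_four] at ht
  have hs := h.sub_ne
  have e0 := congrFun ht (0, 0)
  have e1 := congrFun ht (0, 1)
  have e2 := congrFun ht (2, 0)
  have e3 := congrFun ht (2, 1)
  simp [gradCasimir, gradH0, gradK0, gradJ1, gradJ2] at e0 e1 e2 e3
  have t1 : t 1 = 0 := by
    refine (mul_eq_zero.1 ?_).resolve_left hs
    linear_combination e1 - e0
  have t0 : t 0 = 0 := by simpa [t1] using e0
  simp only [t1] at e2 e3
  have t2 : t 2 = 0 := by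
    refine (mul_eq_zero.1 ?_).resolve_left hs
    linear_combination c x 0 * e2 - c x 1 * e3
  have t3 : t 3 = 0 := by simpa [t2, h.c_ne] using e2
  ext i
  fin_cases i <;> assumption

/-! ### Restriction of bivectors to the leaves -/

/-- A functional on `ℂ⁴` vanishing on the range of the four differentials would be a linear relation
among them. They are independent, so the range is everything and the kernel has dimension `12 - 4`.
-/
theorem finrank_tangent {x : M} (h : IsGenericPoint x) : Module.finrank ℂ (tangent x) = 8 := by
  let L : M →ₗ[ℂ] (Fin 4 → ℂ) := LinearMap.pi fun i => diff (casimir i) x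
  have hker : tangent x = LinearMap.ker L := (LinearMap.ker_pi _).symm
  have hrange : LinearMap.range L = ⊤ := by
    by_contra hne
    obtain ⟨φ, hφ0, hφ⟩ := Submodule.exists_le_ker_of_lt_top _ (lt_top_iff_ne_top.2 hne)
    refine hφ0 (LinearMap.pi_ext fun i s => ?_)
    have hφ' : ∀ y : Fin 4 → ℂ, φ y = ∑ i, y i * φ (Pi.single i 1) := fun y => by
      conv_lhs => rw [pi_eq_sum_univ' y]
      simp [map_sum, map_smul]
    have h0 : (fun i => φ (Pi.single i 1)) = 0 := by
      refine gradCasimir_independent h ?_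
      ext p
      have h1 : φ (L (Pi.single p 1)) = 0 := hφ (LinearMap.mem_range_self L _)
      rw [hφ'] at h1
      simpa [L, diff_casimir, covec_single, mul_comm] using h1
    rw [hφ']
    simp [congrFun h0 _]
  have := LinearMap.finrank_range_add_finrank_ker L
  rw [hrange, finrank_top, ← hker] at this
  simp at this
  omega

theorem mulVec_mem_tangent {x : M} {B : Matrix Idx Idx ℂ} (hB : Bᵀ = -B)
    (hC : ∀ i, B *ᵥ gradCasimir x i = 0) (ξ : M) : B *ᵥ ξ ∈ tangent x := by
  rw [mem_tangent]
  intro i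
  rw [covec_mulVec_swap hB, hC, map_zero, neg_zero]

/-- A covector that vanishes on the tangent space is a combination of the differentials of the
Casimirs. -/
theorem exists_eq_sum_of_tangent {x ξ : M} (hξ : ∀ v ∈ tangent x, covec ξ v = 0) :
    ∃ t : Fin 4 → ℂ, ξ = ∑ i, t i • gradCasimir x i := by
  have h : (covec ξ).toLinearMap ∈ Submodule.span ℂ
      (Set.range fun i => diff (casimir i) x) :=
    mem_span_of_iInf_ker_le_ker fun v hv => hξ v hv
  obtain ⟨t, ht⟩ := (Submodule.mem_span_range_iff_exists_fun ℂ).1 h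
  refine ⟨t, funext fun p => ?_⟩
  have := LinearMap.congr_fun ht (Pi.single p 1)
  simpa [diff_casimir, covec_single] using this.symm

/-- `Bξ` depends only on the restriction of `ξ`: two extensions of a covector differ by a
combination of the Casimir differentials, which `B` kills. Antisymmetry makes `Bξ` tangent. The map
`σ` chooses extensions linearly. -/
theorem isRestriction_restrict {x : M} {B : Matrix Idx Idx ℂ} (hB : Bᵀ = -B)
    (hC : ∀ i, B *ᵥ gradCasimir x i = 0) : IsRestriction x B (restrict x B) := by
  have hex : ∃ A, IsRestriction x B A := by
    obtain ⟨σ, hσ⟩ := ((tangent x).dualRestrict).exists_rightInverse_of_surjective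
      (LinearMap.range_eq_top.2 (Subspace.dualRestrict_surjective))
    let S : Module.Dual ℂ M →ₗ[ℂ] M :=
      { toFun := sharp B
        map_add' := fun ξ η => by
          rw [sharp, sharp, sharp, ← mulVec_add]; rfl
        map_smul' := fun t ξ => by
          rw [sharp, sharp, RingHom.id_apply, ← mulVec_smul]; rfl }
    have hS : ∀ ξ, S ξ ∈ tangent x := fun ξ =>
      mulVec_mem_tangent hB hC fun j => ξ (Pi.single j 1)
    refine ⟨(S.codRestrict _ hS) ∘ₗ σ, fun ξ => ?_⟩
    have h1 : ∀ v ∈ tangent x, σ (ξ ∘ₗ (tangent x).subtype) v = ξ v := fun v hv =>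
      LinearMap.congr_fun (LinearMap.congr_fun hσ (ξ ∘ₗ (tangent x).subtype)) ⟨v, hv⟩
    obtain ⟨η, hη⟩ := exists_covec (σ (ξ ∘ₗ (tangent x).subtype) - ξ)
    obtain ⟨t, ht⟩ := exists_eq_sum_of_tangent (x := x) (ξ := η) fun v hv => by
      have := LinearMap.congr_fun hη v
      simpa [h1 v hv] using this.symm
    have h2 : S (σ (ξ ∘ₗ (tangent x).subtype) - ξ) = 0 := by
      rw [hη]
      change sharp B _ = 0
      rw [sharp_covec, ht, mulVec_sum]
      simp [mulVec_smul, hC]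
    rw [map_sub, sub_eq_zero] at h2
    exact h2
  rw [restrict, dif_pos hex]
  exact hex.choose_spec

theorem restrict_leafDiff {x : M} {B : Matrix Idx Idx ℂ} (hB : Bᵀ = -B)
    (hC : ∀ i, B *ᵥ gradCasimir x i = 0) {ξ : M} :
    (restrict x B ((covec ξ).toLinearMap ∘ₗ (tangent x).subtype) : M) = B *ᵥ ξ := by
  rw [isRestriction_restrict hB hC, sharp_covec]

theorem isRestriction_tensorP (x : M) :
    IsRestriction x (tensorP x) (restrict x (tensorP x)) :=
  isRestriction_restrict (tensorP_transpose x) (tensorP_gradCasimir x)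

theorem restrict_tensorP_covec (x ξ : M) :
    (restrict x (tensorP x) ((covec ξ).toLinearMap ∘ₗ (tangent x).subtype) : M) =
      tensorP x *ᵥ ξ :=
  restrict_leafDiff (tensorP_transpose x) (tensorP_gradCasimir x)

theorem exists_covec_tangent {x : M} (η : Module.Dual ℂ (tangent x)) :
    ∃ ξ : M, η = (covec ξ).toLinearMap ∘ₗ (tangent x).subtype := by
  obtain ⟨η', hη'⟩ := LinearMap.exists_extend η
  obtain ⟨ξ, rfl⟩ := exists_covec η'
  exact ⟨ξ, hη'.symm⟩

theorem bijective_restrict_tensorP {x : M} (h : IsGenericPoint x) :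
    Function.Bijective (restrict x (tensorP x)) := by
  have hinj : Function.Injective (restrict x (tensorP x)) := by
    rw [← LinearMap.ker_eq_bot, LinearMap.ker_eq_bot']
    intro η hη
    obtain ⟨ξ, rfl⟩ := exists_covec_tangent η
    have h0 : tensorP x *ᵥ ξ = 0 := by rw [← restrict_tensorP_covec, hη]; rfl
    obtain ⟨t, ht⟩ := exists_eq_sum_gradCasimir h h0
    ext ⟨v, hv⟩
    rw [mem_tangent] at hv
    rw [ht]
    have hsum : covec (∑ i, t i • gradCasimir x i) = ∑ i, t i • covec (gradCasimir x i) := by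
      simp only [Fin.sum_univ_four, covec_add, covec_smul]
    simp [hsum, hv]
  exact ⟨hinj, (LinearMap.injective_iff_surjective_of_finrank_eq_finrank
    Subspace.dual_finrank_eq).1 hinj⟩

theorem exists_tangent_eq {x v : M} (h : IsGenericPoint x) (hv : v ∈ tangent x) :
    ∃ ξ, v = tensorP x *ᵥ ξ := by
  obtain ⟨η, hη⟩ := (bijective_restrict_tensorP h).2 ⟨v, hv⟩
  obtain ⟨ξ, rfl⟩ := exists_covec_tangent η
  exact ⟨ξ, by rw [← restrict_tensorP_covec, hη]⟩


/-! ### The tensor `Q` and the Nijenhuis tensor -/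

theorem matG_eq (x : M) : matG x = !![-1, -(c x 0 * c x 2); 0, lead x] := by
  have h0 : diff (f 0) x = (covec (gradH0 x)).toLinearMap := diff_casimir x 0
  have h1 : diff (f 1) x = (covec (gradK0 x)).toLinearMap := diff_casimir x 1
  ext i j
  fin_cases i <;> fin_cases j <;>
    simp [matG, Z, h0, h1, covec_single, gradH0, gradK0, lead]
  ring

theorem det_matG (x : M) : (matG x).det = -lead x := by
  simp [matG_eq, det_fin_two]

theorem det_matG_ne {x : M} : (matG x).det ≠ 0 ↔ lead x ≠ 0 := by
  rw [det_matG, neg_ne_zero]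

/-- The gradients of the two Casimirs that are not Casimirs of `P'`. -/
def gradF (x : M) : Fin 2 → M := ![gradH0 x, gradK0 x]

theorem X1_eq (x : M) (i : Fin 2) : X1 i x = tensorP' x *ᵥ gradF x i := by
  have : diff (f i) x = (covec (gradF x i)).toLinearMap := by
    fin_cases i
    exacts [diff_casimir x 0, diff_casimir x 1]
  rw [X1, this, sharp_covec]

theorem matG_apply (x : M) (i j : Fin 2) : matG x i j = covec (gradF x j) (Z i) := by
  have : diff (f j) x = (covec (gradF x j)).toLinearMap := by
    fin_cases j
    exacts [diff_casimir x 0, diff_casimir x 1]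
  simp [matG, this]

theorem wedge_mulVec (v w ξ : M) :
    wedge v w *ᵥ ξ = covec ξ v • w - covec ξ w • v := by
  ext p
  simp only [wedge, sub_mulVec, vecMulVec_mulVec, covec_apply]
  simp [dotProduct, mul_comm]

theorem tensorQ_mulVec (x ξ : M) : tensorQ x *ᵥ ξ = tensorP' x *ᵥ ξ -
    ∑ i, ∑ j, (matG x)⁻¹ i j • (covec ξ (Z j) • (tensorP' x *ᵥ gradF x i) -
      covec ξ (tensorP' x *ᵥ gradF x i) • Z j) := by
  simp only [tensorQ, sub_mulVec, sum_mulVec, smul_mulVec, wedge_mulVec, X1_eq]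

theorem wedge_transpose (v w : M) : (wedge v w)ᵀ = -wedge v w := by
  simp [wedge]

theorem tensorQ_transpose (x : M) : (tensorQ x)ᵀ = -tensorQ x := by
  simp only [tensorQ, transpose_sub, transpose_sum, transpose_smul, tensorP'_transpose,
    wedge_transpose, smul_neg, Finset.sum_neg_distrib]
  abel

theorem covec_self_mulVec {B : Matrix Idx Idx ℂ} (hB : Bᵀ = -B) (ξ : M) :
    covec ξ (B *ᵥ ξ) = 0 :=
  self_eq_neg.1 (covec_mulVec_swap hB ξ ξ)

/-- `P' dK₀ = P dK₁`, and `H₀` is a Casimir of `P`; the other cases follow by antisymmetry. -/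
theorem covec_gradF_P'_gradF (x : M) (i j : Fin 2) :
    covec (gradF x i) (tensorP' x *ᵥ gradF x j) = 0 := by
  have h : covec (gradH0 x) (tensorP' x *ᵥ gradK0 x) = 0 := by
    rw [tensorP'_gradK0, covec_mulVec_swap (tensorP_transpose x), tensorP_gradH0]
    simp
  fin_cases i <;> fin_cases j
  · exact covec_self_mulVec (tensorP'_transpose x) _
  · exact h
  · refine (covec_mulVec_swap (tensorP'_transpose x) _ _).trans ?_
    exact neg_eq_zero.2 h
  · exact covec_self_mulVec (tensorP'_transpose x) _

/-- This is the purpose of the coefficients `G⁻¹`: the terms along the `X₁ⁱ` add up to `∑ (G⁻¹G)ᵢₖ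
X₁ⁱ = P' df_k` and cancel the leading term, while the terms along `Z_j` vanish because `f₁`, `f₂`
are in involution for `P'`. -/
theorem tensorQ_gradF {x : M} (h : lead x ≠ 0) (k : Fin 2) : tensorQ x *ᵥ gradF x k = 0 := by
  have hG : IsUnit (matG x).det := (det_matG_ne.2 h).isUnit
  have h1 : ∀ i, ∑ j, (matG x)⁻¹ i j * matG x j k = (1 : Matrix (Fin 2) (Fin 2) ℂ) i k :=
    fun i => by rw [← Matrix.mul_apply, nonsing_inv_mul _ hG]
  rw [tensorQ_mulVec]
  simp only [covec_gradF_P'_gradF, zero_smul, sub_zero, ← matG_apply, smul_smul, ← Finset.sum_smul,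
    h1]
  simp [Matrix.one_apply]

theorem covec_Z {ξ : M} (h0 : ξ (0, 3) = 0) (h1 : ξ (1, 3) = 0) (j : Fin 2) :
    covec ξ (Z j) = 0 := by
  fin_cases j <;> simp [Z, covec_single, h0, h1]

theorem tensorQ_gradCasimir {x : M} (h : lead x ≠ 0) (k : Fin 4) :
    tensorQ x *ᵥ gradCasimir x k = 0 := by
  have hJ : ∀ ξ : M, ξ (0, 3) = 0 → ξ (1, 3) = 0 → tensorP' x *ᵥ ξ = 0 → tensorQ x *ᵥ ξ = 0 := by
    intro ξ h0 h1 h2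
    rw [tensorQ_mulVec, h2]
    simp [covec_Z h0 h1, covec_mulVec_swap (tensorP'_transpose x) ξ, h2]
  fin_cases k
  · exact tensorQ_gradF h 0
  · exact tensorQ_gradF h 1
  · exact hJ (gradJ1 x) rfl rfl (tensorP'_gradJ1 x)
  · exact hJ (gradJ2 x) rfl rfl (tensorP'_gradJ2 x)

theorem isRestriction_tensorQ {x : M} (h : lead x ≠ 0) :
    IsRestriction x (tensorQ x) (restrict x (tensorQ x)) :=
  isRestriction_restrict (tensorQ_transpose x) (tensorQ_gradCasimir h)

/-- If `P' ξ` and `P η` agree modulo `Z₁` and `Z₂`, and `ξ` annihilates `Z₁` and `Z₂`, then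
`Q ξ = P η`. -/
theorem tensorQ_eq_of_eqModZ {x ξ η : M} (h : lead x ≠ 0) (h0 : ξ (0, 3) = 0) (h1 : ξ (1, 3) = 0)
    (hξ : EqModZ (tensorP' x *ᵥ ξ) (tensorP x *ᵥ η)) : tensorQ x *ᵥ ξ = tensorP x *ᵥ η := by
  obtain ⟨u, hu⟩ : ∃ u, u = tensorQ x *ᵥ ξ - tensorP x *ᵥ η := ⟨_, rfl⟩
  have hmod : ∀ p : Idx, p ≠ (0, 3) → p ≠ (1, 3) → u p = 0 := by
    intro p hp hq
    have hZ : ∀ j, Z j p = 0 := fun j => by fin_cases j <;> simp [Z, hp, hq]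
    rw [hu, tensorQ_mulVec]
    simp [covec_Z h0 h1, hZ, hξ p hp hq]
  -- By `hmod`, `u` is a combination of `Z₁` and `Z₂`. Being tangent to the leaf, it is annihilated
  -- by `dH₀` and `dK₀`, and the resulting system is invertible because `lead` is nonzero.
  have ht : u ∈ tangent x := hu ▸ Submodule.sub_mem _
    (mulVec_mem_tangent (tensorQ_transpose x) (tensorQ_gradCasimir h) ξ)
    (mulVec_mem_tangent (tensorP_transpose x) (tensorP_gradCasimir x) η)
  rw [mem_tangent] at ht
  have ht0 : covec (gradH0 x) u = 0 := ht 0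
  have ht1 : covec (gradK0 x) u = 0 := ht 1
  simp [covec_apply, sum_idx, hmod, gradH0, gradK0] at ht0 ht1
  have hu1 : u (1, 3) = 0 := by
    refine (mul_eq_zero.1 ?_).resolve_left h
    simp only [lead]
    rw [ht0] at ht1
    linear_combination ht1
  rw [← sub_eq_zero, ← hu]
  ext p
  by_cases hp : p = (0, 3)
  · rw [hp]; exact ht0
  by_cases hq : p = (1, 3)
  · rw [hq]; exact hu1
  exact hmod p hp hq

theorem nijenhuis_tensorP {x : M} (hx : IsGenericPoint x) (h : lead x ≠ 0) (ξ : M)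
    (hv : tensorP x *ᵥ ξ ∈ tangent x) :
    (nijenhuis x ⟨tensorP x *ᵥ ξ, hv⟩ : M) = tensorQ x *ᵥ ξ := by
  have hb := bijective_restrict_tensorP hx
  have h1 : (LinearEquiv.ofBijective (restrict x (tensorP x)) hb).symm ⟨tensorP x *ᵥ ξ, hv⟩ =
      (covec ξ).toLinearMap ∘ₗ (tangent x).subtype := by
    rw [LinearEquiv.symm_apply_eq]
    exact Subtype.ext (restrict_tensorP_covec x ξ).symm
  rw [nijenhuis, dif_pos hb]
  simp only [LinearMap.comp_apply, LinearEquiv.coe_coe, h1]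
  exact restrict_leafDiff (tensorQ_transpose x) (tensorQ_gradCasimir h)

/-- If `Q ξ = P η`, then `N* ξ = η` on the leaf. -/
theorem covec_nijenhuis {x ξ η : M} (hx : IsGenericPoint x) (h : lead x ≠ 0)
    (hξ : tensorQ x *ᵥ ξ = tensorP x *ᵥ η) (v : tangent x) :
    covec ξ (nijenhuis x v) = covec η v := by
  obtain ⟨v, hv⟩ := v
  -- For `v = Pζ`: `ξ(Nv) = ξ(Qζ) = -ζ(Qξ) = -ζ(Pη) = η(Pζ)`.
  obtain ⟨ζ, rfl⟩ := exists_tangent_eq hx hv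
  rw [nijenhuis_tensorP hx h, covec_mulVec_swap (tensorQ_transpose x), hξ,
    covec_mulVec_swap (tensorP_transpose x), neg_neg]


/-! ### The matrix `𝒢(λ)` -/

theorem polyH_coeff (x : M) :
    (polyH x).coeff 0 = H3 x ∧ (polyH x).coeff 1 = -H2 x ∧ (polyH x).coeff 2 = H1 x ∧
      (polyH x).coeff 3 = -H0 x := by
  refine ⟨?_, ?_, ?_, ?_⟩ <;> simp [polyH, coeff_X, coeff_C]

theorem polyK_coeff (x : M) :
    (polyK x).coeff 0 = K1 x ∧ (polyK x).coeff 1 = K0 x ∧ (polyK x).coeff 2 = 0 ∧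
      (polyK x).coeff 3 = 0 := by
  refine ⟨?_, ?_, ?_, ?_⟩ <;> simp [polyK, coeff_X, coeff_C]

theorem liePoly_polyH (v x : M) : liePoly v polyH x =
    C (covec (gradH3 x) v) - C (covec (gradH2 x) v) * X + C (covec (gradH1 x) v) * X ^ 2
      - C (covec (gradH0 x) v) * X ^ 3 := by
  have h0 : diff (fun y => H3 y) x v = covec (gradH3 x) v := by
    rw [diff_eq (hasFDerivAt_H3 x)]; rfl
  have h1 : diff (fun y => -H2 y) x v = -covec (gradH2 x) v := by
    rw [diff, (hasFDerivAt_H2 x).fun_neg.fderiv]; rfl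
  have h2 : diff (fun y => H1 y) x v = covec (gradH1 x) v := by
    rw [diff_eq (hasFDerivAt_H1 x)]; rfl
  have h3 : diff (fun y => -H0 y) x v = -covec (gradH0 x) v := by
    rw [diff, (hasFDerivAt_H0 x).fun_neg.fderiv]; rfl
  simp only [liePoly, Finset.sum_range_succ, Finset.sum_range_zero, polyH_coeff, h0, h1, h2, h3,
    map_neg]
  ring

theorem liePoly_polyK (v x : M) : liePoly v polyK x =
    C (covec (gradK1 x) v) + C (covec (gradK0 x) v) * X := by
  have h0 : diff (fun y => K1 y) x v = covec (gradK1 x) v := by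
    rw [diff_eq (hasFDerivAt_K1 x)]; rfl
  have h1 : diff (fun y => K0 y) x v = covec (gradK0 x) v := by
    rw [diff_eq (hasFDerivAt_K0 x)]; rfl
  have h2 : diff (fun _ => (0 : ℂ)) x v = 0 := by
    rw [diff, fderiv_const_apply]; rfl
  simp only [liePoly, Finset.sum_range_succ, Finset.sum_range_zero, polyK_coeff, h0, h1, h2,
    map_zero]
  ring

theorem calG_zero_zero (x : M) : calG x 0 0 = X ^ 3 - C (b x 0 + b x 1 + b x 2) * X ^ 2
    + C (b x 0 * b x 1 + b x 0 * b x 2 + b x 1 * b x 2 + a x 0 + a x 1) * X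
    - C (c x 0 + b x 2 * a x 0 + b x 0 * a x 1 + b x 0 * b x 1 * b x 2) := by
  change liePoly (Z 0) polyH x = _
  rw [liePoly_polyH]
  simp [Z, covec_single, gradH0, gradH1, gradH2, gradH3]
  ring

theorem calG_zero_one (x : M) :
    calG x 0 1 = X ^ 2 - C (b x 1 + b x 2) * X + C (b x 1 * b x 2 + a x 1) := by
  change liePoly (Z 1) polyH x = _
  rw [liePoly_polyH]
  simp [Z, covec_single, gradH0, gradH1, gradH2, gradH3]
  ring

theorem calG_one_zero (x : M) : calG x 1 0 =
    C (-(c x 0 * c x 2)) * X + C (b x 1 * c x 0 * c x 2 - a x 0 * a x 1 * c x 2) := by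
  change liePoly (Z 0) polyK x = _
  rw [liePoly_polyK]
  simp [Z, covec_single, gradK0, gradK1]
  ring

theorem calG_one_one (x : M) : calG x 1 1 = C (lead x) * X +
    C (b x 1 * a x 2 * c x 0 + b x 2 * a x 0 * c x 1 - a x 0 * a x 1 * a x 2 + c x 0 * c x 1) := by
  change liePoly (Z 1) polyK x = _
  rw [liePoly_polyK]
  simp [Z, covec_single, gradK0, gradK1, lead]
  ring

theorem eval_calG_zero_zero (x : M) (l : ℂ) : (calG x 0 0).eval l = g11 x l := by
  simp only [calG_zero_zero, g11, eval_add, eval_sub, eval_mul, eval_pow, eval_X, eval_C]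

theorem eval_calG_zero_one (x : M) (l : ℂ) : (calG x 0 1).eval l = g12 x l := by
  simp only [calG_zero_one, g12, eval_add, eval_sub, eval_mul, eval_pow, eval_X, eval_C]

theorem eval_calG_one_zero (x : M) (l : ℂ) : (calG x 1 0).eval l = g21 x l := by
  simp only [calG_one_zero, g21, eval_add, eval_mul, eval_X, eval_C]

theorem eval_calG_one_one (x : M) (l : ℂ) : (calG x 1 1).eval l = g22 x l := by
  simp only [calG_one_one, g22, eval_add, eval_mul, eval_X, eval_C]

theorem eval_det_calG (x : M) (l : ℂ) : (calG x).det.eval l = detFun x l := by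
  rw [det_fin_two, eval_sub, eval_mul, eval_mul, eval_calG_zero_zero, eval_calG_zero_one,
    eval_calG_one_zero, eval_calG_one_one, detFun]

/-- The coefficients of `Det 𝒢(λ)`. -/
def detCoeff (x : M) : Fin 4 → ℂ :=
  let s₂ := b x 0 + b x 1 + b x 2
  let s₁ := b x 0 * b x 1 + b x 0 * b x 2 + b x 1 * b x 2 + a x 0 + a x 1
  let s₀ := c x 0 + b x 2 * a x 0 + b x 0 * a x 1 + b x 0 * b x 1 * b x 2
  let t := b x 1 * a x 2 * c x 0 + b x 2 * a x 0 * c x 1 - a x 0 * a x 1 * a x 2 + c x 0 * c x 1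
  let q₁ := b x 1 + b x 2
  let q₀ := b x 1 * b x 2 + a x 1
  let m := c x 0 * c x 2
  let r := b x 1 * c x 0 * c x 2 - a x 0 * a x 1 * c x 2
  ![-s₀ * t - q₀ * r, s₁ * t - s₀ * lead x + q₀ * m + q₁ * r,
    s₁ * lead x - s₂ * t - q₁ * m - r, t - s₂ * lead x + m]

theorem det_calG (x : M) : (calG x).det = C (lead x) * X ^ 4 + C (detCoeff x 3) * X ^ 3
    + C (detCoeff x 2) * X ^ 2 + C (detCoeff x 1) * X + C (detCoeff x 0) := by
  rw [det_fin_two, calG_zero_zero, calG_zero_one, calG_one_zero, calG_one_one]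
  generalize hg : lead x = g
  simp [detCoeff, hg]
  ring

theorem natDegree_det_calG {x : M} (h : lead x ≠ 0) : (calG x).det.natDegree = 4 := by
  rw [det_calG]
  compute_degree!

theorem natDegree_det_calG_le (x : M) : (calG x).det.natDegree ≤ 4 := by
  rw [det_calG]
  compute_degree

theorem coeff_det_calG (x : M) (k : Fin 4) : (calG x).det.coeff k = detCoeff x k := by
  rw [det_calG]
  fin_cases k <;> simp [coeff_X, coeff_C]

theorem coeff_four_det_calG (x : M) : (calG x).det.coeff 4 = lead x := by
  rw [det_calG]
  simp

theorem leadingCoeff_det_calG {x : M} (h : lead x ≠ 0) : (calG x).det.leadingCoeff = lead x := by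
  rw [leadingCoeff, natDegree_det_calG h, coeff_four_det_calG]

theorem rho_eq (x : M) (l : ℂ) : rho x l = -g22 x l / g12 x l := by
  rw [rho, eval_calG_one_one, eval_calG_zero_one]

theorem sigma_eq (x : M) (l : ℂ) : sigma x l = -g21 x l / g11 x l := by
  rw [sigma, eval_calG_one_zero, eval_calG_zero_zero]

theorem rho_explicit (x : M) (l : ℂ) : rho x l =
    -((-(c x 0 * a x 2) - a x 0 * c x 1) * l + c x 1 * a x 0 * b x 2 - a x 0 * a x 1 * a x 2
        + c x 0 * b x 1 * a x 2 + c x 0 * c x 1) /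
      (l ^ 2 - (b x 1 + b x 2) * l + b x 1 * b x 2 + a x 1) := by
  rw [rho_eq, g22, g12, lead]
  congr 1 <;> ring

/-! ### The eigenvalues of the Nijenhuis tensor -/

theorem hasEigenvalue_of_tensorQ {x ξ : M} {l : ℂ} (hx : IsGenericPoint x) (h : lead x ≠ 0)
    (hξ : tensorQ x *ᵥ ξ = l • (tensorP x *ᵥ ξ)) (h0 : tensorP x *ᵥ ξ ≠ 0) :
    Module.End.HasEigenvalue (nijenhuis x) l := by
  have hv : tensorP x *ᵥ ξ ∈ tangent x :=
    mulVec_mem_tangent (tensorP_transpose x) (tensorP_gradCasimir x) ξ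
  refine Module.End.hasEigenvalue_of_hasEigenvector (x := ⟨tensorP x *ᵥ ξ, hv⟩)
    ⟨Module.End.mem_eigenspace_iff.2 (Subtype.ext ?_), fun h1 => h0 (congrArg Subtype.val h1)⟩
  rw [nijenhuis_tensorP hx h, hξ]
  rfl

theorem exists_tensorQ_of_hasEigenvalue {x : M} {l : ℂ} (hx : IsGenericPoint x) (h : lead x ≠ 0)
    (hl : Module.End.HasEigenvalue (nijenhuis x) l) :
    ∃ ξ, tensorQ x *ᵥ ξ = l • (tensorP x *ᵥ ξ) ∧ tensorP x *ᵥ ξ ≠ 0 := by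
  obtain ⟨⟨v, hv⟩, hvl, hv0⟩ := hl.exists_hasEigenvector
  obtain ⟨ξ, rfl⟩ := exists_tangent_eq hx hv
  refine ⟨ξ, ?_, fun h0 => hv0 (Subtype.ext h0)⟩
  rw [← nijenhuis_tensorP hx h ξ hv, Module.End.mem_eigenspace_iff.1 hvl]
  rfl

/-- The components of a combination of the gradients of `𝒢₁₂` and `𝒢₂₂`. -/
theorem pencil_columnForm (x : M) (l u v : ℂ) (h1 : u * g11 x l + v * g21 x l = 0)
    (h2 : u * g12 x l + v * g22 x l = 0) :
    EqModZ (tensorP' x *ᵥ (u • gradG12 x l + v • gradG22 x l))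
      (l • (tensorP x *ᵥ (u • gradG12 x l + v • gradG22 x l))) := by
  simp only [g11, g12, g21, g22, lead] at h1 h2
  rw [tensorP_mulVec, tensorP'_mulVec]
  refine EqModZ.mk ?_ ?_ ?_ ?_ ?_ ?_ (forall_fin_four.2 ⟨?_, ?_, ?_, ?_⟩) <;>
    simp [-mul_eq_mul_left_iff, gradG12, gradG22]
  · linear_combination -h1 + (l - b x 0) * h2
  · ring
  · ring
  · linear_combination -a x 0 * h2
  · ring
  · linear_combination a x 2 * h2
  · linear_combination -c x 0 * h2
  · linear_combination c x 1 * h2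
  · linear_combination c x 2 * h2
  · linear_combination -c x 3 * h2

/-- A covector in the kernel of `P` that annihilates `Z₁` and `Z₂` has no `b` and `a`
components. -/
theorem eq_zero_of_tensorP_eq_zero {x ξ : M} (hx : IsGenericPoint x) (h : lead x ≠ 0)
    (h0 : ξ (0, 3) = 0) (h1 : ξ (1, 3) = 0) (hξ : tensorP x *ᵥ ξ = 0) (i : Fin 4) :
    b ξ i = 0 ∧ a ξ i = 0 := by
  obtain ⟨t, rfl⟩ := exists_eq_sum_gradCasimir hx hξ
  rw [Fin.sum_univ_four] at *
  simp [gradCasimir, gradH0, gradK0, gradJ1, gradJ2] at h0 h1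
  have t1 : t 1 = 0 := by
    refine h1.resolve_right fun h2 => h ?_
    simp only [lead]
    linear_combination h2
  have t0 : t 0 = 0 := by simpa [t1] using h0
  constructor <;> fin_cases i <;> simp [gradCasimir, t0, t1, gradJ1, gradJ2]

/-- A left null vector `(u, v)` of `𝒢(l)` makes `u d𝒢₁₂ + v d𝒢₂₂` an eigencovector by
`pencil_columnForm`. What remains is that, for some choice of null vector, it is nonzero on the
leaf. -/
theorem hasEigenvalue_of_isRoot {x : M} {l : ℂ} (hx : IsGenericPoint x) (h : lead x ≠ 0)
    (hl : detFun x l = 0) : Module.End.HasEigenvalue (nijenhuis x) l := by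
  have key : ∀ u v : ℂ, u * g11 x l + v * g21 x l = 0 → u * g12 x l + v * g22 x l = 0 →
      ¬ Module.End.HasEigenvalue (nijenhuis x) l →
      ∀ i, b (u • gradG12 x l + v • gradG22 x l) i = 0 ∧
        a (u • gradG12 x l + v • gradG22 x l) i = 0 := by
    intro u v h1 h2 hn
    refine eq_zero_of_tensorP_eq_zero hx h ?_ ?_ ?_
    · simp [gradG12, gradG22]
    · simp [gradG12, gradG22]
    · by_contra hne
      refine hn (hasEigenvalue_of_tensorQ hx h ?_ hne)
      rw [← mulVec_smul]
      refine tensorQ_eq_of_eqModZ h ?_ ?_ ?_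
      · simp [gradG12, gradG22]
      · simp [gradG12, gradG22]
      · rw [mulVec_smul]
        exact pencil_columnForm x l u v h1 h2
  by_contra hn
  -- If the first row of `𝒢(l)` vanishes, `(1, 0)` is a left null vector, and `d𝒢₁₂` has `a₂`
  -- component 1.
  have hG : g11 x l ≠ 0 ∨ g12 x l ≠ 0 := by
    by_contra! hG
    have := (key 1 0 (by simp [hG.1]) (by simp [hG.2]) hn 1).2
    simp [gradG12] at this
  obtain ⟨w, hw0, hw⟩ := exists_vecMul_eq_zero_iff.2
    (show (!![g11 x l, g12 x l; g21 x l, g22 x l]).det = 0 by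
      rw [det_fin_two_of]; exact hl)
  have h1 : w 0 * g11 x l + w 1 * g21 x l = 0 := by
    simpa [vecMul, dotProduct] using congrFun hw 0
  have h2 : w 0 * g12 x l + w 1 * g22 x l = 0 := by
    simpa [vecMul, dotProduct] using congrFun hw 1
  -- If the covector attached to `w` also vanishes on the leaf, its components force the first row
  -- of `𝒢(l)` to vanish, which `hG` excludes.
  have e := key _ _ h1 h2 hn
  have e1 := (e 1).1
  have e2 := (e 2).1
  have e3 := (e 0).2
  have e4 := (e 1).2
  have e5 := (e 2).2
  simp [gradG12, gradG22] at e1 e2 e3 e4 e5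
  have hw1 : w 1 ≠ 0 := by
    intro hw1
    refine hw0 (funext fun i => ?_)
    fin_cases i
    · simpa [hw1] using e4
    · exact hw1
  have hc0 := hx.c_ne 0
  have hc1 := hx.c_ne 1
  have e3' : c x 1 * (b x 2 - l) = a x 1 * a x 2 := by
    linear_combination e3.resolve_left hw1
  have e5' : c x 0 * (b x 1 - l) = a x 0 * a x 1 := by
    linear_combination e5.resolve_left hw1
  have hu : w 0 = w 1 * (a x 0 * a x 2) := by linear_combination e4
  rw [hu] at e1 e2 h1 h2
  have ha2 : a x 2 ≠ 0 := by
    intro ha2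
    have : b x 2 - l = 0 := by simpa [ha2, hc1] using e3'
    have h3 : a x 0 = 0 := by simpa [ha2, hw1, hc1] using e2
    exact h (by simp [lead, ha2, h3])
  have ha0 : a x 0 ≠ 0 := by
    intro ha0
    have h3 : a x 2 = 0 := by simpa [ha0, hw1, hc0] using e1
    exact ha2 h3
  have e1' : a x 0 * (b x 2 - l) = -c x 0 := by
    refine mul_left_cancel₀ (mul_ne_zero hw1 ha2) ?_
    linear_combination e1
  have h12 : g12 x l = 0 := by
    refine mul_left_cancel₀ hc0 ?_
    simp only [g12]
    linear_combination (b x 2 - l) * e5' + a x 1 * e1'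
  have h21 : g21 x l = 0 := by
    simp only [g21]
    linear_combination c x 2 * e5'
  rw [h21, mul_zero, add_zero] at h1
  have h11 : g11 x l = 0 := (mul_eq_zero.1 h1).resolve_left
    (mul_ne_zero hw1 (mul_ne_zero ha0 ha2))
  exact hG.elim (fun h => h h11) fun h => h h12

theorem covec_eq_of_eqModZ {ξ u v : M} (h0 : ξ (0, 3) = 0) (h1 : ξ (1, 3) = 0)
    (h : EqModZ u v) : covec ξ u = covec ξ v := by
  rw [covec_apply, covec_apply]
  refine Finset.sum_congr rfl fun p _ => ?_
  by_cases hp : p = (0, 3)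
  · simp [hp, h0]
  by_cases hq : p = (1, 3)
  · simp [hq, h1]
  rw [h p hp hq]

/-- Antisymmetry moves `P' - lP` from `η` to `ξ`, where it gives zero modulo `Z₁`, `Z₂`. Congruences
suffice because both covectors annihilate these fields. -/
theorem covec_pencil_eq_zero {x ξ η w : M} {l : ℂ} (h0 : ξ (0, 3) = 0) (h1 : ξ (1, 3) = 0)
    (hη0 : η (0, 3) = 0) (hη1 : η (1, 3) = 0)
    (hξ : EqModZ (tensorP' x *ᵥ ξ) (l • (tensorP x *ᵥ ξ)))
    (hη : EqModZ (tensorP' x *ᵥ η - l • (tensorP x *ᵥ η)) w) : covec ξ w = 0 := by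
  rw [← covec_eq_of_eqModZ h0 h1 hη, map_sub, map_smul,
    covec_mulVec_swap (tensorP'_transpose x), covec_mulVec_swap (tensorP_transpose x),
    covec_eq_of_eqModZ hη0 hη1 hξ, map_smul, smul_neg, sub_neg_eq_add, neg_add_cancel]

theorem tensorQ_eqModZ {x ξ : M} (h0 : ξ (0, 3) = 0) (h1 : ξ (1, 3) = 0) :
    EqModZ (tensorQ x *ᵥ ξ) (tensorP' x *ᵥ ξ) := by
  intro p hp hq
  have hZ : ∀ j, Z j p = 0 := fun j => by fin_cases j <;> simp [Z, hp, hq]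
  rw [tensorQ_mulVec]
  simp [covec_Z h0 h1, hZ]

/-- One more covector whose image under the pencil is divisible by `Det 𝒢`; it supplies the fourth
linear condition on an eigencovector in `isRoot_of_hasEigenvalue`. -/
theorem pencil_mixedForm (x : M) (l : ℂ) :
    EqModZ (tensorP' x *ᵥ (g22 x l • gradG11 x l - g12 x l • gradG21 x l)
        - l • (tensorP x *ᵥ (g22 x l • gradG11 x l - g12 x l • gradG21 x l)))
      (detFun x l • blocks 0 ![0, 0, a x 2, 0] ![0, c x 1, 0, -c x 3]) := by
  rw [tensorP_mulVec, tensorP'_mulVec]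
  refine EqModZ.mk ?_ ?_ ?_ ?_ ?_ ?_ (forall_fin_four.2 ⟨?_, ?_, ?_, ?_⟩) <;>
    simp [detFun, gradG11, gradG21] <;>
    simp only [g11, g12, g21, g22, lead] <;> ring

theorem isRoot_of_hasEigenvalue {x : M} {l : ℂ} (hx : IsGenericPoint x) (h : lead x ≠ 0)
    (hl : Module.End.HasEigenvalue (nijenhuis x) l) : detFun x l = 0 := by
  by_contra hD
  obtain ⟨ξ', hξ', hne⟩ := exists_tensorQ_of_hasEigenvalue hx h hl
  -- Subtracting multiples of `dH₀` and `dK₀`, which both `P` and `Q` kill, makes the covector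
  -- annihilate `Z₁` and `Z₂`, so that `Q` may be replaced by `P'` modulo these fields.
  obtain ⟨t, ht⟩ : ∃ t, t * lead x = a ξ' 3 := ⟨_, div_mul_cancel₀ _ h⟩
  obtain ⟨ξ, hξ⟩ : ∃ ξ, ξ = ξ' - (b ξ' 3 - t * (c x 0 * c x 2)) • gradH0 x - t • gradK0 x :=
    ⟨_, rfl⟩
  have h0 : ξ (0, 3) = 0 := by simp [hξ, gradH0, gradK0]
  have h1 : ξ (1, 3) = 0 := by
    simp only [lead] at ht
    simp [hξ, gradH0, gradK0]
    linear_combination -ht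
  have hP : tensorP x *ᵥ ξ = tensorP x *ᵥ ξ' := by
    simp [hξ, mulVec_sub, mulVec_smul, tensorP_gradH0, tensorP_gradK0]
  have hQ : tensorQ x *ᵥ ξ = tensorQ x *ᵥ ξ' := by
    have q0 : tensorQ x *ᵥ gradH0 x = 0 := tensorQ_gradF h 0
    have q1 : tensorQ x *ᵥ gradK0 x = 0 := tensorQ_gradF h 1
    simp [hξ, mulVec_sub, mulVec_smul, q0, q1]
  have hmod : EqModZ (tensorP' x *ᵥ ξ) (l • (tensorP x *ᵥ ξ)) := fun p hp hq => by
    rw [← tensorQ_eqModZ h0 h1 p hp hq, hQ, hξ', hP]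
  refine hne ?_
  rw [← hP]
  -- Since `Det 𝒢(l) ≠ 0`, the four pencil identities give four linear conditions on `ξ`: its `b₁`
  -- and `a₃` components vanish, and the relations `hT` and `hS` below hold.
  have p22 := covec_pencil_eq_zero h0 h1 (by simp [rhoForm, gradG12, gradG22])
    (by simp [rhoForm, gradG12, gradG22]) hmod (pencil_rhoForm x l)
  have p11 := covec_pencil_eq_zero h0 h1 (by simp [sigmaForm, gradG11, gradG21])
    (by simp [sigmaForm, gradG11, gradG21]) hmod (pencil_sigmaForm x l)
  have p21 := covec_pencil_eq_zero h0 h1 (by simp [gradG11, gradG21])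
    (by simp [gradG11, gradG21]) hmod (pencil_mixedForm x l)
  have pD := covec_pencil_eq_zero h0 h1 (by simp [gradDet, gradG11, gradG21, gradG12, gradG22])
    (by simp [gradDet, gradG11, gradG21, gradG12, gradG22]) hmod (pencil_gradDet x l)
  have hc2 := hx.c_ne 2
  rw [covec_apply, sum_idx] at p22 p11 p21 pD
  simp [eulerVec, hD, hc2] at p22 p11 p21 pD
  rw [tensorP_mulVec, tensorP'_mulVec] at hmod
  have r00 := hmod (0, 0) (by decide) (by decide)
  have r01 := hmod (0, 1) (by decide) (by decide)
  have r02 := hmod (0, 2) (by decide) (by decide)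
  have r10 := hmod (1, 0) (by decide) (by decide)
  have r11 := hmod (1, 1) (by decide) (by decide)
  have r12 := hmod (1, 2) (by decide) (by decide)
  have r20 := hmod (2, 0) (by decide) (by decide)
  have r21 := hmod (2, 1) (by decide) (by decide)
  simp [-mul_eq_mul_left_iff, p22, p11, h0, h1] at r00 r01 r02 r10 r11 r12 r20 r21
  have hc0 := hx.c_ne 0
  have hT : c x 1 * c ξ 1 = c x 3 * c ξ 3 := by
    refine mul_left_cancel₀ hD ?_
    rw [p11] at p21
    linear_combination p21
  have hS : a x 0 * a ξ 0 + c x 0 * c ξ 0 - c x 2 * c ξ 2 = 0 := by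
    refine (mul_eq_zero.1 ?_).resolve_left hD
    rw [p11, p22] at pD
    linear_combination -pD + 2 * detFun x l * hT
  have e1 : (b x 2 - l) * b ξ 2 = a x 0 * a ξ 0 - a x 1 * a ξ 1 := by
    refine mul_left_cancel₀ hc0 ?_
    linear_combination -r20 - c x 0 * hT
  have e2 : (b x 1 - l) * b ξ 1 = -(a x 1 * a ξ 1) := by
    refine mul_left_cancel₀ (hx.c_ne 1) ?_
    linear_combination r21 - c x 1 * hS
  have e3 : a x 0 * b ξ 1 = -(c x 0 * a ξ 1) := by
    linear_combination r00 + (b x 0 - l) * hS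
  have e4 : a x 1 * b ξ 2 = (b x 1 - l) * (a x 1 * a ξ 1 - a x 0 * a ξ 0) := by
    linear_combination r01 + (b x 1 - l) * hT
  have e5 : a x 1 * b ξ 1 = (b x 2 - l) * (a x 1 * a ξ 1 - a x 0 * a ξ 0) - c x 0 * a ξ 0 := by
    linear_combination -r02 + (b x 2 - l) * hS
  have e6 : b ξ 1 = (b x 2 - l) * a ξ 1 := by
    refine mul_left_cancel₀ (hx.c_ne 1) ?_
    linear_combination -r12 + a x 2 * e1 + a x 2 * hS + a x 2 * hT
  have e7 : c x 0 * b ξ 2 =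
      (b x 1 - l) * (a x 0 * b ξ 1 + c x 0 * a ξ 1) + a x 0 * (a x 1 * a ξ 1 - a x 0 * a ξ 0) := by
    linear_combination r10 + a x 0 * hS + a x 0 * hT
  -- These two equations would annihilate the second column of `𝒢(l)`, contrary to `Det 𝒢(l) ≠ 0`.
  have hdeg : a x 0 * (b x 2 - l) = -c x 0 → (b x 1 - l) * (b x 2 - l) = -a x 1 → False := by
    intro h2 h3
    refine hD ?_
    have h12 : g12 x l = 0 := by simp only [g12]; linear_combination h3
    have h22 : g22 x l = 0 := by
      simp only [g22, lead]
      linear_combination c x 1 * h2 - a x 0 * a x 2 * h3 + a x 2 * (b x 1 - l) * h2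
    rw [detFun, h12, h22]
    ring
  have hz1 : a ξ 1 = 0 := by
    by_contra hne
    refine hdeg (mul_right_cancel₀ hne ?_) (mul_right_cancel₀ hne ?_)
    · linear_combination e3 - a x 0 * e6
    · linear_combination e2 - (b x 1 - l) * e6
  have hy1 : b ξ 1 = 0 := by rw [e6, hz1, mul_zero]
  rw [hz1] at e1 e4 e5 e7
  rw [hy1] at e5 e7
  have hz0 : a ξ 0 = 0 := by
    by_contra hne
    have h2 : a x 0 * (b x 2 - l) = -c x 0 := by
      refine mul_right_cancel₀ hne ?_
      linear_combination e5
    have ha0 : a x 0 ≠ 0 := by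
      rintro ha0
      rw [ha0, zero_mul] at h2
      exact hc0 (neg_eq_zero.1 h2.symm)
    have hy2 : b ξ 2 ≠ 0 := by
      intro hy2
      rw [hy2] at e1
      exact mul_ne_zero ha0 hne (by linear_combination -e1)
    refine hdeg h2 (mul_right_cancel₀ hy2 ?_)
    linear_combination e4 + (b x 1 - l) * e1
  rw [hz0] at e7 hS
  have hy2 : b ξ 2 = 0 := by
    refine mul_left_cancel₀ hc0 ?_
    linear_combination e7
  -- Only `c` components are left, and they satisfy the relations characterizing combinations of
  -- `dJ₁` and `dJ₂`, which lie in the kernel of `P`.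
  obtain ⟨s, r, rfl⟩ := exists_eq_gradJ hx (η := ξ) (forall_fin_four.2 ⟨p22, hy1, hy2, h0⟩)
    (forall_fin_four.2 ⟨hz0, hz1, p11, h1⟩) (by linear_combination hS) hT
  simp [mulVec_add, mulVec_smul, tensorP_gradJ1, tensorP_gradJ2]

theorem hasEigenvalue_iff {x : M} {l : ℂ} (hx : IsGenericPoint x) (h : lead x ≠ 0) :
    Module.End.HasEigenvalue (nijenhuis x) l ↔ detFun x l = 0 :=
  ⟨isRoot_of_hasEigenvalue hx h, hasEigenvalue_of_isRoot hx h⟩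


/-! ### Kernels of antisymmetric maps are even-dimensional -/

theorem det_eq_zero_of_transpose_eq_neg {n : Type*} [Fintype n] [DecidableEq n]
    (hn : Odd (Fintype.card n)) {A : Matrix n n ℂ} (hA : Aᵀ = -A) : A.det = 0 := by
  have h := det_transpose A
  rw [hA, det_neg, hn.neg_one_pow, neg_one_mul] at h
  exact self_eq_neg.1 h.symm

/-- Deleting row and column `i` leaves an antisymmetric matrix of odd size, which is singular;
extend a null vector of it by 0 at `i`. The missing equation in row `i` comes from `v ⬝ Au = -(Av) ⬝
u = 0`, where only the `i`-th term survives and `v i ≠ 0`. -/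
theorem exists_mulVec_eq_zero_of_transpose_eq_neg {n : ℕ} (hn : Odd n)
    {A : Matrix (Fin (n + 1)) (Fin (n + 1)) ℂ} (hA : Aᵀ = -A) {v : Fin (n + 1) → ℂ}
    (hv : A *ᵥ v = 0) {i : Fin (n + 1)} (hi : v i ≠ 0) : ∃ u ≠ 0, u i = 0 ∧ A *ᵥ u = 0 := by
  have hA' : (A.submatrix i.succAbove i.succAbove)ᵀ = -A.submatrix i.succAbove i.succAbove := by
    rw [transpose_submatrix, hA]; rfl
  obtain ⟨u, hu0, hu⟩ := exists_mulVec_eq_zero_iff.2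
    (det_eq_zero_of_transpose_eq_neg (by simpa using hn) hA')
  have h1 : ∀ j, (A *ᵥ i.insertNth 0 u) (i.succAbove j) = 0 := fun j => by
    have := congrFun hu j
    simpa [mulVec, dotProduct, Fin.sum_univ_succAbove _ i] using this
  refine ⟨i.insertNth 0 u, fun h => hu0 (funext fun j => ?_), by simp, funext fun k => ?_⟩
  · simpa using congrFun h (i.succAbove j)
  · rcases eq_or_ne k i with rfl | hk
    · have h2 : v ⬝ᵥ (A *ᵥ k.insertNth 0 u) = 0 := by
        rw [dotProduct_mulVec, ← mulVec_transpose, hA, neg_mulVec, hv, neg_zero, zero_dotProduct]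
      rw [dotProduct, Fin.sum_univ_succAbove _ k] at h2
      simpa [h1, hi] using h2
    · obtain ⟨j, rfl⟩ := Fin.exists_succAbove_eq hk
      exact h1 j

/-- In even dimension `n + 1`, the kernel of an antisymmetric map cannot be a line: the second null
vector vanishes at a coordinate where the first does not. -/
theorem two_le_finrank_ker {V : Type*} [AddCommGroup V] [Module ℂ V] {n : ℕ}
    (hn : Odd n) (e : Module.Basis (Fin (n + 1)) ℂ V) {A : Module.Dual ℂ V →ₗ[ℂ] V}
    (hA : ∀ ξ η : Module.Dual ℂ V, ξ (A η) = -η (A ξ)) (hker : LinearMap.ker A ≠ ⊥) :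
    2 ≤ Module.finrank ℂ (LinearMap.ker A) := by
  have : FiniteDimensional ℂ V := e.finiteDimensional_of_finite
  obtain ⟨v, hv, hv0⟩ := Submodule.exists_mem_ne_zero_of_ne_bot hker
  let B : Matrix (Fin (n + 1)) (Fin (n + 1)) ℂ := Matrix.of fun i j => e.coord i (A (e.coord j))
  have hB : Bᵀ = -B := by
    ext i j
    exact hA (e.coord j) (e.coord i)
  have hsum : ∀ w : Fin (n + 1) → ℂ, ∀ i, (B *ᵥ w) i = e.coord i (A (∑ j, w j • e.coord j)) := by
    intro w i
    simp [mulVec, dotProduct, B, map_sum, mul_comm]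
  have hv1 : v = ∑ j, v (e j) • e.coord j := (e.sum_dual_apply_smul_coord v).symm
  have hv2 : B *ᵥ (fun j => v (e j)) = 0 := by
    ext i
    rw [hsum, ← hv1, LinearMap.mem_ker.1 hv]
    simp
  obtain ⟨i, hi⟩ : ∃ i, v (e i) ≠ 0 := by
    by_contra! h
    exact hv0 (e.ext fun i => by simpa using h i)
  obtain ⟨u, hu0, hui, hu⟩ := exists_mulVec_eq_zero_of_transpose_eq_neg hn hB hv2 hi
  have hcoord : ∀ k, (∑ j, u j • e.coord j) (e k) = u k := fun k => by
    simp [LinearMap.sum_apply, Finsupp.single_apply]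
  have hw : ∑ j, u j • e.coord j ∈ LinearMap.ker A := by
    rw [LinearMap.mem_ker]
    refine e.ext_elem fun k => ?_
    have := congrFun hu k
    rw [hsum] at this
    simpa using this
  have hli : LinearIndependent ℂ ![(⟨v, hv⟩ : LinearMap.ker A), ⟨_, hw⟩] := by
    rw [LinearIndependent.pair_iff]
    intro s t hst
    have h1 : s • v + t • ∑ j, u j • e.coord j = 0 := congrArg Subtype.val hst
    have h2 : ∀ k, s * v (e k) + t * u k = 0 := fun k => by
      have := LinearMap.congr_fun h1 (e k)
      simpa only [LinearMap.add_apply, LinearMap.smul_apply, hcoord, smul_eq_mul,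
        LinearMap.zero_apply] using this
    have hs : s = 0 := by simpa [hui, hi] using h2 i
    refine ⟨hs, ?_⟩
    by_contra ht
    exact hu0 (funext fun k => by simpa [hs, ht] using h2 k)
  simpa using hli.fintype_card_le_finrank

/-! ### The minimal polynomial of the Nijenhuis tensor -/

theorem restrict_swap {x : M} {B : Matrix Idx Idx ℂ} (hB : Bᵀ = -B)
    (hC : ∀ i, B *ᵥ gradCasimir x i = 0) (ξ η : Module.Dual ℂ (tangent x)) :
    ξ (restrict x B η) = -η (restrict x B ξ) := by
  obtain ⟨ξ, rfl⟩ := exists_covec_tangent ξ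
  obtain ⟨η, rfl⟩ := exists_covec_tangent η
  simp only [LinearMap.comp_apply, Submodule.subtype_apply, restrict_leafDiff hB hC]
  exact covec_mulVec_swap hB ξ η

theorem nijenhuis_restrict {x : M} (hx : IsGenericPoint x) (h : lead x ≠ 0)
    (ξ : Module.Dual ℂ (tangent x)) :
    nijenhuis x (restrict x (tensorP x) ξ) = restrict x (tensorQ x) ξ := by
  obtain ⟨ξ, rfl⟩ := exists_covec_tangent ξ
  refine Subtype.ext ?_
  rw [restrict_leafDiff (tensorQ_transpose x) (tensorQ_gradCasimir h),
    ← nijenhuis_tensorP hx h ξ (mulVec_mem_tangent (tensorP_transpose x) (tensorP_gradCasimir x) ξ)]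
  congr 2
  exact Subtype.ext (restrict_tensorP_covec x ξ)

/-- `P` maps the kernel of `Q - lP` isomorphically onto the eigenspace, and `Q - lP` is
antisymmetric on a space of dimension 8. -/
theorem two_le_finrank_eigenspace {x : M} (hx : IsGenericPoint x) (h : lead x ≠ 0) {l : ℂ}
    (hl : Module.End.HasEigenvalue (nijenhuis x) l) :
    2 ≤ Module.finrank ℂ (Module.End.eigenspace (nijenhuis x) l) := by
  let A := restrict x (tensorQ x) - l • restrict x (tensorP x)
  let E := LinearEquiv.ofBijective _ (bijective_restrict_tensorP hx)
  have hmap : (LinearMap.ker A).map E.toLinearMap = Module.End.eigenspace (nijenhuis x) l := by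
    ext v
    obtain ⟨ξ, rfl⟩ := E.surjective v
    rw [Module.End.mem_eigenspace_iff]
    have h1 : E.toLinearMap ξ = restrict x (tensorP x) ξ := rfl
    have h2 : E ξ = restrict x (tensorP x) ξ := rfl
    rw [h2, nijenhuis_restrict hx h, Submodule.mem_map]
    constructor
    · rintro ⟨η, hη, hηξ⟩
      obtain rfl := E.injective hηξ
      exact sub_eq_zero.1 hη
    · exact fun hξ => ⟨ξ, sub_eq_zero.2 hξ, rfl⟩
  rw [← hmap, LinearEquiv.finrank_map_eq]
  have := finrank_tangent hx
  have : FiniteDimensional ℂ (tangent x) := inferInstance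
  refine two_le_finrank_ker (n := 7) (by decide)
    (Module.finBasisOfFinrankEq ℂ _ (finrank_tangent hx)) (fun ξ η => ?_) fun h0 => ?_
  · have h1 := restrict_swap (tensorQ_transpose x) (tensorQ_gradCasimir h) ξ η
    have h2 := restrict_swap (tensorP_transpose x) (tensorP_gradCasimir x) ξ η
    simp only [A, LinearMap.sub_apply, LinearMap.smul_apply, map_sub, map_smul, h1, h2]
    rw [smul_neg]
    abel
  · rw [h0, Submodule.map_bot] at hmap
    exact hl hmap.symm

theorem iSup_eigenspace_eq_top {V : Type*} [AddCommGroup V] [Module ℂ V] [FiniteDimensional ℂ V]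
    {f : Module.End ℂ V} {n d : ℕ} {r : Fin n → ℂ} (hr : Function.Injective r)
    (h : ∀ i, d ≤ Module.finrank ℂ (f.eigenspace (r i))) (hd : Module.finrank ℂ V ≤ n * d) :
    ⨆ i, f.eigenspace (r i) = ⊤ := by
  have hind : iSupIndep fun i => f.eigenspace (r i) := f.eigenspaces_iSupIndep.comp hr
  rw [Submodule.iSup_eq_range_dfinsupp_lsum]
  refine Submodule.eq_top_of_finrank_eq (le_antisymm (Submodule.finrank_le _) (hd.trans ?_))
  rw [LinearMap.finrank_range_of_inj hind.dfinsupp_lsum_injective]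
  have h2 : Module.finrank ℂ (Π₀ i, f.eigenspace (r i)) =
      ∑ i, Module.finrank ℂ (f.eigenspace (r i)) :=
    Module.finrank_directSum ℂ fun i => f.eigenspace (r i)
  rw [h2]
  simpa using Finset.sum_le_sum fun i (_ : i ∈ Finset.univ) => h i

theorem minpoly_eq_prod {V : Type*} [AddCommGroup V] [Module ℂ V] [FiniteDimensional ℂ V]
    {f : Module.End ℂ V} {n : ℕ} {r : Fin n → ℂ} (hr : Function.Injective r)
    (h : ∀ i, f.HasEigenvalue (r i)) (htop : ⨆ i, f.eigenspace (r i) = ⊤) :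
    minpoly ℂ f = ∏ i, (X - C (r i)) := by
  refine eq_of_monic_of_associated (minpoly.monic (Algebra.IsIntegral.isIntegral f))
    (monic_prod_of_monic _ _ fun i _ => monic_X_sub_C _)
    (associated_of_dvd_dvd (minpoly.dvd _ _ ?_) ?_)
  · rw [← LinearMap.ker_eq_top, eq_top_iff, ← htop, iSup_le_iff]
    intro i v hv
    rw [LinearMap.mem_ker]
    rcases eq_or_ne v 0 with rfl | hv0
    · simp
    · rw [Module.End.aeval_apply_of_hasEigenvector ⟨hv, hv0⟩, eval_prod,
        Finset.prod_eq_zero (Finset.mem_univ i) (by simp), zero_smul]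
  · exact Finset.prod_dvd_of_coprime
      (fun i _ j _ hij => isCoprime_X_sub_C_of_isUnit_sub
        (sub_ne_zero.2 (hr.ne hij)).isUnit)
      fun i _ => dvd_iff_isRoot.2 (Module.End.hasEigenvalue_iff_isRoot.1 (h i))

theorem exists_roots_det_calG {x : M} (h : lead x ≠ 0) (hs : (calG x).det.Separable) :
    ∃ r : Fin 4 → ℂ, Function.Injective r ∧
      (calG x).det.roots = Finset.univ.val.map r := by
  have hcard : Multiset.card (calG x).det.roots = 4 := by
    rw [← natDegree_det_calG h]
    exact (splits_iff_card_roots.1 (IsAlgClosed.splits _))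
  have hl : (calG x).det.roots.toList.length = 4 := by simpa using hcard
  refine ⟨fun i => (calG x).det.roots.toList.get (i.cast hl.symm), ?_, ?_⟩
  · have hnd : (calG x).det.roots.toList.Nodup := by
      rw [← Multiset.coe_nodup, Multiset.coe_toList]
      exact nodup_roots hs
    exact (List.nodup_iff_injective_get.1 hnd).comp (Fin.cast_injective _)
  · conv_lhs => rw [← Multiset.coe_toList (calG x).det.roots]
    generalize (calG x).det.roots.toList = L at hl
    match L, hl with
    | [p, q, r, s], _ => rfl

theorem det_calG_eq_prod {x : M} (h : lead x ≠ 0) {r : Fin 4 → ℂ}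
    (hr : (calG x).det.roots = Finset.univ.val.map r) :
    (calG x).det = C (lead x) * ∏ i, (X - C (r i)) := by
  have := C_leadingCoeff_mul_prod_multiset_X_sub_C (p := (calG x).det)
    (splits_iff_card_roots.1 (IsAlgClosed.splits _))
  rw [leadingCoeff_det_calG h, hr, Multiset.map_map] at this
  exact this.symm

theorem detFun_eq_prod {x : M} (h : lead x ≠ 0) {r : Fin 4 → ℂ}
    (hr : (calG x).det.roots = Finset.univ.val.map r) (l : ℂ) :
    detFun x l = lead x * ∏ i, (l - r i) := by
  rw [← eval_det_calG, det_calG_eq_prod h hr, eval_mul, eval_C, eval_prod]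
  simp

theorem detFun_root {x : M} (h : lead x ≠ 0) {r : Fin 4 → ℂ}
    (hr : (calG x).det.roots = Finset.univ.val.map r) (i : Fin 4) : detFun x (r i) = 0 := by
  rw [detFun_eq_prod h hr, Finset.prod_eq_zero (Finset.mem_univ i) (sub_self _), mul_zero]

/-- Four distinct eigenvalues with eigenspaces of dimension at least 2 fill the 8-dimensional
tangent space. Hence `N` is diagonalizable, and each root occurs once in its minimal polynomial. -/
theorem minpoly_nijenhuis {x : M} (hx : x ∈ regLocus) :
    minpoly ℂ (nijenhuis x) = C (lead x)⁻¹ * (calG x).det := by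
  obtain ⟨hg, hdet, hs⟩ := hx
  have h : lead x ≠ 0 := det_matG_ne.1 hdet
  obtain ⟨r, hr, hroots⟩ := exists_roots_det_calG h hs
  have hev : ∀ i, Module.End.HasEigenvalue (nijenhuis x) (r i) := fun i =>
    (hasEigenvalue_iff hg h).2 (detFun_root h hroots i)
  have hfin := finrank_tangent hg
  rw [minpoly_eq_prod hr hev (iSup_eigenspace_eq_top (d := 2) hr
      (fun i => two_le_finrank_eigenspace hg h (hev i)) hfin.le),
    det_calG_eq_prod h hroots, ← mul_assoc, ← C_mul, inv_mul_cancel₀ h, C_1, one_mul]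


/-! ### Resultants of analytic families of polynomials -/

section Families

variable {E : Type*} [NormedAddCommGroup E] [NormedSpace ℂ E]

/-- The coefficients of a family of polynomials are analytic functions of the parameter. -/
def AnalyticFamily (p : E → ℂ[X]) : Prop := ∀ k, ContDiff ℂ ⊤ fun x => (p x).coeff k

theorem AnalyticFamily.add {p q : E → ℂ[X]} (hp : AnalyticFamily p) (hq : AnalyticFamily q) :
    AnalyticFamily fun x => p x + q x := fun k => by
  simpa only [coeff_add] using (hp k).add (hq k)

theorem AnalyticFamily.mul {p q : E → ℂ[X]} (hp : AnalyticFamily p) (hq : AnalyticFamily q) :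
    AnalyticFamily fun x => p x * q x := fun k => by
  simpa only [coeff_mul] using ContDiff.sum fun i _ => (hp _).mul (hq _)

theorem AnalyticFamily.derivative {p : E → ℂ[X]} (hp : AnalyticFamily p) :
    AnalyticFamily fun x => derivative (p x) := fun k => by
  simpa only [coeff_derivative] using (hp _).mul contDiff_const

theorem AnalyticFamily.monomial {F : E → ℂ} (hF : ContDiff ℂ ⊤ F) (n : ℕ) :
    AnalyticFamily fun x => C (F x) * X ^ n := fun k => by
  by_cases h : k = n
  · simpa [h] using hF
  · simpa [coeff_C_mul, coeff_X_pow, h] using contDiff_const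

/-- With fixed formal degrees the Sylvester determinant is a polynomial in the coefficients, even
where the actual degrees drop. -/
theorem AnalyticFamily.resultant {p q : E → ℂ[X]} (hp : AnalyticFamily p) (hq : AnalyticFamily q)
    (m n : ℕ) : ContDiff ℂ ⊤ fun x => (p x).resultant (q x) m n := by
  simp only [Polynomial.resultant, det_apply']
  refine ContDiff.sum fun σ _ => contDiff_const.mul (contDiff_prod fun i _ => ?_)
  simp only [sylvester, of_apply]
  refine Fin.addCases (fun j => ?_) (fun j => ?_) i
  · simp only [Fin.addCases_left]
    split_ifs
    exacts [hq _, contDiff_const]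
  · simp only [Fin.addCases_right]
    split_ifs
    exacts [hp _, contDiff_const]

end Families

/-- Overestimating the degree of `q` only multiplies the resultant by a power of the leading
coefficient of `p`; for `p` itself the degree must be exact. -/
theorem resultant_ne_zero_iff {p q : ℂ[X]} {m n : ℕ} (hm : p.natDegree = m) (hp : p ≠ 0)
    (hq : q.natDegree ≤ n) : p.resultant q m n ≠ 0 ↔ IsCoprime p q := by
  obtain ⟨k, rfl⟩ := Nat.exists_eq_add_of_le hq
  subst hm
  rw [resultant_add_right_deg _ _ _ _ _ le_rfl, mul_ne_zero_iff]
  have : p.resultant q ≠ 0 ↔ IsCoprime p q := by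
    rw [Ne, resultant_eq_zero_iff]
    tauto
  rw [this]
  exact and_iff_right (pow_ne_zero _ (leadingCoeff_ne_zero.2 hp))

/-! ### Openness of the generic loci -/

theorem contDiff_coord (p : Idx) : ContDiff ℂ ⊤ fun x : M => x p := contDiff_apply ℂ ℂ p

theorem contDiff_lead : ContDiff ℂ ⊤ lead := by
  have := contDiff_coord
  unfold lead
  fun_prop

theorem contDiff_detCoeff (k : Fin 4) : ContDiff ℂ ⊤ fun x => detCoeff x k := by
  have := contDiff_coord
  have := contDiff_lead
  fin_cases k <;> simp [detCoeff] <;> fun_prop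

theorem contDiff_casimir (i : Fin 4) : ContDiff ℂ ⊤ (casimir i) := by
  have := contDiff_coord
  fin_cases i
  · change ContDiff ℂ ⊤ H0
    unfold H0
    fun_prop
  · change ContDiff ℂ ⊤ K0
    unfold K0
    fun_prop
  · change ContDiff ℂ ⊤ J1
    unfold J1
    fun_prop
  · change ContDiff ℂ ⊤ J2
    unfold J2
    fun_prop

theorem analyticFamily_det_calG : AnalyticFamily fun x => (calG x).det := fun k => by
  by_cases h : k < 4
  · have hk : (fun x => (calG x).det.coeff k) = fun x => detCoeff x ⟨k, h⟩ :=
      funext fun x => coeff_det_calG x ⟨k, h⟩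
    rw [hk]
    exact contDiff_detCoeff _
  · rcases eq_or_ne k 4 with rfl | h4
    · simpa only [coeff_four_det_calG] using contDiff_lead
    · have hk : (fun x => (calG x).det.coeff k) = fun _ => 0 := funext fun x =>
        coeff_eq_zero_of_natDegree_lt ((natDegree_det_calG_le x).trans_lt (by omega))
      rw [hk]
      exact contDiff_const

/-- The resultant that detects the multiple roots of `Det 𝒢(λ)`. -/
def sepRes (x : M) : ℂ := (calG x).det.resultant (derivative (calG x).det) 4 3

/-- The resultant that detects the multiple roots of `Det 𝒢(λ)` and its common roots with `𝒢₁₂`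
and `𝒢₂₂`. -/
def dnRes (x : M) : ℂ :=
  (calG x).det.resultant (derivative (calG x).det * (calG x 0 1 * calG x 1 1)) 4 6

theorem contDiff_sepRes : ContDiff ℂ ⊤ sepRes :=
  analyticFamily_det_calG.resultant analyticFamily_det_calG.derivative 4 3

theorem analyticFamily_calG_zero_one : AnalyticFamily fun x => calG x 0 1 := by
  have h := contDiff_coord
  have h1 : AnalyticFamily fun x : M => C 1 * X ^ 2 + (C (-(b x 1 + b x 2)) * X ^ 1 +
    C (b x 1 * b x 2 + a x 1) * X ^ 0) := by
    refine (AnalyticFamily.monomial ?_ 2).add ((AnalyticFamily.monomial ?_ 1).add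
      (AnalyticFamily.monomial ?_ 0)) <;> fun_prop
  convert h1 using 2 with x
  rw [calG_zero_one]
  simp
  ring

theorem analyticFamily_calG_one_one : AnalyticFamily fun x => calG x 1 1 := by
  have h := contDiff_coord
  have h1 : AnalyticFamily fun x : M => C (lead x) * X ^ 1 +
      C (b x 1 * a x 2 * c x 0 + b x 2 * a x 0 * c x 1 - a x 0 * a x 1 * a x 2
        + c x 0 * c x 1) * X ^ 0 := by
    refine (AnalyticFamily.monomial contDiff_lead 1).add (AnalyticFamily.monomial ?_ 0)
    fun_prop
  convert h1 using 2 with x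
  rw [calG_one_one]
  simp

theorem contDiff_dnRes : ContDiff ℂ ⊤ dnRes :=
  analyticFamily_det_calG.resultant (analyticFamily_det_calG.derivative.mul
    (analyticFamily_calG_zero_one.mul analyticFamily_calG_one_one)) 4 6

theorem natDegree_derivative_det_calG_le (x : M) : (derivative (calG x).det).natDegree ≤ 3 :=
  (natDegree_derivative_le _).trans (Nat.sub_le_sub_right (natDegree_det_calG_le x) 1)

theorem det_calG_ne_zero {x : M} (h : lead x ≠ 0) : (calG x).det ≠ 0 := fun h0 => by
  have := natDegree_det_calG h
  rw [h0] at this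
  simp at this

theorem mem_regLocus {x : M} :
    x ∈ regLocus ↔ IsGenericPoint x ∧ lead x ≠ 0 ∧ sepRes x ≠ 0 := by
  rw [regLocus, Set.mem_ofPred_eq, det_matG_ne]
  refine and_congr_right fun _ => and_congr_right fun h => ?_
  exact (resultant_ne_zero_iff (natDegree_det_calG h) (det_calG_ne_zero h)
    (natDegree_derivative_det_calG_le x)).symm

theorem isCoprime_iff_forall_isRoot {p q : ℂ[X]} :
    IsCoprime p q ↔ ∀ l, p.IsRoot l → q.eval l ≠ 0 := by
  rw [isCoprime_iff_aeval_ne_zero_of_isAlgClosed ℂ ℂ]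
  refine forall_congr' fun l => ?_
  simp only [coe_aeval_eq_eval, IsRoot.def]
  tauto

theorem mem_dnLocus {x : M} :
    x ∈ dnLocus ↔ IsGenericPoint x ∧ lead x ≠ 0 ∧ dnRes x ≠ 0 := by
  rw [dnLocus, Set.mem_ofPred_eq, regLocus, Set.mem_ofPred_eq, det_matG_ne, and_assoc, and_assoc]
  refine and_congr_right fun _ => and_congr_right fun h => ?_
  rw [dnRes, resultant_ne_zero_iff (natDegree_det_calG h) (det_calG_ne_zero h),
    IsCoprime.mul_right_iff, Polynomial.Separable]
  · refine and_congr_right fun _ => ?_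
    simp only [isCoprime_iff_forall_isRoot, eval_mul, mul_ne_zero_iff]
  -- The formal degree 6 is the sum of the bounds 3 for `Det 𝒢'`, 2 for `𝒢₁₂` and 1 for `𝒢₂₂`.
  · refine natDegree_mul_le.trans (add_le_add (natDegree_derivative_det_calG_le x)
      (natDegree_mul_le.trans (add_le_add (b := 2) (d := 1) ?_ ?_)))
    · rw [calG_zero_one]
      compute_degree
    · rw [calG_one_one]
      compute_degree

theorem isOpen_isGenericPoint : IsOpen {x | IsGenericPoint x} := by
  have h : ∀ i, Continuous (casimir i) := fun i => (contDiff_casimir i).continuous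
  refine IsOpen.inter ?_ ?_
  · exact isOpen_ne_fun (h 3) continuous_const
  · exact isOpen_ne_fun ((h 2).pow 2) (continuous_const.mul (h 3))

theorem isOpen_regLocus : IsOpen regLocus := by
  have h : regLocus = {x | IsGenericPoint x} ∩ ({x | lead x ≠ 0} ∩ {x | sepRes x ≠ 0}) := by
    ext x
    exact mem_regLocus
  rw [h]
  exact isOpen_isGenericPoint.inter ((isOpen_ne_fun contDiff_lead.continuous continuous_const).inter
    (isOpen_ne_fun contDiff_sepRes.continuous continuous_const))

theorem isOpen_dnLocus : IsOpen dnLocus := by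
  have h : dnLocus = {x | IsGenericPoint x} ∩ ({x | lead x ≠ 0} ∩ {x | dnRes x ≠ 0}) := by
    ext x
    exact mem_dnLocus
  rw [h]
  exact isOpen_isGenericPoint.inter ((isOpen_ne_fun contDiff_lead.continuous continuous_const).inter
    (isOpen_ne_fun contDiff_dnRes.continuous continuous_const))

/-! ### The coefficients of the minimal polynomial -/

theorem coeffP_eq {x : M} (hx : x ∈ regLocus) (i : Fin 4) :
    coeffP i x = -detCoeff x (Fin.rev i) / lead x := by
  have : (3 - (i : ℕ)) = (Fin.rev i : Fin 4) := by
    rw [Fin.val_rev]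
    omega
  rw [coeffP, minpoly_nijenhuis hx, coeff_C_mul, this, coeff_det_calG]
  field_simp

theorem coeffP_eventuallyEq {x : M} (hx : x ∈ regLocus) (i : Fin 4) :
    coeffP i =ᶠ[nhds x] fun y => -detCoeff y (Fin.rev i) / lead y :=
  Filter.eventuallyEq_of_mem (isOpen_regLocus.mem_nhds hx) fun _ hy => coeffP_eq hy i

theorem analyticAt_coeffP {x : M} (hx : x ∈ regLocus) (i : Fin 4) :
    AnalyticAt ℂ (coeffP i) x :=
  ((contDiff_detCoeff _).contDiffAt.analyticAt.neg.div contDiff_lead.contDiffAt.analyticAt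
    (mem_regLocus.1 hx).2.1).congr (coeffP_eventuallyEq hx i).symm


/-! ### Density of the generic locus -/

/-- The point of a leaf with Casimirs `κ`, with `c₁c₃ = r` and `c₂c₄ = s` and with given values of
the remaining coordinates. -/
def leafPoint (κ : Fin 4 → ℂ) (r s b₂ b₃ : ℂ) (v : Fin 4 → ℂ) (c₁ c₂ : ℂ) : M :=
  let t := (κ 1 + (c₁ * v 3 * v 2 + c₂ * v 0 * v 3 + r / c₁ * v 1 * v 0 + s / c₂ * v 2 * v 1)
    - r * κ 0) / (s - r)
  blocks ![t - b₃, b₂, b₃, κ 0 - t - b₂] v ![c₁, c₂, r / c₁, s / c₂]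

/-- For `c₁c₃ = r` and `c₂c₄ = s`, the equations for `H₀` and `K₀` are linear in `b₁ + b₃` and `b₂ +
b₄`, with determinant `±(s - r)`. The number `t` in `leafPoint` is the resulting value of `b₁ + b₃`.
-/
theorem leafPoint_mem {κ : Fin 4 → ℂ} {r s : ℂ} (h2 : r + s = κ 2) (h3 : r * s = κ 3) (hrs : r ≠ s)
    (b₂ b₃ : ℂ) (v : Fin 4 → ℂ) {c₁ c₂ : ℂ} (hc₁ : c₁ ≠ 0) (hc₂ : c₂ ≠ 0) :
    leafPoint κ r s b₂ b₃ v c₁ c₂ ∈ leaf κ := by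
  have hsr : s - r ≠ 0 := sub_ne_zero.2 hrs.symm
  refine forall_fin_four.2 ⟨?_, ?_, ?_, ?_⟩
  · change H0 _ = _
    simp [H0, leafPoint]
    ring
  · change K0 _ = _
    simp [K0, leafPoint]
    field_simp
    ring
  · change J1 _ = _
    simp [J1, leafPoint]
    field_simp
    exact h2
  · change J2 _ = _
    simp [J2, leafPoint]
    field_simp
    exact h3

theorem eq_leafPoint {κ : Fin 4 → ℂ} (hκ : IsGenericValue κ) {x : M} (hx : x ∈ leaf κ) :
    x = leafPoint κ (c x 0 * c x 2) (c x 1 * c x 3) (b x 1) (b x 2) (fun i => a x i)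
      (c x 0) (c x 1) := by
  have hg := isGenericPoint_of_leaf hκ hx
  have hc := hg.c_ne
  have h0 : H0 x = κ 0 := hx 0
  have h1 : K0 x = κ 1 := hx 1
  have hsr := hg.sub_ne
  have e2 : c x 0 * c x 2 / c x 0 = c x 2 := mul_div_cancel_left₀ _ (hc 0)
  have e3 : c x 1 * c x 3 / c x 1 = c x 3 := mul_div_cancel_left₀ _ (hc 1)
  have ht : (κ 1 + (c x 0 * a x 3 * a x 2 + c x 1 * a x 0 * a x 3 + c x 2 * a x 1 * a x 0
      + c x 3 * a x 2 * a x 1) - c x 0 * c x 2 * κ 0) / (c x 1 * c x 3 - c x 0 * c x 2)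
      = b x 0 + b x 2 := by
    rw [div_eq_iff (by intro h; apply hsr; linear_combination -h), ← h0, ← h1]
    simp only [H0, K0]
    ring
  rw [leafPoint, e2, e3, ht]
  refine ext_blocks (forall_fin_four.2 ⟨?_, ?_, ?_, ?_⟩) (fun i => ?_)
    (forall_fin_four.2 ⟨?_, ?_, ?_, ?_⟩) <;> simp [← h0, H0]
  ring

/-- The last `a` is chosen to make `b₁ = 0`. Then `𝒢₁₂ = λ²`, `𝒢₂₂ = r(λ - 1)` and `Det 𝒢 = r(λ⁴ - λ
+ 1)`, a polynomial with simple roots that vanishes at neither 0 nor 1. -/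
theorem leafPoint_mem_dnLocus {κ : Fin 4 → ℂ} (hκ : IsGenericValue κ) {r s : ℂ} (h2 : r + s = κ 2)
    (h3 : r * s = κ 3) (hrs : r ≠ s) :
    leafPoint κ r s 0 0 ![0, 0, -r, κ 1 / r - κ 0] 1 (-r) ∈ dnLocus := by
  have hr : r ≠ 0 := by
    rintro rfl
    exact hκ.1 (by rw [← h3, zero_mul])
  set x := leafPoint κ r s 0 0 ![0, 0, -r, κ 1 / r - κ 0] 1 (-r) with hxdef
  have hx : x ∈ leaf κ := leafPoint_mem h2 h3 hrs _ _ _ one_ne_zero (neg_ne_zero.2 hr)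
  have hb0 : b x 0 = 0 := by
    simp [hxdef, leafPoint]
    left
    field_simp
    ring
  have hb1 : b x 1 = 0 := rfl
  have hb2 : b x 2 = 0 := rfl
  have ha0 : a x 0 = 0 := rfl
  have ha1 : a x 1 = 0 := rfl
  have ha2 : a x 2 = -r := rfl
  have hc0 : c x 0 = 1 := rfl
  have hc1 : c x 1 = -r := rfl
  have hc2 : c x 2 = r := div_one r
  have hlead : lead x = r := by simp only [lead, ha0, ha2, hc0, hc1]; ring
  have hpoly : (calG x).det = C r * X ^ 4 - C r * X + C r := by
    rw [det_calG, hlead]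
    simp [detCoeff, hb0, hb1, hb2, ha0, ha1, ha2, hc0, hc1, hc2, hlead]
    ring
  have hroot : ∀ l, (calG x).det.IsRoot l → l ^ 4 - l + 1 = 0 := by
    intro l hl
    rw [hpoly] at hl
    simp at hl
    refine mul_left_cancel₀ hr ?_
    linear_combination hl
  refine ⟨⟨isGenericPoint_of_leaf hκ hx, det_matG_ne.2 (hlead ▸ hr), ?_⟩, fun l hl => ?_⟩
  · refine isCoprime_iff_forall_isRoot.2 fun l hl h => ?_
    have h1 := hroot l hl
    rw [hpoly] at h
    simp at h
    have h4 : 4 * l ^ 3 - 1 = 0 := by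
      refine mul_left_cancel₀ hr ?_
      linear_combination h
    -- Euclidean step: `l(4l³ - 1) - 4(l⁴ - l + 1) = 3l - 4`.
    have h5 : l = 4 / 3 := by linear_combination (1 / 3) * (l * h4 - 4 * h1)
    rw [h5] at h4
    norm_num at h4
  · have h1 := hroot l hl
    rw [eval_calG_zero_one, eval_calG_one_one]
    simp only [g12, g22, hlead, hb1, hb2, ha0, ha1, ha2, hc0, hc1]
    constructor
    · intro h
      have : l = 0 := by simpa using h
      simp [this] at h1
    · intro h
      have : l = 1 := by
        refine mul_left_cancel₀ hr ?_
        linear_combination h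
      simp [this] at h1

theorem exists_add_mul {κ : Fin 4 → ℂ} (hκ : IsGenericValue κ) :
    ∃ r s, r + s = κ 2 ∧ r * s = κ 3 ∧ r ≠ s := by
  obtain ⟨d, hd⟩ := IsAlgClosed.exists_pow_nat_eq (κ 2 ^ 2 - 4 * κ 3) (n := 2) (by norm_num)
  refine ⟨(κ 2 + d) / 2, (κ 2 - d) / 2, by ring, ?_, fun h => hκ.2 ?_⟩
  · linear_combination (-1 / 4) * hd
  · have : d = 0 := by linear_combination h
    rw [this] at hd
    linear_combination -hd

theorem leaf_nonempty {κ : Fin 4 → ℂ} (hκ : IsGenericValue κ) : (leaf κ).Nonempty := by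
  obtain ⟨r, s, h2, h3, hrs⟩ := exists_add_mul hκ
  exact ⟨_, leafPoint_mem h2 h3 hrs 0 0 0 one_ne_zero one_ne_zero⟩

/-- The free parameters of `leafPoint` move along a complex line while `r` and `s` stay fixed. Only
the finitely many `z` with `c₁ = 0` or `c₂ = 0` are removed, and the complement of a finite set in
`ℂ` is connected. -/
theorem exists_analytic_path {κ : Fin 4 → ℂ} (hκ : IsGenericValue κ) {x : M} (hx : x ∈ leaf κ) :
    ∃ (S : Set ℂ) (γ : ℂ → M), IsOpen S ∧ IsPreconnected S ∧ 0 ∈ S ∧ 1 ∈ S ∧ γ 0 = x ∧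
      γ 1 ∈ dnLocus ∧ (∀ z ∈ S, γ z ∈ leaf κ) ∧ AnalyticOnNhd ℂ γ S := by
  have hg := isGenericPoint_of_leaf hκ hx
  have hc := hg.c_ne
  have hsr := hg.sub_ne
  have hr0 : c x 0 * c x 2 ≠ 0 := mul_ne_zero (hc 0) (hc 2)
  have hx' := eq_leafPoint hκ hx
  have h2 : c x 0 * c x 2 + c x 1 * c x 3 = κ 2 := hx 2
  have h3 : c x 0 * c x 2 * (c x 1 * c x 3) = κ 3 := by
    rw [← show J2 x = κ 3 from hx 3, J2]; ring
  generalize c x 0 * c x 2 = r at *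
  generalize c x 1 * c x 3 = s at *
  have hrs : r ≠ s := fun h => hsr (by rw [h]; ring)
  let e₁ : ℂ → ℂ := fun z => (1 - z) * c x 0 + z
  let e₂ : ℂ → ℂ := fun z => (1 - z) * c x 1 - z * r
  let v : ℂ → Fin 4 → ℂ := fun z => ![(1 - z) * a x 0, (1 - z) * a x 1, (1 - z) * a x 2 - z * r,
    (1 - z) * a x 3 + z * (κ 1 / r - κ 0)]
  let S : Set ℂ := {z | e₁ z ≠ 0 ∧ e₂ z ≠ 0}
  have hS : S = {z | ((C (c x 0) * (1 - X) + X) * (C (c x 1) * (1 - X) - C r * X)).IsRoot z}ᶜ := by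
    ext z
    have h₁ : e₁ z = c x 0 * (1 - z) + z := by ring
    have h₂ : e₂ z = c x 1 * (1 - z) - r * z := by ring
    change (e₁ z ≠ 0 ∧ e₂ z ≠ 0) ↔ ¬IsRoot _ z
    rw [IsRoot.def, eval_mul, mul_eq_zero, not_or]
    simp only [eval_add, eval_sub, eval_mul, eval_C, eval_X, eval_one, ← h₁, ← h₂, ne_eq]
  -- The value at 1 is `-r`.
  have hne : (C (c x 0) * (1 - X) + X) * (C (c x 1) * (1 - X) - C r * X) ≠ 0 := fun h => by
    have := congrArg (Polynomial.eval 1) h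
    simp [hr0] at this
  have hfin := Polynomial.finite_setOfPred_isRoot hne
  refine ⟨S, fun z => leafPoint κ r s ((1 - z) * b x 1) ((1 - z) * b x 2) (v z) (e₁ z) (e₂ z),
    ?_, ?_, ?_, ?_, ?_, ?_, fun z hz => leafPoint_mem h2 h3 hrs _ _ _ hz.1 hz.2, fun z hz => ?_⟩
  · rw [hS]
    exact hfin.isClosed.isOpen_compl
  · rw [hS]
    exact (hfin.countable.isConnected_compl_of_one_lt_rank
      (by rw [Complex.rank_real_complex]; norm_num)).isPreconnected
  · simpa [S, e₁, e₂] using ⟨hc 0, hc 1⟩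
  · simpa [S, e₁, e₂] using hr0
  · have hv : v 0 = fun i => a x i := by
      ext i
      fin_cases i <;> simp [v]
    simp only [hv, e₁, e₂, sub_zero, one_mul, zero_mul, add_zero]
    exact hx'.symm
  · have hv : v 1 = ![0, 0, -r, κ 1 / r - κ 0] := by simp [v]
    simp only [hv, e₁, e₂, sub_self, zero_mul, one_mul, zero_add, zero_sub]
    exact leafPoint_mem_dnLocus hκ h2 h3 hrs
  · have he₁ : AnalyticAt ℂ e₁ z := by fun_prop
    have he₂ : AnalyticAt ℂ e₂ z := by fun_prop
    have hv : ∀ i, AnalyticAt ℂ (fun z => v z i) z :=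
      forall_fin_four.2 ⟨by simp [v]; fun_prop, by simp [v]; fun_prop, by simp [v]; fun_prop,
        by simp [v]; fun_prop⟩
    have hd₁ : AnalyticAt ℂ (fun z => r / e₁ z) z := analyticAt_const.div he₁ hz.1
    have hd₂ : AnalyticAt ℂ (fun z => s / e₂ z) z := analyticAt_const.div he₂ hz.2
    have ht : AnalyticAt ℂ (fun z => (κ 1 + (e₁ z * v z 3 * v z 2 + e₂ z * v z 0 * v z 3 +
        r / e₁ z * v z 1 * v z 0 + s / e₂ z * v z 2 * v z 1) - r * κ 0) / (s - r)) z := by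
      have h0 := hv 0
      have h1 := hv 1
      have h2 := hv 2
      have h3 := hv 3
      exact AnalyticAt.div (by fun_prop) analyticAt_const (sub_ne_zero.2 hrs.symm)
    refine AnalyticAt.pi fun p => ?_
    obtain ⟨k, i⟩ := p
    fin_cases k
    · refine forall_fin_four (p := fun i => AnalyticAt ℂ (fun z => leafPoint κ r s
        ((1 - z) * b x 1) ((1 - z) * b x 2) (v z) (e₁ z) (e₂ z) (0, i)) z) |>.2
        ⟨?_, ?_, ?_, ?_⟩ i <;> simp [leafPoint] <;> fun_prop
    · exact hv i
    · exact forall_fin_four (p := fun i => AnalyticAt ℂ (fun z => leafPoint κ r s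
        ((1 - z) * b x 1) ((1 - z) * b x 2) (v z) (e₁ z) (e₂ z) (2, i)) z) |>.2
        ⟨he₁, he₂, hd₁, hd₂⟩ i

/-- Along the path, `lead * dnRes` is analytic and nonzero at 1, so by the identity theorem it does
not vanish identically near 0, and its zeros there are isolated. -/
theorem leaf_subset_closure {κ : Fin 4 → ℂ} (hκ : IsGenericValue κ) :
    leaf κ ⊆ closure (leaf κ ∩ dnLocus) := by
  intro x hx
  obtain ⟨S, γ, hSo, hSc, h0, h1, hγ0, hγ1, hγ, han⟩ := exists_analytic_path hκ hx
  have hF : AnalyticOnNhd ℂ (fun z => lead (γ z) * dnRes (γ z)) S := fun z hz =>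
    ((contDiff_lead.mul contDiff_dnRes).contDiffAt (x := γ z)).analyticAt.comp (han z hz)
  have hmem : ∀ z ∈ S, lead (γ z) * dnRes (γ z) ≠ 0 → γ z ∈ leaf κ ∩ dnLocus := fun z hz h =>
    ⟨hγ z hz, mem_dnLocus.2 ⟨isGenericPoint_of_leaf hκ (hγ z hz), left_ne_zero_of_mul h,
      right_ne_zero_of_mul h⟩⟩
  have hne : ∀ᶠ z in nhdsWithin 0 {0}ᶜ, lead (γ z) * dnRes (γ z) ≠ 0 := by
    refine (hF 0 h0).eventually_eq_zero_or_eventually_ne_zero.resolve_left fun h => ?_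
    have h := hF.eqOn_zero_of_preconnected_of_eventuallyEq_zero hSc h0 h h1
    have hd := (mem_dnLocus.1 hγ1).2
    exact mul_ne_zero hd.1 hd.2 h
  have hcont : Filter.Tendsto γ (nhdsWithin 0 {0}ᶜ) (nhds x) := by
    rw [← hγ0]
    exact (han 0 h0).continuousAt.tendsto.mono_left nhdsWithin_le_nhds
  refine mem_closure_of_tendsto hcont ?_
  filter_upwards [hne, nhdsWithin_le_nhds (hSo.mem_nhds h0)] with z hz hzS
  exact hmem z hzS hz


/-! ### Nijenhuis functions generators -/

theorem hasFDerivAt_rho {x : M} {l : ℂ} (h : g12 x l ≠ 0) :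
    HasFDerivAt (fun y => rho y l) (covec ((g12 x l ^ 2)⁻¹ • rhoForm x l)) x := by
  have h1 := (hasFDerivAt_g22 x l).fun_neg.fun_mul
    ((hasDerivAt_inv h).comp_hasFDerivAt x (hasFDerivAt_g12 x l))
  simp only [rho_eq, div_eq_mul_inv]
  refine h1.congr_fderiv ?_
  simp only [rhoForm, covec_smul, covec_sub, Function.comp_apply]
  match_scalars <;> field_simp

theorem hasFDerivAt_sigma {x : M} {l : ℂ} (h : g11 x l ≠ 0) :
    HasFDerivAt (fun y => sigma y l) (covec ((g11 x l ^ 2)⁻¹ • sigmaForm x l)) x := by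
  have h1 := (hasFDerivAt_g21 x l).fun_neg.fun_mul
    ((hasDerivAt_inv h).comp_hasFDerivAt x (hasFDerivAt_g11 x l))
  simp only [sigma_eq, div_eq_mul_inv]
  refine h1.congr_fderiv ?_
  simp only [sigmaForm, covec_smul, covec_sub, Function.comp_apply]
  match_scalars <;> field_simp

theorem tensorQ_rhoForm {x : M} (h : lead x ≠ 0) (l : ℂ) : tensorQ x *ᵥ rhoForm x l =
    tensorP x *ᵥ (l • rhoForm x l + (detFun x l / lead x) • gradLead x) := by
  refine tensorQ_eq_of_eqModZ h ?_ ?_ fun p hp hq => ?_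
  · simp [rhoForm, gradG12, gradG22]
  · simp [rhoForm, gradG12, gradG22]
  · have h1 := pencil_rhoForm x l p hp hq
    have h2 := tensorP_gradLead x p hp hq
    simp only [mulVec_add, mulVec_smul, Pi.add_apply, Pi.smul_apply, Pi.sub_apply, smul_eq_mul,
      h2] at h1 ⊢
    have h3 : (blocks ![-1, 0, 0, 0] 0 0 : M) p = -(blocks ![1, 0, 0, 0] 0 0 : M) p := by
      obtain ⟨k, i⟩ := p
      fin_cases k <;> fin_cases i <;> simp
    rw [h3] at h1
    field_simp
    linear_combination h1

theorem tensorQ_sigmaForm {x : M} (h : lead x ≠ 0) (l : ℂ) : tensorQ x *ᵥ sigmaForm x l =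
    tensorP x *ᵥ (l • sigmaForm x l + (-detFun x l / lead x) • sigmaAux x) := by
  refine tensorQ_eq_of_eqModZ h ?_ ?_ fun p hp hq => ?_
  · simp [sigmaForm, gradG11, gradG21]
  · simp [sigmaForm, gradG11, gradG21]
  · have h1 := pencil_sigmaForm x l p hp hq
    have h2 := tensorP_sigmaAux x p hp hq
    simp only [mulVec_add, mulVec_smul, Pi.add_apply, Pi.smul_apply, Pi.sub_apply, smul_eq_mul,
      h2] at h1 ⊢
    field_simp
    linear_combination h1

theorem leafDiff_apply {F : M → ℂ} {x ξ : M} (h : HasFDerivAt F (covec ξ) x) (v : tangent x) :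
    leafDiff F x v = covec ξ v := by
  rw [leafDiff, diff_eq h]
  rfl

theorem eval_minpoly_nijenhuis {x : M} (hx : x ∈ regLocus) (l : ℂ) :
    (minpoly ℂ (nijenhuis x)).eval l = detFun x l / lead x := by
  rw [minpoly_nijenhuis hx, eval_mul, eval_C, eval_det_calG, div_eq_inv_mul]

/-- `hQ` says that `N*` maps the numerator form to `λ` times itself plus `(Det 𝒢 / lead) aux`. Since
`Det 𝒢 / lead` is the minimal polynomial, division by `den²` gives the identity with `α = aux /
den²`. -/
theorem isNijenhuisGenerator_of_form {num den : M → ℂ → ℂ} {Φ : M → ℂ → ℂ} {form : M → ℂ → M}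
    {aux : M → M} {Ω : Set (M × ℂ)} (hΩ : ∀ z ∈ Ω, z.1 ∈ regLocus ∧ den z.1 z.2 ≠ 0)
    (hΦ : ∀ x l, Φ x l = num x l / den x l)
    (hnum : Differentiable ℂ fun z : M × ℂ => num z.1 z.2)
    (hden : Differentiable ℂ fun z : M × ℂ => den z.1 z.2)
    (haux : ∀ p, Differentiable ℂ fun x => aux x p)
    (hform : ∀ x l, den x l ≠ 0 →
      HasFDerivAt (fun y => Φ y l) (covec ((den x l ^ 2)⁻¹ • form x l)) x)
    (hQ : ∀ x l, lead x ≠ 0 → tensorQ x *ᵥ form x l =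
      tensorP x *ᵥ (l • form x l + (detFun x l / lead x) • aux x)) :
    IsNijenhuisGenerator Ω Φ := by
  refine ⟨?_, fun z => (den z.1 z.2 ^ 2)⁻¹ • covec (aux z.1), ?_, fun x l hxl v => ?_⟩
  · simp only [hΦ]
    simp only [div_eq_mul_inv]
    exact hnum.differentiableOn.fun_mul (hden.differentiableOn.fun_inv fun z hz => (hΩ z hz).2)
  · refine DifferentiableOn.fun_smul ?_ (Differentiable.differentiableOn ?_)
    · exact (hden.fun_pow 2).differentiableOn.fun_inv fun z hz => pow_ne_zero 2 (hΩ z hz).2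
    · refine Differentiable.fun_sum fun p _ => Differentiable.smul_const ?_ _
      exact (haux p).comp differentiable_fst
  · obtain ⟨hx, hd⟩ := hΩ _ hxl
    obtain ⟨hg, hl, -⟩ := mem_regLocus.1 hx
    rw [leafDiff_apply (hform x l hd), leafDiff_apply (hform x l hd), eval_minpoly_nijenhuis hx,
      covec_smul]
    have := covec_nijenhuis hg hl (hQ x l hl) v
    simp only [_root_.smul_apply, this, covec_add, covec_smul,
      _root_.add_apply, smul_eq_mul]
    ring

theorem differentiable_coord_fst (p : Idx) : Differentiable ℂ fun z : M × ℂ => z.1 p :=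
  ((contDiff_coord p).differentiable (by simp)).comp differentiable_fst

theorem isNijenhuisGenerator_rho : IsNijenhuisGenerator
    {z | z.1 ∈ regLocus ∧ (calG z.1 0 1).eval z.2 ≠ 0} rho := by
  have hco := differentiable_coord_fst
  refine isNijenhuisGenerator_of_form (num := fun x l => -g22 x l) (den := g12) (form := rhoForm)
    (aux := gradLead) ?_ rho_eq ?_ ?_ ?_ (fun x l h => hasFDerivAt_rho h)
    fun x l h => tensorQ_rhoForm h l
  · exact fun z hz => ⟨hz.1, by rw [← eval_calG_zero_one]; exact hz.2⟩
  · unfold g22 lead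
    fun_prop
  · unfold g12
    fun_prop
  · have h := fun p => (contDiff_coord p).differentiable (by simp)
    rintro ⟨k, i⟩
    fin_cases k <;> fin_cases i <;> simp [gradLead] <;> fun_prop

theorem isNijenhuisGenerator_sigma : IsNijenhuisGenerator
    {z | z.1 ∈ regLocus ∧ (calG z.1 0 0).eval z.2 ≠ 0} sigma := by
  have hco := differentiable_coord_fst
  refine isNijenhuisGenerator_of_form (num := fun x l => -g21 x l) (den := g11) (form := sigmaForm)
    (aux := fun x => -sigmaAux x) ?_ sigma_eq ?_ ?_ ?_ (fun x l h => hasFDerivAt_sigma h)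
    fun x l h => ?_
  · exact fun z hz => ⟨hz.1, by rw [← eval_calG_zero_zero]; exact hz.2⟩
  · unfold g21
    fun_prop
  · unfold g11
    fun_prop
  · have h := fun p => (contDiff_coord p).differentiable (by simp)
    rintro ⟨k, i⟩
    fin_cases k <;> fin_cases i <;> simp [sigmaAux] <;> fun_prop
  · rw [tensorQ_sigmaForm h, neg_div, neg_smul, smul_neg]

/-! ### Involution of the Hamiltonians -/

/-- The gradients of the Hamiltonians. -/
def gradHam (x : M) : Fin 4 → M := ![gradH1 x, gradH2 x, gradH3 x, gradK1 x]

theorem hasFDerivAt_hamiltonian (x : M) (i : Fin 4) :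
    HasFDerivAt (hamiltonian i) (covec (gradHam x i)) x := by
  fin_cases i
  exacts [hasFDerivAt_H1 x, hasFDerivAt_H2 x, hasFDerivAt_H3 x, hasFDerivAt_K1 x]

/-- Lenard's argument: a bracket for `P'` becomes one for `P` by moving along a chain in either
factor, and antisymmetry, or the end of a chain, makes it vanish. -/
theorem covec_gradHam_tensorP' (x : M) (i j : Fin 4) :
    covec (gradHam x i) (tensorP' x *ᵥ gradHam x j) = 0 ∧
      covec (gradHam x i) (tensorP x *ᵥ gradHam x j) = 0 := by
  have s := covec_mulVec_swap (tensorP_transpose x)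
  have s' := covec_mulVec_swap (tensorP'_transpose x)
  have d := fun ξ => covec_self_mulVec (tensorP_transpose x) ξ
  have d' := fun ξ => covec_self_mulVec (tensorP'_transpose x) ξ
  have e0 := tensorP'_gradH0 x
  have e1 := tensorP'_gradH1 x
  have e2 := tensorP'_gradH2 x
  have e3 := tensorP'_gradH3 x
  have f0 := tensorP'_gradK0 x
  have f1 := tensorP'_gradK1 x
  have h12 : covec (gradH1 x) (tensorP x *ᵥ gradH2 x) = 0 := by
    have := s' (gradH1 x) (gradH1 x)
    rw [e1, map_neg] at this
    linear_combination (-1 / 2 : ℂ) * this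
  have h23 : covec (gradH2 x) (tensorP x *ᵥ gradH3 x) = 0 := by
    have := s' (gradH2 x) (gradH2 x)
    rw [e2, map_neg] at this
    linear_combination (-1 / 2 : ℂ) * this
  have h13 : covec (gradH1 x) (tensorP x *ᵥ gradH3 x) = 0 := by
    have := s' (gradH1 x) (gradH2 x)
    rw [e1, e2, map_neg, map_neg, neg_neg, d] at this
    linear_combination -this
  have k1 : covec (gradK1 x) (tensorP x *ᵥ gradH1 x) = 0 := by
    have := s' (gradK1 x) (gradH0 x)
    rw [e0, f1, map_zero, map_neg] at this
    linear_combination -this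
  have k2 : covec (gradK1 x) (tensorP x *ᵥ gradH2 x) = 0 := by
    have := s' (gradK1 x) (gradH1 x)
    rw [e1, f1, map_zero, map_neg] at this
    linear_combination -this
  have k3 : covec (gradK1 x) (tensorP x *ᵥ gradH3 x) = 0 := by
    have := s' (gradK1 x) (gradH2 x)
    rw [e2, f1, map_zero, map_neg] at this
    linear_combination -this
  have h21 := (s (gradH2 x) (gradH1 x)).trans (neg_eq_zero.2 h12)
  have h31 := (s (gradH3 x) (gradH1 x)).trans (neg_eq_zero.2 h13)
  have h32 := (s (gradH3 x) (gradH2 x)).trans (neg_eq_zero.2 h23)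
  have l1 := (s (gradH1 x) (gradK1 x)).trans (neg_eq_zero.2 k1)
  have l2 := (s (gradH2 x) (gradK1 x)).trans (neg_eq_zero.2 k2)
  have l3 := (s (gradH3 x) (gradK1 x)).trans (neg_eq_zero.2 k3)
  fin_cases i <;> fin_cases j <;>
    simp [gradHam, e1, e2, e3, f1, d, h12, h13, h23, h21, h31, h32, k1, k2, k3, l1, l2, l3]

theorem covec_gradHam_tensorP'_gradF (x : M) (i : Fin 4) (j : Fin 2) :
    covec (gradHam x i) (tensorP' x *ᵥ gradF x j) = 0 := by
  fin_cases j
  · simp only [gradF, Fin.zero_eta, cons_val_zero, tensorP'_gradH0, map_neg, neg_eq_zero]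
    exact (covec_gradHam_tensorP' x i 0).2
  · simp only [gradF, Fin.mk_one, cons_val_one, cons_val_fin_one, tensorP'_gradK0]
    exact (covec_gradHam_tensorP' x i 3).2

/-- The correction terms of `Q` involve the fields `P' dfᵢ`, which are `-P dH₁` and `P dK₁`; every
Hamiltonian is constant along them. -/
theorem covec_gradHam_tensorQ (x : M) (i j : Fin 4) :
    covec (gradHam x i) (tensorQ x *ᵥ gradHam x j) = 0 := by
  rw [tensorQ_mulVec]
  simp [covec_gradHam_tensorP'_gradF, covec_gradHam_tensorP']

theorem hamiltonian_involution {x : M} (h : lead x ≠ 0) (i j : Fin 4) :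
    leafDiff (hamiltonian i) x (restrict x (tensorP x) (leafDiff (hamiltonian j) x)) = 0 ∧
      leafDiff (hamiltonian i) x (restrict x (tensorQ x) (leafDiff (hamiltonian j) x)) = 0 := by
  have hj : leafDiff (hamiltonian j) x =
      (covec (gradHam x j)).toLinearMap ∘ₗ (tangent x).subtype := by
    rw [leafDiff, diff_eq (hasFDerivAt_hamiltonian x j)]
  rw [leafDiff_apply (hasFDerivAt_hamiltonian x i), leafDiff_apply (hasFDerivAt_hamiltonian x i),
    hj, restrict_tensorP_covec, restrict_leafDiff (tensorQ_transpose x) (tensorQ_gradCasimir h)]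
  exact ⟨(covec_gradHam_tensorP' x i j).2, covec_gradHam_tensorQ x i j⟩


/-! ### The canonical eigenforms -/

/-- The derivative of `Det 𝒢(λ)` with respect to `λ`. -/
def detDeriv (x : M) (l : ℂ) : ℂ := (derivative (calG x).det).eval l

theorem hasDerivAt_detFun (x : M) (l : ℂ) : HasDerivAt (detFun x) (detDeriv x l) l := by
  have h : detFun x = fun t => (calG x).det.eval t := funext fun t => (eval_det_calG x t).symm
  rw [h]
  exact (calG x).det.hasDerivAt l

theorem detDeriv_ne_zero {x : M} (hx : x ∈ regLocus) {l : ℂ} (hl : detFun x l = 0) :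
    detDeriv x l ≠ 0 :=
  isCoprime_iff_forall_isRoot.1 hx.2.2 l (by rw [IsRoot.def, eval_det_calG, hl])

theorem g12_ne_zero {x : M} (hx : x ∈ dnLocus) {l : ℂ} (hl : detFun x l = 0) : g12 x l ≠ 0 := by
  rw [← eval_calG_zero_one]
  exact (hx.2 l (by rw [IsRoot.def, eval_det_calG, hl])).1

theorem g22_ne_zero {x : M} (hx : x ∈ dnLocus) {l : ℂ} (hl : detFun x l = 0) : g22 x l ≠ 0 := by
  rw [← eval_calG_one_one]
  exact (hx.2 l (by rw [IsRoot.def, eval_det_calG, hl])).2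

/-- The differential of a root of `Det 𝒢(λ)`. -/
def lamForm (x : M) (l : ℂ) : M := (-(detDeriv x l)⁻¹) • gradDet x l

/-- The differential of `log ρ(λ)`, up to a multiple of the differential of the root `λ`. -/
def muForm (x : M) (l k : ℂ) : M := (-(g12 x l * g22 x l)⁻¹) • rhoForm x l + k • lamForm x l

theorem gradDet_apply_three (x : M) (l : ℂ) : gradDet x l (0, 3) = 0 ∧ gradDet x l (1, 3) = 0 := by
  simp [gradDet, gradG11, gradG12, gradG21, gradG22]

theorem rhoForm_apply_three (x : M) (l : ℂ) : rhoForm x l (0, 3) = 0 ∧ rhoForm x l (1, 3) = 0 := by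
  simp [rhoForm, gradG12, gradG22]

theorem tensorQ_gradDet {x : M} (h : lead x ≠ 0) {l : ℂ} (hl : detFun x l = 0) :
    tensorQ x *ᵥ gradDet x l = tensorP x *ᵥ (l • gradDet x l) := by
  refine tensorQ_eq_of_eqModZ h (gradDet_apply_three x l).1 (gradDet_apply_three x l).2
    fun p hp hq => ?_
  have h1 := pencil_gradDet x l p hp hq
  rw [hl, zero_smul, Pi.zero_apply, Pi.sub_apply, sub_eq_zero] at h1
  rw [h1, mulVec_smul]

theorem tensorQ_lamForm {x : M} (h : lead x ≠ 0) {l : ℂ} (hl : detFun x l = 0) :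
    tensorQ x *ᵥ lamForm x l = tensorP x *ᵥ (l • lamForm x l) := by
  rw [lamForm, mulVec_smul, tensorQ_gradDet h hl, smul_comm l]
  simp only [mulVec_smul]

theorem tensorQ_muForm {x : M} (h : lead x ≠ 0) {l : ℂ} (hl : detFun x l = 0) (k : ℂ) :
    tensorQ x *ᵥ muForm x l k = tensorP x *ᵥ (l • muForm x l k) := by
  rw [muForm, mulVec_add, mulVec_smul, mulVec_smul, tensorQ_lamForm h hl, tensorQ_rhoForm h, hl,
    zero_div, zero_smul, add_zero]
  simp only [mulVec_smul, mulVec_add, smul_add, smul_comm l]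

/-- Computing `ξ(Qη)` in two ways by antisymmetry gives `(l - l') ξ(Pη) = 0`. -/
theorem covec_tensorP_eq_zero {x ξ η : M} {l l' : ℂ}
    (hξ : tensorQ x *ᵥ ξ = tensorP x *ᵥ (l • ξ)) (hη : tensorQ x *ᵥ η = tensorP x *ᵥ (l' • η))
    (hl : l ≠ l') : covec ξ (tensorP x *ᵥ η) = 0 := by
  have h1 := covec_mulVec_swap (tensorQ_transpose x) ξ η
  rw [hξ, hη, mulVec_smul, mulVec_smul, map_smul, map_smul,
    covec_mulVec_swap (tensorP_transpose x) η ξ, smul_eq_mul, smul_eq_mul] at h1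
  exact (mul_eq_zero.1 (show (l - l') * covec ξ (tensorP x *ᵥ η) = 0 by
    linear_combination -h1)).resolve_left (sub_ne_zero.2 hl)

/-- The pencil identity for `rhoForm` at `l` is paired with `d Det 𝒢(r)`, and that for `d Det 𝒢(r)`
with `rhoForm` at `l`; in the sum the `P'` terms cancel. For `l = r` both sides are zero, so the
bracket itself has to be found as a limit. -/
theorem covec_rhoForm_gradDet_mul {x : M} {r : ℂ} (hr : detFun x r = 0) (l : ℂ) :
    (l - r) * covec (rhoForm x l) (tensorP x *ᵥ gradDet x r) = detFun x l * (g12 x r * g22 x r) := by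
  have h1 := covec_eq_of_eqModZ (gradDet_apply_three x r).1 (gradDet_apply_three x r).2
    (pencil_rhoForm x l)
  have h2 := covec_eq_of_eqModZ (rhoForm_apply_three x l).1 (rhoForm_apply_three x l).2
    (pencil_gradDet x r)
  rw [map_sub, map_smul, covec_mulVec_swap (tensorP_transpose x) (gradDet x r),
    covec_mulVec_swap (tensorP'_transpose x) (gradDet x r), map_smul] at h1
  rw [hr, zero_smul, map_zero, map_sub, map_smul] at h2
  have h3 : covec (gradDet x r) (blocks ![-1, 0, 0, 0] 0 0) = g12 x r * g22 x r := by
    simp [covec_apply, sum_idx, gradDet, gradG11, gradG12, gradG21, gradG22, g12]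
    ring
  rw [h3] at h1
  simp only [smul_eq_mul] at h1 h2
  linear_combination h1 + h2

/-- Divide the preceding identity by `l - r` and let `l` tend to `r`: the difference quotient of the
determinant tends to its derivative. -/
theorem covec_rhoForm_gradDet {x : M} {r : ℂ} (hr : detFun x r = 0) :
    covec (rhoForm x r) (tensorP x *ᵥ gradDet x r) = detDeriv x r * (g12 x r * g22 x r) := by
  have hcont : Continuous fun l => covec (rhoForm x l) (tensorP x *ᵥ gradDet x r) := by
    simp only [covec_apply, sum_idx, rhoForm, gradG12, gradG22, g12, g22, Pi.sub_apply,
      Pi.smul_apply, smul_eq_mul, blocks_zero, blocks_one, blocks_two, cons_val_zero, cons_val_one,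
      cons_val]
    fun_prop
  refine tendsto_nhds_unique
    (hcont.continuousAt.tendsto.mono_left (nhdsWithin_le_nhds (s := {r}ᶜ))) ?_
  refine ((hasDerivAt_iff_tendsto_slope.1 (hasDerivAt_detFun x r)).mul_const _).congr' ?_
  filter_upwards [self_mem_nhdsWithin] with l hl
  have hlr : l - r ≠ 0 := sub_ne_zero.2 hl
  rw [slope_def_field, hr, sub_zero, div_mul_eq_mul_div, ← covec_rhoForm_gradDet_mul hr,
    mul_div_cancel_left₀ _ hlr]

theorem covec_muForm_lamForm {x : M} (hx : x ∈ dnLocus) {r : ℂ} (hr : detFun x r = 0) (k : ℂ) :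
    covec (muForm x r k) (tensorP x *ᵥ lamForm x r) = 1 := by
  have h1 := detDeriv_ne_zero hx.1 hr
  have h2 := g12_ne_zero hx hr
  have h3 := g22_ne_zero hx hr
  rw [muForm, covec_add, covec_smul, covec_smul, _root_.add_apply, _root_.smul_apply,
    _root_.smul_apply, covec_self_mulVec (tensorP_transpose x), lamForm, mulVec_smul, map_smul,
    covec_rhoForm_gradDet hr]
  simp only [smul_eq_mul]
  field_simp
  ring

section Eigenforms

variable {x : M} {r k : Fin 4 → ℂ}

theorem bracket_lamForm_lamForm (h : lead x ≠ 0) (hr : Function.Injective r)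
    (hD : ∀ i, detFun x (r i) = 0) (i j : Fin 4) :
    covec (lamForm x (r i)) (tensorP x *ᵥ lamForm x (r j)) = 0 := by
  rcases eq_or_ne i j with rfl | hij
  · exact covec_self_mulVec (tensorP_transpose x) _
  · exact covec_tensorP_eq_zero (tensorQ_lamForm h (hD i)) (tensorQ_lamForm h (hD j)) (hr.ne hij)

theorem bracket_muForm_muForm (h : lead x ≠ 0) (hr : Function.Injective r)
    (hD : ∀ i, detFun x (r i) = 0) (i j : Fin 4) :
    covec (muForm x (r i) (k i)) (tensorP x *ᵥ muForm x (r j) (k j)) = 0 := by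
  rcases eq_or_ne i j with rfl | hij
  · exact covec_self_mulVec (tensorP_transpose x) _
  · exact covec_tensorP_eq_zero (tensorQ_muForm h (hD i) _) (tensorQ_muForm h (hD j) _) (hr.ne hij)

theorem bracket_muForm_lamForm (hx : x ∈ dnLocus) (hr : Function.Injective r)
    (hD : ∀ i, detFun x (r i) = 0) (i j : Fin 4) :
    covec (muForm x (r i) (k i)) (tensorP x *ᵥ lamForm x (r j)) = if i = j then 1 else 0 := by
  have h := (mem_regLocus.1 hx.1).2.1
  split_ifs with hij
  · rw [hij]
    exact covec_muForm_lamForm hx (hD j) _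
  · exact covec_tensorP_eq_zero (tensorQ_muForm h (hD i) _) (tensorQ_lamForm h (hD j)) (hr.ne hij)

theorem bracket_lamForm_muForm (hx : x ∈ dnLocus) (hr : Function.Injective r)
    (hD : ∀ i, detFun x (r i) = 0) (i j : Fin 4) :
    covec (lamForm x (r i)) (tensorP x *ᵥ muForm x (r j) (k j)) = if i = j then -1 else 0 := by
  rw [covec_mulVec_swap (tensorP_transpose x), bracket_muForm_lamForm hx hr hD]
  rcases eq_or_ne i j with rfl | hij
  · simp
  · simp [hij, hij.symm]

/-- The differentials of the roots and of the `log ρ` form a basis of the cotangent space of the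
leaf. -/
theorem eq_zero_of_eigenforms (hx : x ∈ dnLocus) (hr : Function.Injective r)
    (hD : ∀ i, detFun x (r i) = 0) {v : M} (hv : v ∈ tangent x)
    (hl : ∀ i, covec (lamForm x (r i)) v = 0) (hm : ∀ i, covec (muForm x (r i) (k i)) v = 0) :
    v = 0 := by
  obtain ⟨hg, h, -⟩ := mem_regLocus.1 hx.1
  -- By the canonical brackets, the vectors `P dλᵢ`, `P dμᵢ` are dual, up to sign and order, to the
  -- eight forms. They are therefore a basis of the tangent space, in which the coordinates of `v`
  -- are the values of the forms on `v`.
  let w : Fin 4 ⊕ Fin 4 → tangent x := Sum.elim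
    (fun i => ⟨tensorP x *ᵥ lamForm x (r i),
      mulVec_mem_tangent (tensorP_transpose x) (tensorP_gradCasimir x) _⟩)
    (fun i => ⟨tensorP x *ᵥ muForm x (r i) (k i),
      mulVec_mem_tangent (tensorP_transpose x) (tensorP_gradCasimir x) _⟩)
  have hcomb : ∀ g : Fin 4 ⊕ Fin 4 → ℂ, ((∑ i, g i • w i : tangent x) : M) =
      (∑ i, g (Sum.inl i) • tensorP x *ᵥ lamForm x (r i)) +
        ∑ i, g (Sum.inr i) • tensorP x *ᵥ muForm x (r i) (k i) := fun g => by
    simp [w]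
  have hmu : ∀ g : Fin 4 ⊕ Fin 4 → ℂ, ∀ j,
      covec (muForm x (r j) (k j)) (∑ i, g i • w i : tangent x) = g (Sum.inl j) := fun g j => by
    rw [hcomb, map_add, map_sum, map_sum]
    simp [bracket_muForm_lamForm hx hr hD, bracket_muForm_muForm h hr hD]
  have hlam : ∀ g : Fin 4 ⊕ Fin 4 → ℂ, ∀ j,
      covec (lamForm x (r j)) (∑ i, g i • w i : tangent x) = -g (Sum.inr j) := fun g j => by
    rw [hcomb, map_add, map_sum, map_sum]
    simp [bracket_lamForm_muForm hx hr hD, bracket_lamForm_lamForm h hr hD]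
  have hli : LinearIndependent ℂ w := by
    rw [Fintype.linearIndependent_iff]
    rintro g hg0 (j | j)
    · rw [← hmu g j, hg0]
      simp
    · have := hlam g j
      rw [hg0] at this
      simpa using this.symm
  have hspan : Submodule.span ℂ (Set.range w) = ⊤ :=
    hli.span_eq_top_of_card_eq_finrank' (by rw [finrank_tangent hg]; rfl)
  obtain ⟨g, hgv⟩ := (Submodule.mem_span_range_iff_exists_fun ℂ).1
    (hspan ▸ Submodule.mem_top : (⟨v, hv⟩ : tangent x) ∈ Submodule.span ℂ (Set.range w))
  have hg0 : g = 0 := by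
    funext i
    rcases i with j | j
    · rw [← hmu g j, hgv]
      exact hm j
    · have := hlam g j
      rw [hgv] at this
      have h0 : covec (lamForm x (r j)) v = 0 := hl j
      simpa [h0] using this.symm
  have := congrArg Subtype.val hgv
  rw [hg0] at this
  simpa using this.symm

theorem linearIndependent_lamForm (hx : x ∈ dnLocus) (hr : Function.Injective r)
    (hD : ∀ i, detFun x (r i) = 0) : LinearIndependent ℂ fun i =>
      (covec (lamForm x (r i))).toLinearMap ∘ₗ (tangent x).subtype := by
  rw [Fintype.linearIndependent_iff]
  intro g hg j
  have := LinearMap.congr_fun hg ⟨tensorP x *ᵥ muForm x (r j) 0,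
    mulVec_mem_tangent (tensorP_transpose x) (tensorP_gradCasimir x) _⟩
  have hb := bracket_lamForm_muForm (k := fun _ => 0) hx hr hD
  simpa [LinearMap.sum_apply, hb] using this

end Eigenforms

/-! ### Independence of the coefficients of the minimal polynomial -/

theorem differentiableAt_coeffP {x : M} (hx : x ∈ regLocus) (i : Fin 4) :
    DifferentiableAt ℂ (coeffP i) x := (analyticAt_coeffP hx i).differentiableAt

theorem detFun_eq_coeffP {x : M} (hx : x ∈ regLocus) (l : ℂ) :
    detFun x l = lead x * (l ^ 4 - ∑ i, coeffP i x * l ^ (3 - (i : ℕ))) := by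
  have h := (mem_regLocus.1 hx).2.1
  rw [← eval_det_calG, det_calG]
  simp only [coeffP_eq hx, Fin.sum_univ_four, eval_add, eval_mul, eval_C, eval_pow, eval_X]
  simp [Fin.rev]
  field_simp
  ring

/-- Differentiate `Det 𝒢 = lead · Δ_N`; at a root the term with the differential of `lead` drops
out. -/
theorem covec_gradDet_eq {x : M} (hx : x ∈ regLocus) {l : ℂ} (hl : detFun x l = 0) :
    (covec (gradDet x l)).toLinearMap =
      -∑ i, (lead x * l ^ (3 - ((i : Fin 4) : ℕ))) • diff (coeffP i) x := by
  have h := (mem_regLocus.1 hx).2.1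
  have hev : (fun y => detFun y l) =ᶠ[nhds x]
      fun y => lead y * (l ^ 4 - ∑ i, coeffP i y * l ^ (3 - ((i : Fin 4) : ℕ))) :=
    Filter.eventuallyEq_of_mem (isOpen_regLocus.mem_nhds hx) fun y hy => detFun_eq_coeffP hy l
  have hsum := (hasFDerivAt_lead x).fun_mul (((HasFDerivAt.fun_sum (u := Finset.univ)
    fun (i : Fin 4) _ => ((differentiableAt_coeffP hx i).hasFDerivAt.mul_const
      (l ^ (3 - (i : ℕ))))).const_sub (l ^ 4)))
  have heq := (hasFDerivAt_detFun x l).unique (hsum.congr_of_eventuallyEq hev)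
  rw [heq]
  have h0 : l ^ 4 - ∑ i, coeffP i x * l ^ (3 - ((i : Fin 4) : ℕ)) = 0 :=
    (mul_eq_zero.1 ((detFun_eq_coeffP hx l).symm.trans hl)).resolve_left h
  rw [h0]
  ext v
  simp [diff, Finset.mul_sum, mul_assoc]

/-- The four independent forms `dλ_j` lie in the span of the four `dpᵢ`, which therefore has
dimension 4. -/
theorem linearIndependent_leafDiff_coeffP {x : M} (hx : x ∈ dnLocus) :
    LinearIndependent ℂ fun i => leafDiff (coeffP i) x := by
  obtain ⟨hg, h, -⟩ := mem_regLocus.1 hx.1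
  obtain ⟨r, hr, hroots⟩ := exists_roots_det_calG h hx.1.2.2
  have hD := detFun_root h hroots
  have hli := linearIndependent_lamForm hx hr hD
  rw [linearIndependent_iff_card_le_finrank_span]
  have hle : Submodule.span ℂ (Set.range fun i =>
      (covec (lamForm x (r i))).toLinearMap ∘ₗ (tangent x).subtype) ≤
      Submodule.span ℂ (Set.range fun i => leafDiff (coeffP i) x) := by
    rw [Submodule.span_le]
    rintro _ ⟨j, rfl⟩
    have h1 : (covec (lamForm x (r j))).toLinearMap ∘ₗ (tangent x).subtype =
        (detDeriv x (r j))⁻¹ • ∑ i, (lead x * r j ^ (3 - ((i : Fin 4) : ℕ))) •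
          leafDiff (coeffP i) x := by
      ext v
      have := LinearMap.congr_fun (covec_gradDet_eq hx.1 (hD j)) v
      simp only [ContinuousLinearMap.coe_coe] at this
      simp only [LinearMap.comp_apply, Submodule.subtype_apply, ContinuousLinearMap.coe_coe,
        lamForm, covec_smul, _root_.smul_apply, this]
      simp [leafDiff, LinearMap.sum_apply]
    simp only [h1]
    exact Submodule.smul_mem _ _ (Submodule.sum_mem _ fun i _ =>
      Submodule.smul_mem _ _ (Submodule.subset_span ⟨i, rfl⟩))
  have h2 := Submodule.finrank_mono hle
  rw [finrank_span_eq_card hli] at h2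
  exact h2


/-! ### Continuous solutions of implicit equations -/

section Implicit

variable {E : Type*} [NormedAddCommGroup E] [NormedSpace ℂ E]

theorem hasStrictFDerivAt_of_partials {F : E × ℂ → ℂ} {p : E} {t : ℂ} {α : E →L[ℂ] ℂ} {d : ℂ}
    (hF : ContDiffAt ℂ ⊤ F (p, t)) (h1 : HasFDerivAt (fun y => F (y, t)) α p)
    (h2 : HasDerivAt (fun s => F (p, s)) d t) :
    HasStrictFDerivAt F (α.coprod (d • ContinuousLinearMap.id ℂ ℂ)) (p, t) := by
  have h := hF.hasStrictFDerivAt (by simp)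
  refine h.congr_fderiv ?_
  have e1 : HasFDerivAt (fun y => F (y, t)) (fderiv ℂ F (p, t) ∘L .inl ℂ E ℂ) p :=
    h.hasFDerivAt.comp p (hasFDerivAt_prodMk_left p t)
  have e2 : HasFDerivAt (fun s => F (p, s)) (fderiv ℂ F (p, t) ∘L .inr ℂ E ℂ) t :=
    h.hasFDerivAt.comp t (hasFDerivAt_prodMk_right p t)
  refine ContinuousLinearMap.ext fun v => ?_
  rw [← ContinuousLinearMap.comp_inl_add_comp_inr, e1.unique h1, e2.unique h2.hasFDerivAt]
  simp [mul_comm]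

theorem isInvertible_coprod_inr {α : E →L[ℂ] ℂ} {d : ℂ} (hd : d ≠ 0) :
    ((α.coprod (d • ContinuousLinearMap.id ℂ ℂ)) ∘L .inr ℂ E ℂ).IsInvertible := by
  refine ⟨ContinuousLinearEquiv.smulLeft (Units.mk0 d hd), ?_⟩
  ext
  simp

variable [CompleteSpace E]

/-- A continuous solution of an implicit equation is strictly differentiable. -/
theorem hasStrictFDerivAt_of_implicit {F : E × ℂ → ℂ} {p : E} {g : E → ℂ} {α : E →L[ℂ] ℂ} {d : ℂ}
    (hF : HasStrictFDerivAt F (α.coprod (d • ContinuousLinearMap.id ℂ ℂ)) (p, g p)) (hd : d ≠ 0)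
    (hg : ContinuousAt g p) (h : ∀ᶠ y in nhds p, F (y, g y) = F (p, g p)) :
    HasStrictFDerivAt g ((-d⁻¹) • α) p := by
  have hinv := isInvertible_coprod_inr (α := α) hd
  have h1 := hF.hasStrictFDerivAt_implicitFunctionOfProdDomain hinv
  have h2 : Filter.Tendsto (fun y => (y, g y)) (nhds p) (nhds (p, g p)) :=
    (continuousAt_id.prodMk hg).tendsto
  have h3 := h2.eventually (hF.eventually_apply_eq_iff_implicitFunctionOfProdDomain hinv)
  -- By local uniqueness, a continuous solution coincides near `p` with the implicit function.
  refine (h1.congr_of_eventuallyEq ?_).congr_fderiv ?_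
  · filter_upwards [h, h3] with y hy hy'
    exact hy'.1 hy
  · ext v
    obtain ⟨e, he⟩ := hinv
    have happ : ∀ t, e t = d * t := fun t => by
      rw [← ContinuousLinearEquiv.coe_coe, he]
      simp
    rw [← he, ContinuousLinearMap.inverse_equiv]
    have : e.symm (α v) = d⁻¹ * α v := by
      rw [ContinuousLinearEquiv.symm_apply_eq, happ, mul_inv_cancel_left₀ hd]
    simp [this]

/-- An implicit equation has a continuous solution. -/
theorem exists_continuousOn_implicit {F : E × ℂ → ℂ} {p : E} {t : ℂ} {α : E →L[ℂ] ℂ} {d : ℂ}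
    (hF : HasStrictFDerivAt F (α.coprod (d • ContinuousLinearMap.id ℂ ℂ)) (p, t)) (hd : d ≠ 0) :
    ∃ g : E → ℂ, g p = t ∧ ∃ s ∈ nhds p, ContinuousOn g s ∧ ∀ y ∈ s, F (y, g y) = F (p, t) := by
  have hinv := isInvertible_coprod_inr (α := α) hd
  obtain ⟨K, s, hs, hK⟩ :=
    (hF.hasStrictFDerivAt_implicitFunctionOfProdDomain hinv).exists_lipschitzOnWith
  have h := hF.eventually_apply_implicitFunctionOfProdDomain hinv
  refine ⟨hF.implicitFunctionOfProdDomain hinv, ?_, s ∩ _, Filter.inter_mem hs h,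
    hK.continuousOn.mono Set.inter_subset_left, fun y hy => hy.2⟩
  exact (hF.eventually_apply_eq_iff_implicitFunctionOfProdDomain hinv).self_of_nhds.1 rfl

end Implicit

/-! ### Differentials of the branches -/

theorem contDiff_coord_fst (p : Idx) : ContDiff ℂ ⊤ fun z : M × ℂ => z.1 p :=
  (contDiff_coord p).comp contDiff_fst

theorem contDiff_g12 : ContDiff ℂ ⊤ fun z : M × ℂ => g12 z.1 z.2 := by
  have := contDiff_coord_fst
  unfold g12
  fun_prop

theorem contDiff_g22 : ContDiff ℂ ⊤ fun z : M × ℂ => g22 z.1 z.2 := by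
  have := contDiff_coord_fst
  unfold g22 lead
  fun_prop

theorem contDiff_detFun : ContDiff ℂ ⊤ fun z : M × ℂ => detFun z.1 z.2 := by
  have := contDiff_coord_fst
  unfold detFun g11 g12 g21 g22 lead
  fun_prop

theorem hasStrictFDerivAt_detFun (x : M) (l : ℂ) :
    HasStrictFDerivAt (fun z : M × ℂ => detFun z.1 z.2)
      ((covec (gradDet x l)).coprod (detDeriv x l • ContinuousLinearMap.id ℂ ℂ)) (x, l) :=
  hasStrictFDerivAt_of_partials contDiff_detFun.contDiffAt (hasFDerivAt_detFun x l)
    (hasDerivAt_detFun x l)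

theorem hasStrictFDerivAt_lam {x : M} (hx : x ∈ regLocus) {g : M → ℂ} (hg : ContinuousAt g x)
    (hD : ∀ᶠ y in nhds x, detFun y (g y) = 0) :
    HasStrictFDerivAt g (covec (lamForm x (g x))) x := by
  rw [lamForm, covec_smul]
  exact hasStrictFDerivAt_of_implicit (hasStrictFDerivAt_detFun x (g x))
    (detDeriv_ne_zero hx hD.self_of_nhds) hg (by simpa [hD.self_of_nhds] using hD)

theorem contDiffAt_rho {x : M} {l : ℂ} (h : g12 x l ≠ 0) :
    ContDiffAt ℂ ⊤ (fun z : M × ℂ => rho z.1 z.2) (x, l) := by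
  simp only [rho_eq]
  exact contDiff_g22.neg.contDiffAt.fun_div contDiff_g12.contDiffAt h

theorem exists_hasStrictFDerivAt_mu {x : M} (hx : x ∈ dnLocus) {g h : M → ℂ} (hg : ContinuousAt g x)
    (hD : ∀ᶠ y in nhds x, detFun y (g y) = 0) (hh : ContinuousAt h x)
    (he : ∀ᶠ y in nhds x, Complex.exp (h y) = rho y (g y)) :
    ∃ k, HasStrictFDerivAt h (covec (muForm x (g x) k)) x := by
  have h12 := g12_ne_zero hx hD.self_of_nhds
  have h22 := g22_ne_zero hx hD.self_of_nhds
  have hlam := hasStrictFDerivAt_lam hx.1 hg hD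
  have hdiff := contDiffAt_rho h12
  have hr : DifferentiableAt ℂ (fun t => rho x t) (g x) :=
    (hdiff.differentiableAt (by simp)).comp (g x) (hasFDerivAt_prodMk_right x (g x)).differentiableAt
  have hrho := hasStrictFDerivAt_of_partials hdiff (hasFDerivAt_rho h12) hr.hasDerivAt
  have hR : HasStrictFDerivAt (fun y => rho y (g y)) _ x :=
    hrho.comp x ((hasStrictFDerivAt_id x).prodMk hlam)
  have hR' : HasStrictFDerivAt (fun z : M × ℂ => rho z.1 (g z.1)) _ (x, h x) :=
    HasStrictFDerivAt.comp (g := fun y => rho y (g y)) (x, h x) hR hasStrictFDerivAt_fst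
  have hF : HasStrictFDerivAt (fun z : M × ℂ => Complex.exp z.2 - rho z.1 (g z.1)) _ (x, h x) :=
    ((Complex.hasStrictDerivAt_exp (h x)).comp_hasStrictFDerivAt (x, h x)
      hasStrictFDerivAt_snd).sub hR'
  have hexp := Complex.exp_ne_zero (h x)
  have he0 : Complex.exp (h x) = -g22 x (g x) / g12 x (g x) := by
    rw [he.self_of_nhds, rho_eq]
  -- From `dμ = dρ(λ)/ρ(λ)`: the dependence of `ρ` on `λ` contributes the coefficient `∂_λρ / ρ` of
  -- `dλ`, while the dependence on the point gives `-rhoForm / (𝒢₁₂𝒢₂₂)`.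
  refine ⟨(Complex.exp (h x))⁻¹ * deriv (fun t => rho x t) (g x), ?_⟩
  refine (hasStrictFDerivAt_of_implicit
    (α := -((g12 x (g x) ^ 2)⁻¹ • covec (rhoForm x (g x)) +
      deriv (fun t => rho x t) (g x) • covec (lamForm x (g x))))
    (hF.congr_fderiv ?_) hexp hh ?_).congr_fderiv ?_
  · ext v
    · simp [covec_smul]
    · simp
  · have h0 := he.self_of_nhds
    filter_upwards [he] with y hy
    simp [hy, h0]
  · rw [muForm, covec_add, covec_smul, covec_smul, he0]
    ext v
    simp only [_root_.smul_apply, _root_.neg_apply, _root_.add_apply, smul_eq_mul]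
    field_simp
    ring


/-! ### Existence of the branches -/

theorem roots_det_calG_eq {x : M} (h : lead x ≠ 0) {r : Fin 4 → ℂ} (hr : Function.Injective r)
    (hD : ∀ i, detFun x (r i) = 0) : (calG x).det.roots = Finset.univ.val.map r := by
  symm
  refine Multiset.eq_of_le_of_card_le ?_ ?_
  · rw [Multiset.le_iff_subset (Finset.univ.nodup.map hr)]
    intro l hl
    obtain ⟨i, -, rfl⟩ := Multiset.mem_map.1 hl
    rw [mem_roots (det_calG_ne_zero h), IsRoot.def, eval_det_calG, hD]
  · refine (card_roots' _).trans ?_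
    rw [natDegree_det_calG h]
    simp

theorem rho_ne_zero {x : M} (hx : x ∈ dnLocus) {l : ℂ} (hl : detFun x l = 0) : rho x l ≠ 0 := by
  rw [rho_eq]
  exact div_ne_zero (neg_ne_zero.2 (g22_ne_zero hx hl)) (g12_ne_zero hx hl)

theorem continuousAt_rho {x : M} (hx : x ∈ dnLocus) {l : ℂ} (hl : detFun x l = 0) :
    ContinuousAt (fun z : M × ℂ => rho z.1 z.2) (x, l) :=
  (contDiffAt_rho (g12_ne_zero hx hl)).continuousAt

theorem exists_isBranch {m : M} (hm : m ∈ dnLocus) :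
    ∃ V, IsOpen V ∧ m ∈ V ∧ ∃ lam mu, IsBranch V lam mu := by
  have h := (mem_regLocus.1 hm.1).2.1
  obtain ⟨r, hr, hroots⟩ := exists_roots_det_calG h hm.1.2.2
  have hD := detFun_root h hroots
  choose g hgm s hs hgs hgD using fun i => exists_continuousOn_implicit
    (hasStrictFDerivAt_detFun m (r i)) (detDeriv_ne_zero hm.1 (hD i))
  have hgc : ∀ i, ContinuousAt (g i) m := fun i => (hgs i).continuousAt (hs i)
  -- The quotient equals 1 at `m`, so near `m` it avoids the branch cut of the logarithm, whatever
  -- the argument of `ρ` at `m`.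
  let q : Fin 4 → M → ℂ := fun i y => rho y (g i y) / rho m (r i)
  have hqc : ∀ i, ContinuousAt (q i) m := fun i => by
    have h1 : ContinuousAt (fun z : M × ℂ => rho z.1 z.2) (m, g i m) :=
      continuousAt_rho hm (by rw [hgm, hD])
    exact (ContinuousAt.comp (f := fun y => (y, g i y)) h1
      (continuousAt_id.prodMk (hgc i))).div_const _
  have hqm : ∀ i, q i m = 1 := fun i => by
    simp only [q, hgm]
    exact div_self (rho_ne_zero hm (hD i))
  have hev : ∀ᶠ y in nhds m, y ∈ dnLocus ∧ (∀ i, y ∈ s i) ∧ (∀ i j, i ≠ j → g i y ≠ g j y) ∧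
      ∀ i, q i y ∈ Complex.slitPlane := by
    refine (isOpen_dnLocus.eventually_mem hm).and ((Filter.eventually_all.2 hs).and
      ((Filter.eventually_all.2 fun i => Filter.eventually_all.2 fun j => ?_).and
        (Filter.eventually_all.2 fun i => ?_)))
    · rcases eq_or_ne i j with hij | hij
      · simp [hij]
      · have hne : g i m - g j m ≠ 0 := by
          rw [hgm, hgm]
          exact sub_ne_zero.2 (hr.ne hij)
        filter_upwards [((hgc i).sub (hgc j)).eventually_ne hne] with y hy _
        exact sub_ne_zero.1 hy
    · exact (hqc i).eventually_mem (Complex.isOpen_slitPlane.mem_nhds (by simp [hqm]))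
  obtain ⟨V, hV, hVo, hmV⟩ := eventually_nhds_iff.1 hev
  have hgV : ∀ i, ContinuousOn (g i) V := fun i => (hgs i).mono fun y hy => (hV y hy).2.1 i
  have hDV : ∀ y ∈ V, ∀ i, detFun y (g i y) = 0 := fun y hy i =>
    (hgD i y ((hV y hy).2.1 i)).trans (hD i)
  refine ⟨V, hVo, hmV, g, fun i y => Complex.log (rho m (r i)) + Complex.log (q i y), hgV,
    fun i => continuousOn_const.add fun y hy => ?_, fun y hy => ?_, fun y hy i => ?_⟩
  · refine ContinuousWithinAt.clog ?_ ((hV y hy).2.2.2 i)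
    refine ContinuousWithinAt.div_const ?_ _
    exact ContinuousAt.comp_continuousWithinAt (f := fun y => (y, g i y))
      (continuousAt_rho (hV y hy).1 (hDV y hy i)) (continuousWithinAt_id.prodMk (hgV i y hy))
  · refine roots_det_calG_eq (mem_regLocus.1 (hV y hy).1.1).2.1 (fun i j hij => ?_) (hDV y hy)
    by_contra hne
    exact (hV y hy).2.2.1 i j hne hij
  · rw [Complex.exp_add, Complex.exp_log (rho_ne_zero hm (hD i)),
      Complex.exp_log (Complex.slitPlane_ne_zero ((hV y hy).2.2.2 i)),
      mul_div_cancel₀ _ (rho_ne_zero hm (hD i))]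

/-! ### The chart of the leaf -/

/-- The roots, the `log ρ` and the Casimirs, as one map. -/
def chartMap (lam mu : Fin 4 → M → ℂ) (x : M) : (Fin 4 → ℂ) × (Fin 4 → ℂ) × (Fin 4 → ℂ) :=
  (fun i => lam i x, fun i => mu i x, fun i => casimir i x)

/-- The derivative of `chartMap`. -/
def chartDeriv (x : M) (r k : Fin 4 → ℂ) :
    M →L[ℂ] (Fin 4 → ℂ) × (Fin 4 → ℂ) × (Fin 4 → ℂ) :=
  (ContinuousLinearMap.pi fun i => covec (lamForm x (r i))).prod
    ((ContinuousLinearMap.pi fun i => covec (muForm x (r i) (k i))).prod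
      (ContinuousLinearMap.pi fun i => covec (gradCasimir x i)))

section Branch

variable {V : Set M} {lam mu : Fin 4 → M → ℂ}

theorem IsBranch.detFun_eq (h : IsBranch V lam mu) {x : M} (hx : x ∈ V) (i : Fin 4) :
    detFun x (lam i x) = 0 := by
  rw [← eval_det_calG]
  refine isRoot_of_mem_roots ?_
  rw [h.roots_eq x hx]
  exact Multiset.mem_map_of_mem (fun i => lam i x) (Finset.mem_univ i)

theorem IsBranch.injective (h : IsBranch V lam mu) {x : M} (hx : x ∈ V) (hd : x ∈ regLocus) :
    Function.Injective fun i => lam i x := by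
  have hnd := nodup_roots hd.2.2
  rw [h.roots_eq x hx] at hnd
  exact fun i j hij => Multiset.inj_on_of_nodup_map hnd i (Finset.mem_univ i) j
    (Finset.mem_univ j) hij

theorem IsBranch.hasStrictFDerivAt_lam (h : IsBranch V lam mu) (hV : IsOpen V) {x : M} (hx : x ∈ V)
    (hd : x ∈ regLocus) (i : Fin 4) :
    HasStrictFDerivAt (lam i) (covec (lamForm x (lam i x))) x :=
  Toda.hasStrictFDerivAt_lam hd ((h.continuousOn_lam i).continuousAt (hV.mem_nhds hx))
    (Filter.eventually_of_mem (hV.mem_nhds hx) fun _ hy => h.detFun_eq hy i)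

theorem IsBranch.exists_hasStrictFDerivAt_mu (h : IsBranch V lam mu) (hV : IsOpen V) {x : M}
    (hx : x ∈ V) (hd : x ∈ dnLocus) : ∃ k : Fin 4 → ℂ, ∀ i,
      HasStrictFDerivAt (mu i) (covec (muForm x (lam i x) (k i))) x :=
  Classical.skolem.1 fun i => Toda.exists_hasStrictFDerivAt_mu hd
    ((h.continuousOn_lam i).continuousAt (hV.mem_nhds hx))
    (Filter.eventually_of_mem (hV.mem_nhds hx) fun _ hy => h.detFun_eq hy i)
    ((h.continuousOn_mu i).continuousAt (hV.mem_nhds hx))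
    (Filter.eventually_of_mem (hV.mem_nhds hx) fun y hy => h.exp_mu y hy i)

theorem hasStrictFDerivAt_casimir (x : M) (i : Fin 4) :
    HasStrictFDerivAt (casimir i) (covec (gradCasimir x i)) x :=
  (contDiff_casimir i).contDiffAt.hasStrictFDerivAt' (hasFDerivAt_casimir x i) (by simp)

theorem hasStrictFDerivAt_chartMap {x : M} {r k : Fin 4 → ℂ}
    (hl : ∀ i, HasStrictFDerivAt (lam i) (covec (lamForm x (r i))) x)
    (hm : ∀ i, HasStrictFDerivAt (mu i) (covec (muForm x (r i) (k i))) x) :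
    HasStrictFDerivAt (chartMap lam mu) (chartDeriv x r k) x :=
  (hasStrictFDerivAt_pi.2 hl).prodMk ((hasStrictFDerivAt_pi.2 hm).prodMk
    (hasStrictFDerivAt_pi.2 (hasStrictFDerivAt_casimir x)))

/-- A vector in the kernel is tangent to the leaf by its Casimir components, and it is then zero
because the eigenforms separate tangent vectors. Both spaces have dimension 12. -/
theorem exists_equiv_chartDeriv {x : M} (hx : x ∈ dnLocus) {r : Fin 4 → ℂ}
    (hr : Function.Injective r) (hD : ∀ i, detFun x (r i) = 0) (k : Fin 4 → ℂ) :
    ∃ e : M ≃L[ℂ] (Fin 4 → ℂ) × (Fin 4 → ℂ) × (Fin 4 → ℂ),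
      (e : M →L[ℂ] (Fin 4 → ℂ) × (Fin 4 → ℂ) × (Fin 4 → ℂ)) = chartDeriv x r k := by
  have hinj : Function.Injective (chartDeriv x r k).toLinearMap := by
    rw [injective_iff_map_eq_zero]
    intro v hv
    have h1 := Prod.ext_iff.1 hv
    have h2 := Prod.ext_iff.1 h1.2
    exact eq_zero_of_eigenforms hx hr hD (mem_tangent.2 fun i => congrFun h2.2 i)
      (fun i => congrFun h1.1 i) fun i => congrFun h2.1 i
  have hdim : Module.finrank ℂ M = Module.finrank ℂ ((Fin 4 → ℂ) × (Fin 4 → ℂ) × (Fin 4 → ℂ)) := by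
    simp [Module.finrank_prod]
  refine ⟨(LinearMap.linearEquivOfInjective _ hinj hdim).toContinuousLinearEquiv, ?_⟩
  ext v <;> rfl

theorem leafDiff_eq {F : M → ℂ} {x ξ : M} (h : HasStrictFDerivAt F (covec ξ) x) :
    leafDiff F x = (covec ξ).toLinearMap ∘ₗ (tangent x).subtype := by
  rw [leafDiff, diff_eq h.hasFDerivAt]

theorem leafDiff_restrict_tensorP {F F' : M → ℂ} {x ξ ξ' : M}
    (h : HasStrictFDerivAt F (covec ξ) x) (h' : HasStrictFDerivAt F' (covec ξ') x) :
    leafDiff F x (restrict x (tensorP x) (leafDiff F' x)) = covec ξ (tensorP x *ᵥ ξ') := by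
  rw [leafDiff_eq h, leafDiff_eq h', LinearMap.comp_apply, Submodule.subtype_apply,
    restrict_tensorP_covec]
  rfl

theorem chartDeriv_nijenhuis {x : M} (hx : x ∈ dnLocus) {r : Fin 4 → ℂ}
    (hD : ∀ i, detFun x (r i) = 0) (k : Fin 4 → ℂ) (v : tangent x) :
    chartDeriv x r k (nijenhuis x v) = (fun i => r i * covec (lamForm x (r i)) v,
      fun i => r i * covec (muForm x (r i) (k i)) v, 0) := by
  obtain ⟨hg, h, -⟩ := mem_regLocus.1 hx.1
  refine Prod.ext (funext fun i => ?_) (Prod.ext (funext fun i => ?_) (funext fun i => ?_))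
  · exact (covec_nijenhuis hg h (tensorQ_lamForm h (hD i)) v).trans (by simp [covec_smul])
  · exact (covec_nijenhuis hg h (tensorQ_muForm h (hD i) (k i)) v).trans (by simp [covec_smul])
  · exact mem_tangent.1 (nijenhuis x v).2 i

/-- In the local chart of `M` given by the roots, the `log ρ` and the Casimirs, the leaf is the
slice where the last four coordinates equal `κ`; the map `ι` below inserts these values. -/
theorem IsBranch.exists_isDarbouxNijenhuis (hb : IsBranch V lam mu) (hV : IsOpen V) {m : M}
    (hmV : m ∈ V) (hm : m ∈ dnLocus) (κ : Fin 4 → ℂ) :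
    ∃ U ⊆ V, m ∈ U ∧ ∃ W Ψ, IsDarbouxNijenhuis κ U lam mu lam W Ψ := by
  have hderiv : ∀ x ∈ V ∩ dnLocus, ∃ k : Fin 4 → ℂ,
      (∀ i, HasStrictFDerivAt (mu i) (covec (muForm x (lam i x) (k i))) x) ∧
      ∃ e : M ≃L[ℂ] (Fin 4 → ℂ) × (Fin 4 → ℂ) × (Fin 4 → ℂ),
        (e : M →L[ℂ] (Fin 4 → ℂ) × (Fin 4 → ℂ) × (Fin 4 → ℂ)) =
          chartDeriv x (fun i => lam i x) k ∧
        HasStrictFDerivAt (chartMap lam mu)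
          (e : M →L[ℂ] (Fin 4 → ℂ) × (Fin 4 → ℂ) × (Fin 4 → ℂ)) x := by
    rintro x ⟨hxV, hx⟩
    obtain ⟨k, hk⟩ := hb.exists_hasStrictFDerivAt_mu hV hxV hx
    obtain ⟨e, he⟩ := exists_equiv_chartDeriv hx (hb.injective hxV hx.1) (hb.detFun_eq hxV) k
    exact ⟨k, hk, e, he, he ▸ hasStrictFDerivAt_chartMap
      (hb.hasStrictFDerivAt_lam hV hxV hx.1) hk⟩
  obtain ⟨-, -, em, -, hem⟩ := hderiv m ⟨hmV, hm⟩
  let φ := (hem.toOpenPartialHomeomorph (chartMap lam mu)).restrOpen (V ∩ dnLocus)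
    (hV.inter isOpen_dnLocus)
  have hφ : ∀ x, φ x = chartMap lam mu x := fun x => rfl
  have hsource : ∀ x ∈ φ.source, x ∈ V ∩ dnLocus := fun x hx => hx.2
  let ι : (Fin 4 → ℂ) × (Fin 4 → ℂ) → (Fin 4 → ℂ) × (Fin 4 → ℂ) × (Fin 4 → ℂ) :=
    fun w => (w.1, w.2, κ)
  let L : (Fin 4 → ℂ) × (Fin 4 → ℂ) →L[ℂ] (Fin 4 → ℂ) × (Fin 4 → ℂ) × (Fin 4 → ℂ) :=
    (ContinuousLinearMap.fst ℂ _ _).prod ((ContinuousLinearMap.snd ℂ _ _).prod 0)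
  have hι : ∀ w, HasFDerivAt ι L w := fun w =>
    hasFDerivAt_fst.prodMk (hasFDerivAt_snd.prodMk (hasFDerivAt_const κ w))
  have hιφ : ∀ x ∈ leaf κ, ι (fun i => lam i x, fun i => mu i x) = φ x := fun x hx => by
    rw [hφ, chartMap, show (fun i => casimir i x) = κ from funext hx]
  have hinv : ∀ w, ι w ∈ φ.target → ∀ e : M ≃L[ℂ] (Fin 4 → ℂ) × (Fin 4 → ℂ) × (Fin 4 → ℂ),
      HasStrictFDerivAt (chartMap lam mu)
        (e : M →L[ℂ] (Fin 4 → ℂ) × (Fin 4 → ℂ) × (Fin 4 → ℂ)) (φ.symm (ι w)) →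
      HasFDerivAt (fun w => φ.symm (ι w))
        ((e.symm : (Fin 4 → ℂ) × (Fin 4 → ℂ) × (Fin 4 → ℂ) →L[ℂ] M) ∘L L) w :=
    fun w hw e he => (φ.hasFDerivAt_symm hw he.hasFDerivAt).comp w (hι w)
  refine ⟨φ.source, fun x hx => (hsource x hx).1,
    ⟨hem.mem_toOpenPartialHomeomorph_source, hmV, hm⟩, {w | ι w ∈ φ.target},
    fun w => φ.symm (ι w), ⟨φ.open_source, φ.open_target.preimage ?_, fun i x hx => ?_,
      fun i x hx => ?_, fun w hw => ?_, fun x hx => ?_, fun w hw => ⟨fun i => ?_, ?_⟩,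
      fun x hx => ?_, fun w hw => ?_⟩, fun x hx => ?_, fun x hx i j => ?_, fun x hx i j => ?_,
      fun x hx i j => ?_, fun x hx v => ?_⟩
  · exact continuous_fst.prodMk (continuous_snd.prodMk continuous_const)
  · exact (hb.hasStrictFDerivAt_lam hV (hsource x hx).1 (hsource x hx).2.1 i).differentiableAt
      |>.differentiableWithinAt
  · obtain ⟨k, hk, -⟩ := hderiv x (hsource x hx)
    exact (hk i).differentiableAt.differentiableWithinAt
  · obtain ⟨-, -, e, -, he⟩ := hderiv _ (hsource _ (φ.map_target hw))
    exact (hinv w hw e he).differentiableAt.differentiableWithinAt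
  · change ι _ ∈ φ.target
    rw [hιφ x hx.1]
    exact φ.map_source hx.2
  · exact congrFun (congrArg (fun z => z.2.2) (φ.right_inv hw)) i
  · exact φ.map_target hw
  · rw [hιφ x hx.1]
    exact φ.left_inv hx.2
  · exact congrArg (fun z => (z.1, z.2.1)) (φ.right_inv hw)
  · exact hb.injective (hsource x hx.2).1 (hsource x hx.2).2.1
  · obtain ⟨hxV, hxd⟩ := hsource x hx.2
    obtain ⟨k, hk, -⟩ := hderiv x ⟨hxV, hxd⟩
    rw [leafDiff_restrict_tensorP (hk i) (hb.hasStrictFDerivAt_lam hV hxV hxd.1 j)]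
    exact bracket_muForm_lamForm hxd (hb.injective hxV hxd.1) (hb.detFun_eq hxV) i j
  · obtain ⟨hxV, hxd⟩ := hsource x hx.2
    obtain ⟨k, hk, -⟩ := hderiv x ⟨hxV, hxd⟩
    rw [leafDiff_restrict_tensorP (hk i) (hk j)]
    exact bracket_muForm_muForm (mem_regLocus.1 hxd.1).2.1 (hb.injective hxV hxd.1)
      (hb.detFun_eq hxV) i j
  · obtain ⟨hxV, hxd⟩ := hsource x hx.2
    rw [leafDiff_restrict_tensorP (hb.hasStrictFDerivAt_lam hV hxV hxd.1 i)
      (hb.hasStrictFDerivAt_lam hV hxV hxd.1 j)]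
    exact bracket_lamForm_lamForm (mem_regLocus.1 hxd.1).2.1 (hb.injective hxV hxd.1)
      (hb.detFun_eq hxV) i j
  · obtain ⟨hxV, hxd⟩ := hsource x hx.2
    obtain ⟨k, hk, e, hek, he⟩ := hderiv x ⟨hxV, hxd⟩
    have hw : ι (fun i => lam i x, fun i => mu i x) ∈ φ.target := by
      rw [hιφ x hx.1]
      exact φ.map_source hx.2
    have hsymm : φ.symm (ι (fun i => lam i x, fun i => mu i x)) = x := by
      rw [hιφ x hx.1]
      exact φ.left_inv hx.2
    rw [(hinv _ hw e (hsymm.symm ▸ he)).fderiv]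
    -- The formula for `N` is checked after applying the derivative `e` of the chart, which sends
    -- the coordinate fields to standard basis vectors and turns `N` into multiplication by the
    -- `λᵢ`.
    refine e.injective ?_
    have hev : ∀ u, e u = chartDeriv x (fun i => lam i x) k u := fun u => by
      rw [← hek]
      rfl
    rw [hev, chartDeriv_nijenhuis hxd (hb.detFun_eq hxV)]
    simp only [map_sum, map_smul, map_add, ContinuousLinearMap.comp_apply,
      ContinuousLinearEquiv.coe_coe, ContinuousLinearEquiv.apply_symm_apply,
      leafDiff_eq (hk _), leafDiff_eq (hb.hasStrictFDerivAt_lam hV hxV hxd.1 _),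
      LinearMap.comp_apply, Submodule.subtype_apply, ContinuousLinearMap.coe_coe]
    refine Prod.ext (funext fun j => ?_) (Prod.ext (funext fun j => ?_) (funext fun j => ?_))
    · simp [L, Prod.fst_sum, Finset.sum_apply, Pi.single_apply]
    · simp [L, Prod.fst_sum, Prod.snd_sum, Finset.sum_apply, Pi.single_apply]
    · simp [L, Prod.snd_sum, Finset.sum_apply]

end Branch

end Toda
end

theorem proposition4 (κ : Fin 4 → ℂ) (hκ : Toda.IsGenericValue κ) :
    -- the leaf is 8-dimensional and `P` restricts to a symplectic structure on it
    ((Toda.leaf κ).Nonempty ∧ ∀ x ∈ Toda.leaf κ,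
      Module.finrank ℂ (Toda.tangent x) = 8 ∧
      Toda.IsRestriction x (Toda.tensorP x) (Toda.restrict x (Toda.tensorP x)) ∧
      Function.Bijective (Toda.restrict x (Toda.tensorP x))) ∧
    -- where `Q` is defined, it restricts to the leaf, `Det 𝒢(λ)` has degree 4, and its roots are
    -- the eigenvalues of `N`
    (∀ x ∈ Toda.leaf κ, (Toda.matG x).det ≠ 0 →
      Toda.IsRestriction x (Toda.tensorQ x) (Toda.restrict x (Toda.tensorQ x)) ∧
      (Toda.calG x).det.natDegree = 4 ∧
      ∀ l : ℂ, Module.End.HasEigenvalue (Toda.nijenhuis x) l ↔ (Toda.calG x).det.IsRoot l) ∧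
    -- the generic points form a dense open subset of the leaf
    (IsOpen Toda.regLocus ∧ IsOpen Toda.dnLocus ∧
      Toda.leaf κ ⊆ closure (Toda.leaf κ ∩ Toda.dnLocus)) ∧
    -- there, the minimal polynomial of `N` is the normalized `Det 𝒢(λ)`, and its coefficients are
    -- holomorphic functions which are functionally independent on the leaf
    (∀ x ∈ Toda.leaf κ ∩ Toda.regLocus,
      minpoly ℂ (Toda.nijenhuis x) =
        Polynomial.C ((Toda.calG x).det.leadingCoeff)⁻¹ * (Toda.calG x).det ∧
      ∀ i, AnalyticAt ℂ (Toda.coeffP i) x) ∧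
    (∀ x ∈ Toda.leaf κ ∩ Toda.dnLocus,
      LinearIndependent ℂ fun i => Toda.leafDiff (Toda.coeffP i) x) ∧
    -- the two ratios are Nijenhuis functions generators
    Toda.IsNijenhuisGenerator
      {z | z.1 ∈ Toda.regLocus ∧ (Toda.calG z.1 0 1).eval z.2 ≠ 0} Toda.rho ∧
    Toda.IsNijenhuisGenerator
      {z | z.1 ∈ Toda.regLocus ∧ (Toda.calG z.1 0 0).eval z.2 ≠ 0} Toda.sigma ∧
    -- the explicit form of `ρ`
    (∀ (x : Toda.M) (l : ℂ), Toda.rho x l =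
      -((-(Toda.c x 0 * Toda.a x 2) - Toda.a x 0 * Toda.c x 1) * l
          + Toda.c x 1 * Toda.a x 0 * Toda.b x 2 - Toda.a x 0 * Toda.a x 1 * Toda.a x 2
          + Toda.c x 0 * Toda.b x 1 * Toda.a x 2 + Toda.c x 0 * Toda.c x 1) /
        (l ^ 2 - (Toda.b x 1 + Toda.b x 2) * l + Toda.b x 1 * Toda.b x 2 + Toda.a x 1)) ∧
    -- the Hamiltonians of the flows are in involution for both restricted brackets
    (∀ x ∈ Toda.leaf κ, (Toda.matG x).det ≠ 0 → ∀ i j,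
      Toda.leafDiff (Toda.hamiltonian i) x
        (Toda.restrict x (Toda.tensorP x) (Toda.leafDiff (Toda.hamiltonian j) x)) = 0 ∧
      Toda.leafDiff (Toda.hamiltonian i) x
        (Toda.restrict x (Toda.tensorQ x) (Toda.leafDiff (Toda.hamiltonian j) x)) = 0) ∧
    -- around every generic point, the roots `λ_i` and `μ_i = log ρ(λ_i)` exist as continuous
    -- functions, and any such functions are Darboux-Nijenhuis coordinates on the leaf
    (∀ m ∈ Toda.leaf κ ∩ Toda.dnLocus,
      (∃ V, IsOpen V ∧ m ∈ V ∧ ∃ lam mu, Toda.IsBranch V lam mu) ∧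
      ∀ V, IsOpen V → m ∈ V → ∀ lam mu, Toda.IsBranch V lam mu →
        ∃ U ⊆ V, m ∈ U ∧ ∃ W Ψ, Toda.IsDarbouxNijenhuis κ U lam mu lam W Ψ) := by
  have hg : ∀ {x}, x ∈ Toda.leaf κ → Toda.IsGenericPoint x := fun hx =>
    Toda.isGenericPoint_of_leaf hκ hx
  refine ⟨⟨Toda.leaf_nonempty hκ, fun x hx => ⟨Toda.finrank_tangent (hg hx),
      Toda.isRestriction_tensorP x, Toda.bijective_restrict_tensorP (hg hx)⟩⟩,
    fun x hx h => ?_, ⟨Toda.isOpen_regLocus, Toda.isOpen_dnLocus, Toda.leaf_subset_closure hκ⟩,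
    fun x hx => ⟨?_, Toda.analyticAt_coeffP hx.2⟩, fun x hx => ?_,
    Toda.isNijenhuisGenerator_rho, Toda.isNijenhuisGenerator_sigma, Toda.rho_explicit,
    fun x hx h => Toda.hamiltonian_involution (Toda.det_matG_ne.1 h), fun m hm => ⟨?_, ?_⟩⟩
  · rw [Toda.det_matG_ne] at h
    refine ⟨Toda.isRestriction_tensorQ h, Toda.natDegree_det_calG h, fun l => ?_⟩
    rw [IsRoot.def, Toda.eval_det_calG, Toda.hasEigenvalue_iff (hg hx) h]
  · rw [Toda.minpoly_nijenhuis hx.2,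
      Toda.leadingCoeff_det_calG (Toda.mem_regLocus.1 hx.2).2.1]
  · exact Toda.linearIndependent_leafDiff_coeffP hx.2
  · exact Toda.exists_isBranch hm.2
  · exact fun V hV hmV lam mu hb => hb.exists_isDarbouxNijenhuis hV hmV hm.2 κ
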